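/- **Proposition.** Let $(M,J,g,\omega)$ be a compact connected Kähler manifold of complex dimension $m$, with $\omega=g(J\cdot,\cdot)$. Let $\mathfrak h$ be the complex vector space of Hamiltonian holomorphic vector fields, i.e. of holomorphic $(1,0)$-fields $\Xi$ for which there is a smooth $\zeta:M\to\mathbb C$ with $-\bar\partial\zeta=\frac12\,\omega(\Xi,-)$, where $\omega$ is extended complex bilinearly; let $\mathfrak h^*$ be its complex dual, and let $\mathfrak h_0\subset\mathfrak h$ be the set of the $\Xi=X-iJX\in\mathfrak h$ with $X$ a Killing field of $g$. For $\tilde\omega=\phi^*\omega$, where $\phi$ is a biholomorphism in the flow of an element of $\mathfrak h$, let $\xi_{\tilde\omega}:M\to\mathfrak h^*$ be the moment map: for $\Xi\in\mathfrak h$, the function $\zeta=\langle\xi_{\tilde\omega},\Xi\rangle$ is the unique smooth solution of $-\bar\partial\zeta=\frac12\,\tilde\omega(\Xi,-)$ with mean value zero for the Riemannian volume of the metric of $\tilde\omega$. For $\Xi=X-iJX$ and $\tilde\Xi=\tilde X-iJ\tilde X$ put $$(\tilde\Xi,\Xi)_{Her}=g(X,\tilde X)+i\,g(JX,\tilde X).$$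 For a constant $c\in\mathbb C$ (the normalisation of the exponential) and $\Xi\in\mathfrak h$ let $\phi_\Xi$ be the time-one flow of the real vector field $\mathrm{Re}(c\,\Xi)$, where $\mathrm{Re}(X-iJX)=X$. Let $p_1,\dots,p_n\in M$ and $a_1,\dots,a_n>0$, and put $$\mathfrak S_c(\Xi)=\sum_{j=1}^n a_j^{m-1}\,\xi_{\phi_\Xi^*\omega}(p_j)\in\mathfrak h^*,\qquad \Xi\in\mathfrak h.$$ Suppose that no nonzero element of $\mathfrak h$ vanishes at every $p_j$. Then $$L:\mathfrak h\to\mathfrak h^*,\qquad L(\Xi)=\tfrac12\sum_{j=1}^n a_j^{m-1}\,(\,\cdot\,,\Xi)_{Her}(p_j)$$ is a conjugate-linear isomorphism, and $(\tilde\Xi,\Xi)\mapsto L(\Xi)(\tilde\Xi)$ is a positive definite Hermitian form on $\mathfrak h$. Moreover, for every $c\in\mathbb C$ the map $\mathfrak S_c$ is real differentiable at $\Xi=0$, and its differential $D:\mathfrak h\to\mathfrak h^*$, which is real linear, satisfies: 1. $D(\Xi)=-2\,\mathrm{Im}(c)\,L(\Xi)$ and $D(i\,\Xi)=-2\,\mathrm{Re}(c)\,L(\Xi)$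 for all $\Xi\in\mathfrak h_0$. In particular $D=L$ on $\mathfrak h_0$ if $c=-\frac i2$. 2. The conjugate-linear part of $D$ is $\frac12\big(D(\Xi)+i\,D(i\,\Xi)\big)=-i\,\bar c\,L(\Xi)$ for all $\Xi\in\mathfrak h$. Hence it is an isomorphism $\mathfrak h\to\mathfrak h^*$ if $c\neq0$. 3. If $\mathrm{Im}(c)\neq0$, then $\Xi\mapsto\big(\mathrm{Re}\,D(\Xi)\big)|_{\mathfrak h_0}$ is an isomorphism from the real vector space $\mathfrak h_0$ onto its real dual. -/

import Mathlib

open scoped Manifold ContDiff ComplexConjugate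

noncomputable section

namespace KahlerMoment

/-! `M` is a complex manifold modelled on the finite-dimensional complex vector space `E`.
`TangentSpace 𝓘(ℂ, E) x` is the holomorphic tangent space `T^{1,0}_x M`, and
`TangentSpace 𝓘(ℝ, E) x` is the real tangent space; they are identified by `Ξ ↦ Z = Re Ξ`,
whose inverse is `Z ↦ Ξ = Z - i J Z`. -/

section Tensors

variable {E : Type*} [NormedAddCommGroup E] [NormedSpace ℂ E]
  {M : Type*} [TopologicalSpace M] [ChartedSpace E M]
  {N : Type*} [TopologicalSpace N] [ChartedSpace E N]

/-- The complex structure `J` on the real tangent space. -/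
def J (x : M) : TangentSpace 𝓘(ℝ, E) x →ₗ[ℝ] TangentSpace 𝓘(ℝ, E) x :=
  ((Complex.I • (LinearMap.id : E →ₗ[ℂ] E)).restrictScalars ℝ : E →ₗ[ℝ] E)

/-- The real vector `Z` such that the `(1,0)`-vector `Ξ` is `Z - i J Z`. -/
def reVec {x : M} (Ξ : TangentSpace 𝓘(ℂ, E) x) : TangentSpace 𝓘(ℝ, E) x := Ξ

variable (E M) in
/-- Real covariant 2-tensor fields (2-forms, metrics) on `M`. -/
abbrev TwoTensor : Type _ :=
  (x : M) → TangentSpace 𝓘(ℝ, E) x →ₗ[ℝ] TangentSpace 𝓘(ℝ, E) x →ₗ[ℝ] ℝ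

/-- Pull-back `φ^* β` of a 2-tensor field. -/
def pullback (φ : N → M) (β : TwoTensor E M) : TwoTensor E N := fun x =>
  (β (φ x)).compl₁₂ (mfderiv 𝓘(ℝ, E) 𝓘(ℝ, E) φ x).toLinearMap
    (mfderiv 𝓘(ℝ, E) 𝓘(ℝ, E) φ x).toLinearMap

/-- The coefficient `β_y(u, v)` of a 2-tensor field in the chart `e`, for `y` in the image of the
chart and constant vectors `u`, `v` of `E`. -/
def coeff (β : TwoTensor E M) (e : OpenPartialHomeomorph M E) (y u v : E) : ℝ :=
  pullback e.symm β y u v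

/-- A real vector field read in the chart `e`. -/
def fieldInChart (X : (x : M) → TangentSpace 𝓘(ℝ, E) x) (e : OpenPartialHomeomorph M E)
    (y : E) : E :=
  mfderiv 𝓘(ℝ, E) 𝓘(ℝ, E) e (e.symm y) (X (e.symm y))

/-- `Ω` is a Kähler form: a smooth closed `J`-invariant 2-form with `Ω(v, J v) > 0` for `v ≠ 0`. -/
structure IsKahlerForm (Ω : TwoTensor E M) : Prop where
  alt : ∀ x v w, Ω x v w = -Ω x w v
  invariant : ∀ x v w, Ω x (J x v) (J x w) = Ω x v w
  pos : ∀ x v, v ≠ 0 → 0 < Ω x v (J x v)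
  smooth : ∀ e ∈ atlas E M, ∀ u v : E, ContDiffOn ℝ ∞ (fun y => coeff Ω e y u v) e.target
  closed : ∀ e ∈ atlas E M, ∀ y ∈ e.target, ∀ u v w : E,
    fderiv ℝ (fun z => coeff Ω e z v w) y u + fderiv ℝ (fun z => coeff Ω e z w u) y v
      + fderiv ℝ (fun z => coeff Ω e z u v) y w = 0

/-- The metric `g(v, w) = Ω(v, J w)`. -/
def metric (Ω : TwoTensor E M) : TwoTensor E M := fun x => (Ω x).compl₂ (J x)

/-- `X` is a Killing field of `g`: the Lie derivative `L_X g` vanishes. -/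
def IsKilling (g : TwoTensor E M) (X : (x : M) → TangentSpace 𝓘(ℝ, E) x) : Prop :=
  ∀ e ∈ atlas E M, ∀ y ∈ e.target, ∀ u v : E,
    fderiv ℝ (fun z => coeff g e z u v) y (fieldInChart X e y)
      + coeff g e y (fderiv ℝ (fieldInChart X e) y u) v
      + coeff g e y u (fderiv ℝ (fieldInChart X e) y v) = 0

/-- `Ω(Ξ, v)`, where the 2-form `Ω` is extended complex bilinearly, for `Ξ = Z - i J Z`. -/
def contract (Ω : TwoTensor E M) (x : M) (Ξ : TangentSpace 𝓘(ℂ, E) x)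
    (v : TangentSpace 𝓘(ℝ, E) x) : ℂ :=
  (Ω x (reVec Ξ) v : ℂ) - Complex.I * (Ω x (J x (reVec Ξ)) v : ℂ)

/-- `(Ξ', Ξ)_Her = g(X, X') + i g(J X, X')` at `x`, for `Ξ = X - i J X`, `Ξ' = X' - i J X'`. -/
def herm (Ω : TwoTensor E M) (x : M) (Ξ' Ξ : TangentSpace 𝓘(ℂ, E) x) : ℂ :=
  (metric Ω x (reVec Ξ) (reVec Ξ') : ℂ)
    + Complex.I * (metric Ω x (J x (reVec Ξ)) (reVec Ξ') : ℂ)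

/-- The exterior derivative of a complex-valued function. -/
def dC (ζ : M → ℂ) (x : M) (v : TangentSpace 𝓘(ℝ, E) x) : ℂ :=
  mfderiv 𝓘(ℝ, E) 𝓘(ℝ, ℂ) ζ x v

/-- `(∂̄ζ)(v) = (dζ(v) + i dζ(J v)) / 2` for a real tangent vector `v`. -/
def dbar (ζ : M → ℂ) (x : M) (v : TangentSpace 𝓘(ℝ, E) x) : ℂ :=
  1 / 2 * (dC ζ x v + Complex.I * dC ζ x (J x v))

/-- `ζ` is a complex Hamiltonian of the `(1,0)`-field `Ξ`: `-∂̄ζ = ½ Ω(Ξ, -)`. -/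
def IsPotential (Ω : TwoTensor E M) (Ξ : (x : M) → TangentSpace 𝓘(ℂ, E) x) (ζ : M → ℂ) : Prop :=
  ContMDiff 𝓘(ℝ, E) 𝓘(ℝ, ℂ) ∞ ζ ∧
    ∀ (x : M) (v : TangentSpace 𝓘(ℝ, E) x), -dbar ζ x v = 1 / 2 * contract Ω x (Ξ x) v

theorem isPotential_zero (Ω : TwoTensor E M) :
    IsPotential Ω (0 : (x : M) → TangentSpace 𝓘(ℂ, E) x) (fun _ => 0) := by
  refine ⟨contMDiff_const, fun x v => ?_⟩
  have h0 : contract Ω x ((0 : (x : M) → TangentSpace 𝓘(ℂ, E) x) x) v = 0 := by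
    have h : reVec ((0 : (x : M) → TangentSpace 𝓘(ℂ, E) x) x) = 0 := rfl
    rw [contract, h]
    simp only [map_zero, LinearMap.zero_apply, Complex.ofReal_zero, mul_zero, sub_zero]
  have h1 : ∀ w, dC (E := E) (fun _ : M => (0 : ℂ)) x w = 0 := by
    intro w
    unfold dC
    rw [mfderiv_const]
    rfl
  rw [h0]
  simp [dbar, h1]

theorem isPotential_add {Ω : TwoTensor E M} {Ξ Ξ' : (x : M) → TangentSpace 𝓘(ℂ, E) x}
    {ζ ζ' : M → ℂ} (h : IsPotential Ω Ξ ζ) (h' : IsPotential Ω Ξ' ζ') :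
    IsPotential Ω (Ξ + Ξ') (ζ + ζ') := by
  refine ⟨h.1.add h'.1, fun x v => ?_⟩
  have h0 : reVec ((Ξ + Ξ') x) = reVec (Ξ x) + reVec (Ξ' x) := rfl
  have h1 : ∀ w, dC (E := E) (ζ + ζ') x w = dC ζ x w + dC ζ' x w := by
    intro w
    unfold dC
    rw [mfderiv_add (h.1.mdifferentiable (by simp) x) (h'.1.mdifferentiable (by simp) x)]
    rfl
  have e := h.2 x v
  have e' := h'.2 x v
  simp only [dbar, contract, h0, h1, map_add, LinearMap.add_apply, Complex.ofReal_add] at e e' ⊢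
  linear_combination e + e'

theorem isPotential_smul (c : ℂ) {Ω : TwoTensor E M} {Ξ : (x : M) → TangentSpace 𝓘(ℂ, E) x}
    {ζ : M → ℂ} (h : IsPotential Ω Ξ ζ) :
    IsPotential Ω (c • Ξ) (fun x => c * ζ x) := by
  refine ⟨(ContinuousLinearMap.mul ℝ ℂ c).contMDiff.comp h.1, fun x v => ?_⟩
  have h0 : reVec ((c • Ξ) x) = c.re • reVec (Ξ x) + c.im • J x (reVec (Ξ x)) := by
    have key : ∀ u : E, c • u = c.re • u + c.im • (Complex.I • u) := by
      intro u
      conv_lhs => rw [← Complex.re_add_im c]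
      rw [add_smul, mul_smul]
      rfl
    exact key (Ξ x)
  have h2 : ∀ z : TangentSpace 𝓘(ℝ, E) x, J x (J x z) = -z := by
    have key : ∀ u : E, Complex.I • (Complex.I • u) = -u := by
      intro u
      rw [smul_smul, Complex.I_mul_I, neg_one_smul]
    exact fun z => key z
  have h1 : ∀ w, dC (E := E) (fun y => c * ζ y) x w = c * dC ζ x w := by
    intro w
    have hd := (h.1.mdifferentiable (by simp) x).hasMFDerivAt
    have hc := ((ContinuousLinearMap.mul ℝ ℂ c).hasMFDerivAt (x := ζ x)).comp x hd
    exact congrArg (fun T => T w) hc.mfderiv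
  have e := h.2 x v
  simp only [dbar, contract, h0, h1, h2, map_add, map_smul, map_neg, LinearMap.add_apply,
    LinearMap.smul_apply, LinearMap.neg_apply, smul_eq_mul, Complex.ofReal_add,
    Complex.ofReal_mul, Complex.ofReal_neg] at e ⊢
  have hc := Complex.re_add_im c
  have hI := Complex.I_mul_I
  generalize dC ζ x v = d1 at *
  generalize dC ζ x (J x v) = d2 at *
  generalize (Ω x (reVec (Ξ x)) v : ℂ) = A at *
  generalize (Ω x (J x (reVec (Ξ x))) v : ℂ) = B at *
  linear_combination c * e - (1 / 2 * (A - Complex.I * B)) * hc - (1 / 2 * (c.im : ℂ) * B) * hI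

/-- The flow at time one of the real vector field `X` (which is complete if `M` is compact):
the value at time one of the integral curve of `X` starting at `x`. -/
def timeOneFlow (X : (x : M) → TangentSpace 𝓘(ℝ, E) x) (x : M) : M :=
  open Classical in
  if h : ∃ γ : ℝ → M, γ 0 = x ∧ IsMIntegralCurve (I := 𝓘(ℝ, E)) γ X then h.choose 1 else x

end Tensors

section Volume

variable {E : Type*} [NormedAddCommGroup E] [NormedSpace ℂ E] [FiniteDimensional ℂ E]
  [MeasurableSpace E] [BorelSpace E]
  {M : Type*} [TopologicalSpace M] [ChartedSpace E M] [MeasurableSpace M]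

/-- `ν` is the Riemannian volume of the metric `g`: in each chart it has density `√ det (g_{kl})`
with respect to the Lebesgue measure, both taken in the same basis of `E`. -/
def IsRiemannianVolume (g : TwoTensor E M) (ν : MeasureTheory.Measure M) : Prop :=
  ∀ e ∈ atlas E M, ∀ s : Set M, MeasurableSet s → s ⊆ e.source →
    ν s = ∫⁻ y in e '' s, ENNReal.ofReal (√ (Matrix.of fun k l =>
      coeff g e y (Module.finBasis ℝ E k) (Module.finBasis ℝ E l)).det)
        ∂(Module.finBasis ℝ E).addHaar

/-- The volume measure of the metric `g`. -/
def volumeOf (g : TwoTensor E M) : MeasureTheory.Measure M :=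
  Classical.epsilon (IsRiemannianVolume g)

end Volume

section MomentMap

variable {E : Type*} [NormedAddCommGroup E] [NormedSpace ℂ E]
  {M : Type*} [TopologicalSpace M] [ChartedSpace E M] [IsManifold 𝓘(ℂ, E) ω M]

/-- The space `𝔥` of Hamiltonian holomorphic vector fields of `(M, J, Ω)`: the holomorphic
`(1,0)`-fields that have a complex Hamiltonian. -/
def hamFields (Ω : TwoTensor E M) : Submodule ℂ ((x : M) → TangentSpace 𝓘(ℂ, E) x) where
  carrier := {Ξ | ContMDiff 𝓘(ℂ, E) 𝓘(ℂ, E).tangent ω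
      (fun x => (⟨x, Ξ x⟩ : TangentBundle 𝓘(ℂ, E) M)) ∧ ∃ ζ, IsPotential Ω Ξ ζ}
  zero_mem' := ⟨Bundle.contMDiff_zeroSection ℂ (TangentSpace 𝓘(ℂ, E) : M → Type _),
    _, isPotential_zero Ω⟩
  add_mem' := by
    rintro Ξ Ξ' ⟨h, ζ, hζ⟩ ⟨h', ζ', hζ'⟩
    exact ⟨h.add_section h', _, isPotential_add hζ hζ'⟩
  smul_mem' := by
    rintro c Ξ ⟨h, ζ, hζ⟩
    exact ⟨h.const_smul_section, _, isPotential_smul c hζ⟩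

variable [FiniteDimensional ℂ E] [MeasurableSpace E] [BorelSpace E] [MeasurableSpace M]

/-- `ξ : M → 𝔥^*` is the moment map of the Kähler form `Ω`: for `Ξ ∈ 𝔥`, the function
`p ↦ ⟨ξ(p), Ξ⟩` is a Hamiltonian of `Ξ` for `Ω` and has mean value zero. -/
def IsMomentMap (𝔥 : Submodule ℂ ((x : M) → TangentSpace 𝓘(ℂ, E) x)) (Ω : TwoTensor E M)
    (ξ : M → Module.Dual ℂ 𝔥) : Prop :=
  ∀ Ξ : 𝔥, IsPotential Ω Ξ.1 (fun p => ξ p Ξ) ∧ ∫ p, ξ p Ξ ∂(volumeOf (metric Ω)) = 0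

/-- The moment map `ξ_Ω : M → 𝔥^*`. -/
def momentMap (𝔥 : Submodule ℂ ((x : M) → TangentSpace 𝓘(ℂ, E) x)) (Ω : TwoTensor E M) :
    M → Module.Dual ℂ 𝔥 :=
  Classical.epsilon (IsMomentMap 𝔥 Ω)

/-- The biholomorphism `φ_Ξ`: the flow at time one of the real vector field `Re (c Ξ)`. The
constant `c` fixes the normalisation of the exponential of a `(1,0)`-field. -/
def expField (c : ℂ) (Ξ : (x : M) → TangentSpace 𝓘(ℂ, E) x) : M → M :=
  timeOneFlow (fun x => reVec ((c • Ξ) x))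

/-- The map `𝔖 (b, q, Ξ) = ∑_j b_j^{m-1} ξ_{φ_Ξ^* Ω}(q_j) ∈ 𝔥^*`, where `m = dim_ℂ M`. -/
def momentSum (Ω : TwoTensor E M) (c : ℂ) {n : ℕ} (b : Fin n → ℝ) (q : Fin n → M)
    (Ξ : hamFields Ω) : Module.Dual ℂ (hamFields Ω) :=
  ∑ j, ((b j : ℂ) ^ (Module.finrank ℂ E - 1)) •
    momentMap (hamFields Ω) (pullback (expField c Ξ.1) Ω) (q j)

/-- `F : 𝔥 → 𝔥^*` is real Fréchet differentiable at `Ξ₀` with differential `D`. (Stated for each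
component of `F`; the topology on `𝔥` is that of pointwise convergence, which is the norm topology
when `𝔥` is finite dimensional.) -/
def HasRealDifferentialAt {𝔥 : Submodule ℂ ((x : M) → TangentSpace 𝓘(ℂ, E) x)}
    (F : 𝔥 → Module.Dual ℂ 𝔥) (D : 𝔥 →ₗ[ℝ] Module.Dual ℂ 𝔥) (Ξ₀ : 𝔥) : Prop :=
  ∀ Ξ' : 𝔥, ∃ T : 𝔥 →L[ℝ] ℂ, (∀ Ξ, T Ξ = D Ξ Ξ') ∧ HasFDerivAt (fun Ξ => F Ξ Ξ') T Ξ₀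

end MomentMap

end KahlerMoment

end

noncomputable section

namespace KahlerMoment

open Set Filter Topology MeasureTheory

/-! ### Tangent maps, potentials and 2-tensors read in holomorphic charts -/

section Charts

variable {E : Type*} [NormedAddCommGroup E] [NormedSpace ℂ E]
  {M : Type*} [TopologicalSpace M] [ChartedSpace E M]
  {N : Type*} [TopologicalSpace N] [ChartedSpace E N]

/-! The sum is differentiated by naturality. Let `φ` be the time-one flow of the real field
`Re(cΞ)`. It is biholomorphic, it carries potentials and volume of the pulled back form to those of
the original one, and it acts on the space of Hamiltonian holomorphic fields by the exponential of
minus the bracket with `cΞ`. Uniqueness of normalised potentials therefore gives `ξ_{φ^*ω}(x)(Ξ') =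
ξ_ω(φ(x))(exp(-ad cΞ) Ξ')` (`momentMap_pullback`, `momentMap_timeOneFlow`). The form no longer
varies on the right, only the point `φ(x)` and a finite-dimensional exponential. For `c = 1` the
differential at zero is `dζ'(X) - ζ_{[Ξ,Ξ']}`, where `Ξ = X - iJX`, `ζ` and `ζ'` are the normalised
potentials of `Ξ` and `Ξ'`, and `ζ_{[Ξ,Ξ']}` is that of the bracket
(`exists_hasFDerivAt_momentMap`).

The normalised potential of the bracket is the complex bilinear Poisson bracket of `ζ` and `ζ'`. It
is a potential because `ω` is closed and of type (1,1) and the fields are holomorphic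
(`potentialEq_bracket`). It has mean value zero by Liouville's theorem (`bracketPot_eq_poisson`,
`integral_poisson`). It also equals half of `(dζ'(X) - i dζ'(JX)) - (dζ(X') - i dζ(JX'))`, so the
differential becomes `½(dζ'(X) + i dζ'(JX)) + ½(dζ(X') - i dζ(JX'))`. By the potential equation of
`ζ'` the first bracket is `-i/2` times the Hermitian form, which is conjugate linear in `Ξ`; the
second is complex linear in `Ξ` (`momentVariation_eq`). Replacing `Ξ` by `cΞ` and summing over the
points gives `D = -i c̄ L + c P` with `P` complex linear, whence the conjugate linear part.

If `X` is Killing, the complex Hessian of `Im ζ` is minus the Lie derivative of `ω` along `X`, hence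
zero. By the maximum principle `Im ζ` is then constant (`im_potential_const_of_isKilling`). So `dζ`
is real, conjugating the potential equation evaluates `P`, and `P = iL` on such fields. This gives
the two formulas for `D(Ξ)` and `D(iΞ)`.

The evaluation at the points `p_j` is injective, so the space of fields is finite dimensional and
`L` is positive definite. Both isomorphism statements follow by counting dimensions. -/

theorem isManifold_real (n : ℕ∞ω) [h : IsManifold 𝓘(ℂ, E) n M] : IsManifold 𝓘(ℝ, E) n M := by
  refine isManifold_of_contDiffOn _ _ _ fun e e' he he' => ?_
  have := (contDiffGroupoid n 𝓘(ℂ, E)).compatible he he'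
  rw [contDiffGroupoid, mem_groupoid_of_pregroupoid] at this
  exact this.1.restrict_scalars ℝ

/-- `HasMFDerivAt` with a derivative between the model spaces. -/
def HasTangentMapAt (𝕜 : Type*) [NontriviallyNormedField 𝕜] {F F' : Type*}
    [NormedAddCommGroup F] [NormedSpace 𝕜 F] [NormedAddCommGroup F'] [NormedSpace 𝕜 F']
    {N N' : Type*} [TopologicalSpace N] [ChartedSpace F N] [TopologicalSpace N']
    [ChartedSpace F' N'] (f : N → N') (f' : F →L[𝕜] F') (x : N) : Prop :=
  HasMFDerivAt 𝓘(𝕜, F) 𝓘(𝕜, F') f x f'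

section General

variable {𝕜 : Type*} [NontriviallyNormedField 𝕜] {F F' F'' : Type*}
    [NormedAddCommGroup F] [NormedSpace 𝕜 F] [NormedAddCommGroup F'] [NormedSpace 𝕜 F']
    [NormedAddCommGroup F''] [NormedSpace 𝕜 F'']
    {N N' N'' : Type*} [TopologicalSpace N] [ChartedSpace F N] [TopologicalSpace N']
    [ChartedSpace F' N'] [TopologicalSpace N''] [ChartedSpace F'' N'']

variable (𝕜) in
/-- `mfderiv` as a map between the model spaces. -/
def tangentMapAt (f : N → N') (x : N) : F →L[𝕜] F' := mfderiv 𝓘(𝕜, F) 𝓘(𝕜, F') f x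

theorem MDifferentiableAt.hasTangentMapAt {f : N → N'} {x : N}
    (h : MDifferentiableAt 𝓘(𝕜, F) 𝓘(𝕜, F') f x) :
    HasTangentMapAt 𝕜 f (tangentMapAt 𝕜 f x : F →L[𝕜] F') x :=
  h.hasMFDerivAt

theorem HasTangentMapAt.eq {f : N → N'} {x : N} {f' : F →L[𝕜] F'} (h : HasTangentMapAt 𝕜 f f' x) :
    tangentMapAt 𝕜 f x = f' :=
  HasMFDerivAt.mfderiv h

theorem HasTangentMapAt.mdifferentiableAt {f : N → N'} {x : N} {f' : F →L[𝕜] F'}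
    (h : HasTangentMapAt 𝕜 f f' x) : MDifferentiableAt 𝓘(𝕜, F) 𝓘(𝕜, F') f x :=
  HasMFDerivAt.mdifferentiableAt h

theorem HasTangentMapAt.comp {f : N → N'} {g : N' → N''} {x : N} {f' : F →L[𝕜] F'}
    {g' : F' →L[𝕜] F''} (hg : HasTangentMapAt 𝕜 g g' (f x)) (hf : HasTangentMapAt 𝕜 f f' x) :
    HasTangentMapAt 𝕜 (g ∘ f) (g'.comp f') x :=
  HasMFDerivAt.comp x hg hf

theorem hasTangentMapAt_iff_hasFDerivAt {f : F → F'} {x : F} {f' : F →L[𝕜] F'} :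
    HasTangentMapAt 𝕜 f f' x ↔ HasFDerivAt f f' x :=
  hasMFDerivAt_iff_hasFDerivAt

theorem HasTangentMapAt.congr_of_eventuallyEq {f g : N → N'} {x : N} {f' : F →L[𝕜] F'}
    (h : HasTangentMapAt 𝕜 f f' x) (hg : g =ᶠ[𝓝 x] f) : HasTangentMapAt 𝕜 g f' x :=
  HasMFDerivAt.congr_of_eventuallyEq h hg

end General

theorem HasTangentMapAt.real {E' : Type*} [NormedAddCommGroup E'] [NormedSpace ℂ E']
    {N : Type*} [TopologicalSpace N] [ChartedSpace E' N] {f : M → N} {x : M}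
    {f' : E →L[ℂ] E'} (h : HasTangentMapAt ℂ f f' x) :
    HasTangentMapAt ℝ f (f'.restrictScalars ℝ : E →L[ℝ] E') x := by
  refine ⟨h.1, ?_⟩
  have h2 : HasFDerivWithinAt (𝕜 := ℂ) (E := E) (F := E')
    (writtenInExtChartAt 𝓘(ℂ, E) 𝓘(ℂ, E') x f) f' (range 𝓘(ℂ, E)) (extChartAt 𝓘(ℂ, E) x x) := h.2
  exact h2.restrictScalars ℝ

theorem contMDiffAt_real {E' : Type*} [NormedAddCommGroup E'] [NormedSpace ℂ E']
    {N : Type*} [TopologicalSpace N] [ChartedSpace E' N] {f : M → N} {x : M} {n : ℕ∞ω}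
    (h : ContMDiffAt 𝓘(ℂ, E) 𝓘(ℂ, E') n f x) : ContMDiffAt 𝓘(ℝ, E) 𝓘(ℝ, E') n f x := by
  rw [contMDiffAt_iff] at h ⊢
  exact ⟨h.1, h.2.restrict_scalars ℝ⟩

/-- A 2-tensor at a point, as a bilinear form on the model space. -/
def form (β : TwoTensor E M) (x : M) : E →ₗ[ℝ] E →ₗ[ℝ] ℝ := β x

/-- A holomorphic field as a map to the model space. -/
def vec (Ξ : (x : M) → TangentSpace 𝓘(ℂ, E) x) (x : M) : E := Ξ x

/-- The reading of a `(1,0)`-field in a chart. -/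
def reading (Ξ : (x : M) → TangentSpace 𝓘(ℂ, E) x) (e : OpenPartialHomeomorph M E) : E → E :=
  fieldInChart (fun x => reVec (Ξ x)) e

theorem form_metric (Ω : TwoTensor E M) (x : M) (u v : E) :
    form (metric Ω) x u v = form Ω x u (Complex.I • v) := rfl

/-- The potential equation is multiplied by `-2` and transferred to the model space, where `J` is
multiplication by `i` and no tangent space types obstruct rewriting. -/
theorem isPotential_iff {Ω : TwoTensor E M} {Ξ : (x : M) → TangentSpace 𝓘(ℂ, E) x}
    {ζ : M → ℂ} : IsPotential Ω Ξ ζ ↔ ContMDiff 𝓘(ℝ, E) 𝓘(ℝ, ℂ) ∞ ζ ∧ ∀ (x : M) (v : E),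
      tangentMapAt ℝ ζ x v + Complex.I * tangentMapAt ℝ ζ x (Complex.I • v : E) =
      -(form Ω x (vec Ξ x) v : ℂ) + Complex.I * (form Ω x (Complex.I • vec Ξ x) v : ℂ) := by
  have e1 (x : M) (v : E) : -dbar ζ x v = -(1 / 2 * (tangentMapAt ℝ ζ x v
    + Complex.I * tangentMapAt ℝ ζ x (Complex.I • v : E))) := rfl
  have e2 (x : M) (v : E) : contract Ω x (Ξ x) v = (form Ω x (vec Ξ x) v : ℂ)
    - Complex.I * (form Ω x (Complex.I • vec Ξ x) v : ℂ) := rfl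
  constructor
  · refine fun ⟨h1, h⟩ => ⟨h1, fun x v => ?_⟩
    have h := h x v
    rw [e1, e2] at h
    linear_combination (-2 : ℂ) * h
  · refine fun ⟨h1, h⟩ => ⟨h1, fun x v => (e1 x v).trans
      (Eq.trans ?_ (congrArg (fun z => 1 / 2 * z) (e2 x v)).symm)⟩
    linear_combination (-1 / 2 : ℂ) * h x v

theorem form_pullback (φ : N → M) (β : TwoTensor E M) (x : N) (u v : E) :
    form (pullback φ β) x u v =
      form β (φ x) ((tangentMapAt ℝ φ x : E →L[ℝ] E) u) ((tangentMapAt ℝ φ x : E →L[ℝ] E) v) := rfl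

theorem herm_eq (Ω : TwoTensor E M) (x : M) (Ξ' Ξ : (x : M) → TangentSpace 𝓘(ℂ, E) x) :
    herm Ω x (Ξ' x) (Ξ x) = (form Ω x (vec Ξ x) (Complex.I • vec Ξ' x) : ℂ)
      + Complex.I * (form Ω x (Complex.I • vec Ξ x) (Complex.I • vec Ξ' x) : ℂ) := rfl

theorem form_alt {Ω : TwoTensor E M} (h : IsKahlerForm Ω) (x : M) (u v : E) :
    form Ω x u v = -form Ω x v u := h.alt x u v

theorem form_I_I {Ω : TwoTensor E M} (h : IsKahlerForm Ω) (x : M) (u v : E) :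
    form Ω x (Complex.I • u) (Complex.I • v) = form Ω x u v := h.invariant x u v

theorem form_pos {Ω : TwoTensor E M} (h : IsKahlerForm Ω) (x : M) {v : E} (hv : v ≠ 0) :
    0 < form Ω x v (Complex.I • v) := h.pos x v hv

variable [IsManifold 𝓘(ℂ, E) ω M]

/-- The derivative of a chart, at the point with coordinate `y`. -/
def chartCoframe (e : OpenPartialHomeomorph M E) (y : E) : E →L[ℂ] E :=
  tangentMapAt ℂ e (e.symm y)

/-- The derivative of the inverse of a chart. -/
def chartFrame (e : OpenPartialHomeomorph M E) (y : E) : E →L[ℂ] E :=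
  tangentMapAt ℂ e.symm y

theorem hasTangentMapAt_chart {e : OpenPartialHomeomorph M E} (he : e ∈ atlas E M) {y : E}
    (hy : y ∈ e.target) : HasTangentMapAt ℂ e (chartCoframe e y) (e.symm y) := by
  have : IsManifold 𝓘(ℂ, E) 1 M := IsManifold.of_le (n := ω) le_top
  exact (mdifferentiableAt_atlas he (e.map_target hy)).hasMFDerivAt

theorem hasTangentMapAt_chart_symm {e : OpenPartialHomeomorph M E} (he : e ∈ atlas E M) {y : E}
    (hy : y ∈ e.target) : HasTangentMapAt ℂ e.symm (chartFrame e y) y := by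
  have : IsManifold 𝓘(ℂ, E) 1 M := IsManifold.of_le (n := ω) le_top
  exact (mdifferentiableAt_atlas_symm he hy).hasMFDerivAt

theorem chartFrame_chartCoframe {e : OpenPartialHomeomorph M E} (he : e ∈ atlas E M) {y : E}
    (hy : y ∈ e.target) (v : E) : chartFrame e y (chartCoframe e y v) = v := by
  have : IsManifold 𝓘(ℂ, E) 1 M := IsManifold.of_le (n := ω) le_top
  have h := (mdifferentiable_of_mem_atlas (I := 𝓘(ℂ, E)) he).symm_comp_deriv (e.map_target hy)
  rw [e.right_inv hy] at h
  exact DFunLike.congr_fun h v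

theorem chartCoframe_chartFrame {e : OpenPartialHomeomorph M E} (he : e ∈ atlas E M) {y : E}
    (hy : y ∈ e.target) (v : E) : chartCoframe e y (chartFrame e y v) = v := by
  have : IsManifold 𝓘(ℂ, E) 1 M := IsManifold.of_le (n := ω) le_top
  have h := (mdifferentiable_of_mem_atlas (I := 𝓘(ℂ, E)) he).comp_symm_deriv hy
  exact DFunLike.congr_fun h v

theorem reading_eq (Ξ : (x : M) → TangentSpace 𝓘(ℂ, E) x)
    {e : OpenPartialHomeomorph M E} (he : e ∈ atlas E M) {y : E} (hy : y ∈ e.target) :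
    reading Ξ e y = chartCoframe e y (vec Ξ (e.symm y)) :=
  DFunLike.congr_fun (hasTangentMapAt_chart he hy).real.eq (vec Ξ (e.symm y))

theorem chartFrame_reading (Ξ : (x : M) → TangentSpace 𝓘(ℂ, E) x)
    {e : OpenPartialHomeomorph M E} (he : e ∈ atlas E M) {y : E} (hy : y ∈ e.target) :
    chartFrame e y (reading Ξ e y) = vec Ξ (e.symm y) := by
  rw [reading_eq Ξ he hy, chartFrame_chartCoframe he hy]

theorem coeff_eq (β : TwoTensor E M)
    {e : OpenPartialHomeomorph M E} (he : e ∈ atlas E M) {y : E} (hy : y ∈ e.target) (u v : E) :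
    coeff β e y u v = form β (e.symm y) (chartFrame e y u) (chartFrame e y v) := by
  have h : coeff β e y u v = form β (e.symm y) ((tangentMapAt ℝ e.symm y : E →L[ℝ] E) u)
    ((tangentMapAt ℝ e.symm y : E →L[ℝ] E) v) := rfl
  rw [h, (hasTangentMapAt_chart_symm he hy).real.eq]
  rfl

theorem coeff_metric {Ω : TwoTensor E M}
    {e : OpenPartialHomeomorph M E} (he : e ∈ atlas E M) {y : E} (hy : y ∈ e.target) (u v : E) :
    coeff (metric Ω) e y u v = coeff Ω e y u (Complex.I • v) := by
  rw [coeff_eq _ he hy, coeff_eq _ he hy, map_smul, form_metric]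

theorem hasFDerivAt_comp_chart_symm {F : Type*} [NormedAddCommGroup F] [NormedSpace ℝ F]
    {ζ : M → F} {e : OpenPartialHomeomorph M E} (he : e ∈ atlas E M)
    {y : E} (hy : y ∈ e.target)
    (hζ : MDifferentiableAt 𝓘(ℝ, E) 𝓘(ℝ, F) ζ (e.symm y)) :
    HasFDerivAt (ζ ∘ e.symm) ((tangentMapAt ℝ ζ (e.symm y) : E →L[ℝ] F).comp
      ((chartFrame e y).restrictScalars ℝ)) y :=
  hasTangentMapAt_iff_hasFDerivAt.1
    ((MDifferentiableAt.hasTangentMapAt hζ).comp (hasTangentMapAt_chart_symm he hy).real)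

theorem tangentMapAt_chartFrame {F : Type*} [NormedAddCommGroup F] [NormedSpace ℝ F]
    {ζ : M → F} {e : OpenPartialHomeomorph M E} (he : e ∈ atlas E M)
    {y : E} (hy : y ∈ e.target)
    (hζ : MDifferentiableAt 𝓘(ℝ, E) 𝓘(ℝ, F) ζ (e.symm y)) (u : E) :
    tangentMapAt ℝ ζ (e.symm y) (chartFrame e y u) = fderiv ℝ (ζ ∘ e.symm) y u := by
  rw [(hasFDerivAt_comp_chart_symm he hy hζ).fderiv]
  rfl

theorem contDiffOn_comp_chart_symm {F : Type*} [NormedAddCommGroup F] [NormedSpace ℝ F]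
    {ζ : M → F} {n : ℕ∞ω} (hζ : ContMDiff 𝓘(ℝ, E) 𝓘(ℝ, F) n ζ)
    {e : OpenPartialHomeomorph M E} (he : e ∈ atlas E M) :
    ContDiffOn ℝ n (ζ ∘ e.symm) e.target := by
  have : IsManifold 𝓘(ℝ, E) ω M := isManifold_real ω
  rw [← contMDiffOn_iff_contDiffOn]
  have h1 : ContMDiffOn 𝓘(ℝ, E) 𝓘(ℝ, E) n e.symm e.target :=
    (contMDiffOn_symm_of_mem_maximalAtlas (I := 𝓘(ℝ, E)) (n := ω)
      (IsManifold.subset_maximalAtlas he)).of_le le_top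
  exact hζ.comp_contMDiffOn h1

/-- The equation of a potential, read in a chart. -/
theorem IsPotential.chart_eq {Ω : TwoTensor E M} {Ξ : (x : M) → TangentSpace 𝓘(ℂ, E) x}
    {ζ : M → ℂ} (h : IsPotential Ω Ξ ζ) {e : OpenPartialHomeomorph M E} (he : e ∈ atlas E M)
    {y : E} (hy : y ∈ e.target) (u : E) :
    fderiv ℝ (ζ ∘ e.symm) y u + Complex.I * fderiv ℝ (ζ ∘ e.symm) y (Complex.I • u) =
      -(coeff Ω e y (reading Ξ e y) u : ℂ)
        + Complex.I * (coeff Ω e y (Complex.I • reading Ξ e y) u : ℂ) := by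
  obtain ⟨h1, h2⟩ := isPotential_iff.1 h
  have hd : MDifferentiableAt 𝓘(ℝ, E) 𝓘(ℝ, ℂ) ζ (e.symm y) := h1.mdifferentiable (by simp) _
  rw [← tangentMapAt_chartFrame he hy hd, ← tangentMapAt_chartFrame he hy hd, coeff_eq _ he hy,
    coeff_eq _ he hy, (chartFrame e y).map_smul, (chartFrame e y).map_smul,
    chartFrame_reading Ξ he hy]
  exact h2 _ _

/-- The equation at a point is tensorial, so the preferred chart at that point suffices; the
potential of a bracket is verified this way. -/
theorem isPotential_of_chart_eq {Ω : TwoTensor E M} {Ξ : (x : M) → TangentSpace 𝓘(ℂ, E) x}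
    {ζ : M → ℂ} (hζ : ContMDiff 𝓘(ℝ, E) 𝓘(ℝ, ℂ) ∞ ζ)
    (h : ∀ e ∈ atlas E M, ∀ y ∈ e.target, ∀ u : E, fderiv ℝ (ζ ∘ e.symm) y u
      + Complex.I * fderiv ℝ (ζ ∘ e.symm) y (Complex.I • u) =
      -(coeff Ω e y (reading Ξ e y) u : ℂ)
        + Complex.I * (coeff Ω e y (Complex.I • reading Ξ e y) u : ℂ)) :
    IsPotential Ω Ξ ζ := by
  refine isPotential_iff.2 ⟨hζ, fun x v => ?_⟩
  have hy : chartAt E x x ∈ (chartAt E x).target := mem_chart_target E x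
  have he := chart_mem_atlas E x
  have hx : (chartAt E x).symm (chartAt E x x) = x := (chartAt E x).left_inv (mem_chart_source E x)
  have hd : MDifferentiableAt 𝓘(ℝ, E) 𝓘(ℝ, ℂ) ζ ((chartAt E x).symm (chartAt E x x)) :=
    hζ.mdifferentiable (by simp) _
  have h1 := h _ he _ hy (chartCoframe (chartAt E x) (chartAt E x x) v)
  rw [← tangentMapAt_chartFrame he hy hd, ← tangentMapAt_chartFrame he hy hd, coeff_eq _ he hy,
    coeff_eq _ he hy, (chartFrame _ _).map_smul, (chartFrame _ _).map_smul, chartFrame_reading Ξ he hy,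
    chartFrame_chartCoframe he hy, hx] at h1
  exact h1

end Charts

/-! ### Holomorphic fields and their brackets in charts -/

section Readings

variable {E : Type*} [NormedAddCommGroup E] [NormedSpace ℂ E]
  {M : Type*} [TopologicalSpace M] [ChartedSpace E M] [IsManifold 𝓘(ℂ, E) ω M]

/-- The derivative of the inverse of a chart, as an equivalence. -/
def chartFrameEquiv {e : OpenPartialHomeomorph M E} (he : e ∈ atlas E M) {y : E}
    (hy : y ∈ e.target) : E ≃L[ℂ] E :=
  ContinuousLinearEquiv.equivOfInverse (chartFrame e y) (chartCoframe e y)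
    (chartCoframe_chartFrame he hy) (chartFrame_chartCoframe he hy)

/-- This identifies the reading of a field with its pull-back under the inverse chart, so that
naturality of smoothness and of the Lie bracket under pull-back can be used. -/
theorem mpullback_chart_symm (Ξ : (x : M) → TangentSpace 𝓘(ℂ, E) x)
    {e : OpenPartialHomeomorph M E} (he : e ∈ atlas E M) {y : E} (hy : y ∈ e.target) :
    VectorField.mpullback 𝓘(ℂ, E) 𝓘(ℂ, E) e.symm Ξ y = reading Ξ e y := by
  have h1 : VectorField.mpullback 𝓘(ℂ, E) 𝓘(ℂ, E) e.symm Ξ y =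
    (chartFrame e y).inverse (vec Ξ (e.symm y)) := rfl
  have h2 : (chartFrame e y).inverse = ((chartFrameEquiv he hy).symm : E →L[ℂ] E) :=
    ContinuousLinearMap.inverse_equiv (chartFrameEquiv he hy)
  rw [h1, h2, reading_eq Ξ he hy]
  rfl

theorem contMDiffAt_chart_symm {e : OpenPartialHomeomorph M E} (he : e ∈ atlas E M) {y : E}
    (hy : y ∈ e.target) : ContMDiffAt 𝓘(ℂ, E) 𝓘(ℂ, E) ω e.symm y :=
  contMDiffAt_symm_of_mem_maximalAtlas (IsManifold.subset_maximalAtlas he) hy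

theorem contMDiffAt_chart {e : OpenPartialHomeomorph M E} (he : e ∈ atlas E M) {x : M}
    (hx : x ∈ e.source) : ContMDiffAt 𝓘(ℂ, E) 𝓘(ℂ, E) ω e x :=
  contMDiffAt_of_mem_maximalAtlas (IsManifold.subset_maximalAtlas he) hx

theorem isInvertible_mfderiv_chart_symm {e : OpenPartialHomeomorph M E} (he : e ∈ atlas E M)
    {y : E} (hy : y ∈ e.target) :
    (mfderiv 𝓘(ℂ, E) 𝓘(ℂ, E) e.symm y).IsInvertible := by
  have h : (chartFrame e y).IsInvertible := ⟨chartFrameEquiv he hy, rfl⟩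
  exact h

theorem contDiffOn_reading [CompleteSpace E] {Ξ : (x : M) → TangentSpace 𝓘(ℂ, E) x}
    (h : ContMDiff 𝓘(ℂ, E) 𝓘(ℂ, E).tangent ω (fun x => (⟨x, Ξ x⟩ : TangentBundle 𝓘(ℂ, E) M)))
    {e : OpenPartialHomeomorph M E} (he : e ∈ atlas E M) :
    ContDiffOn ℂ ω (reading Ξ e) e.target := by
  have : IsManifold 𝓘(ℂ, E) 1 M := IsManifold.of_le (n := ω) le_top
  intro y hy
  have h1 := (h (e.symm y)).mpullback_vectorField_preimage (contMDiffAt_chart_symm he hy)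
    (isInvertible_mfderiv_chart_symm he hy) le_top
  rw [contMDiffAt_vectorSpace_iff_contDiffAt] at h1
  refine (h1.congr_of_eventuallyEq ?_).contDiffWithinAt
  filter_upwards [e.open_target.mem_nhds hy] with z hz
  exact (mpullback_chart_symm Ξ he hz).symm

theorem contMDiff_of_reading {Ξ : (x : M) → TangentSpace 𝓘(ℂ, E) x}
    (h : ∀ e ∈ atlas E M, ContDiffOn ℂ ω (reading Ξ e) e.target) :
    ContMDiff 𝓘(ℂ, E) 𝓘(ℂ, E).tangent ω (fun x => (⟨x, Ξ x⟩ : TangentBundle 𝓘(ℂ, E) M)) := by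
  have : IsManifold 𝓘(ℂ, E) 1 M := IsManifold.of_le (n := ω) le_top
  intro x
  rw [Bundle.contMDiffAt_section]
  have he := chart_mem_atlas E x
  have hx : x ∈ (chartAt E x).source := mem_chart_source E x
  have h1 : ContMDiffAt 𝓘(ℂ, E) 𝓘(ℂ, E) ω (reading Ξ (chartAt E x) ∘ chartAt E x) x :=
    ContMDiffAt.comp x
      ((h _ he).contDiffAt ((chartAt E x).open_target.mem_nhds (mem_chart_target E x))).contMDiffAt
      (contMDiffAt_chart he hx)
  refine h1.congr_of_eventuallyEq ?_
  filter_upwards [(chartAt E x).open_source.mem_nhds hx] with z hz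
  have h2 := DFunLike.congr_fun (TangentBundle.continuousLinearMapAt_trivializationAt
    (I := 𝓘(ℂ, E)) hz) (Ξ z)
  rw [Function.comp, reading_eq Ξ he ((chartAt E x).map_source hz), chartCoframe,
    (chartAt E x).left_inv hz]
  rw [Bundle.Trivialization.continuousLinearMapAt_apply,
    Bundle.Trivialization.linearMapAt_apply, if_pos (by exact hz)] at h2
  exact h2

theorem mlieBracket_vectorSpace (V W : E → E) (y : E) :
    VectorField.mlieBracket 𝓘(ℂ, E) (M := E) V W y = fderiv ℂ W y (V y) - fderiv ℂ V y (W y) := by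
  have h1 : VectorField.mlieBracket 𝓘(ℂ, E) (M := E) V W =
      VectorField.mlieBracketWithin 𝓘(ℂ, E) (M := E) V W univ :=
    VectorField.mlieBracketWithin_univ.symm
  have h2 : VectorField.mlieBracketWithin 𝓘(ℂ, E) (M := E) V W univ =
      VectorField.lieBracketWithin ℂ V W univ :=
    VectorField.mlieBracketWithin_eq_lieBracketWithin
  have h3 : VectorField.lieBracketWithin ℂ V W univ = VectorField.lieBracket ℂ V W :=
    VectorField.lieBracketWithin_univ
  exact congrFun (h1.trans (h2.trans h3)) y

/-- The Lie bracket of holomorphic fields. -/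
def bracket (Ξ Ξ' : (x : M) → TangentSpace 𝓘(ℂ, E) x) : (x : M) → TangentSpace 𝓘(ℂ, E) x :=
  VectorField.mlieBracket 𝓘(ℂ, E) Ξ Ξ'

/-- The bracket commutes with pull-back by the inverse chart, and on a vector space it is the
difference of the two directional derivatives. -/
theorem reading_bracket [CompleteSpace E] {Ξ Ξ' : (x : M) → TangentSpace 𝓘(ℂ, E) x}
    (h : ContMDiff 𝓘(ℂ, E) 𝓘(ℂ, E).tangent ω (fun x => (⟨x, Ξ x⟩ : TangentBundle 𝓘(ℂ, E) M)))
    (h' : ContMDiff 𝓘(ℂ, E) 𝓘(ℂ, E).tangent ω (fun x => (⟨x, Ξ' x⟩ : TangentBundle 𝓘(ℂ, E) M)))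
    {e : OpenPartialHomeomorph M E} (he : e ∈ atlas E M) {y : E} (hy : y ∈ e.target) :
    reading (bracket Ξ Ξ') e y = fderiv ℂ (reading Ξ' e) y (reading Ξ e y)
      - fderiv ℂ (reading Ξ e) y (reading Ξ' e y) := by
  have : IsManifold 𝓘(ℂ, E) (minSmoothness ℂ 2) M := IsManifold.of_le (n := ω) le_top
  have : IsManifold 𝓘(ℂ, E) (minSmoothness ℂ 2) E := IsManifold.of_le (n := ω) le_top
  have h1 := VectorField.mpullback_mlieBracket (I := 𝓘(ℂ, E)) (I' := 𝓘(ℂ, E)) (f := e.symm)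
    (x₀ := y) ((h.mdifferentiable (by simp)) (e.symm y)) ((h'.mdifferentiable (by simp)) (e.symm y))
    (contMDiffAt_chart_symm he hy) le_top
  have h2 := mpullback_chart_symm (bracket Ξ Ξ') he hy
  rw [← h2]
  refine Eq.trans h1 ((mlieBracket_vectorSpace
    (VectorField.mpullback 𝓘(ℂ, E) 𝓘(ℂ, E) e.symm Ξ)
    (VectorField.mpullback 𝓘(ℂ, E) 𝓘(ℂ, E) e.symm Ξ') y).trans ?_)
  have e1 (Ξ : (x : M) → TangentSpace 𝓘(ℂ, E) x) : @Filter.EventuallyEq E E (𝓝 y)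
      (VectorField.mpullback 𝓘(ℂ, E) 𝓘(ℂ, E) e.symm Ξ) (reading Ξ e) := by
    filter_upwards [e.open_target.mem_nhds hy] with z hz
    exact mpullback_chart_symm Ξ he hz
  rw [(e1 Ξ).fderiv_eq, (e1 Ξ').fderiv_eq, mpullback_chart_symm Ξ he hy,
    mpullback_chart_symm Ξ' he hy]

theorem contMDiff_bracket [CompleteSpace E] {Ξ Ξ' : (x : M) → TangentSpace 𝓘(ℂ, E) x}
    (h : ContMDiff 𝓘(ℂ, E) 𝓘(ℂ, E).tangent ω (fun x => (⟨x, Ξ x⟩ : TangentBundle 𝓘(ℂ, E) M)))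
    (h' : ContMDiff 𝓘(ℂ, E) 𝓘(ℂ, E).tangent ω (fun x => (⟨x, Ξ' x⟩ : TangentBundle 𝓘(ℂ, E) M))) :
    ContMDiff 𝓘(ℂ, E) 𝓘(ℂ, E).tangent ω
      (fun x => (⟨x, bracket Ξ Ξ' x⟩ : TangentBundle 𝓘(ℂ, E) M)) := by
  refine contMDiff_of_reading fun e he => ?_
  have c := contDiffOn_reading h he
  have c' := contDiffOn_reading h' he
  have d := c.fderiv_of_isOpen e.open_target (m := ω) le_top
  have d' := c'.fderiv_of_isOpen e.open_target (m := ω) le_top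
  exact ((d'.clm_apply c).sub (d.clm_apply c')).congr fun y hy => reading_bracket h h' he hy

end Readings

/-! ### The potential of a bracket on an open set of a vector space -/

section Local

variable {E : Type*} [NormedAddCommGroup E] [NormedSpace ℂ E]

/-- The second derivative of a function, in terms of its first derivative. -/
theorem hasFDerivAt_fderiv_of_contDiffOn {V F : Type*} [NormedAddCommGroup V]
    [NormedSpace ℝ V] [NormedAddCommGroup F] [NormedSpace ℝ F]
    {U : Set V} (hU : IsOpen U) {z : V → F} (hz : ContDiffOn ℝ 2 z U) {y : V} (hy : y ∈ U) :
    HasFDerivAt (fderiv ℝ z) (fderiv ℝ (fderiv ℝ z) y) y ∧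
      ∀ u v, fderiv ℝ (fderiv ℝ z) y u v = fderiv ℝ (fderiv ℝ z) y v u := by
  have h1 : ContDiffAt ℝ 2 z y := hz.contDiffAt (hU.mem_nhds hy)
  have h2 : ContDiffOn ℝ 1 (fderiv ℝ z) U := hz.fderiv_of_isOpen hU (by norm_num)
  refine ⟨((h2.differentiableOn (by simp)).differentiableAt (hU.mem_nhds hy)).hasFDerivAt,
    fun u v => ?_⟩
  exact (h1.isSymmSndFDerivAt (by simp)) u v

/-- The potential equation `2 ∂̄z = -b(F,-) + i b(iF,-)` on an open set of a vector space. -/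
def PotentialEq (b : E → E →L[ℝ] E →L[ℝ] ℝ) (F : E → E) (z : E → ℂ) (y : E) : Prop :=
  ∀ u, fderiv ℝ z y u + Complex.I * fderiv ℝ z y (Complex.I • u) =
      -(b y (F y) u : ℂ) + Complex.I * (b y (Complex.I • F y) u : ℂ)

theorem hasFDerivAt_I_smul {F : E → E} {F' : E →L[ℝ] E} {y : E} (h : HasFDerivAt F F' y) :
    HasFDerivAt (fun y => Complex.I • F y) (Complex.I • F') y :=
  h.const_smul Complex.I

/-- The derivative of the potential equation in a direction `w`. -/
theorem PotentialEq.fderiv {b : E → E →L[ℝ] E →L[ℝ] ℝ} {F : E → E} {z : E → ℂ} {U : Set E}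
    (hU : IsOpen U) (hb : DifferentiableOn ℝ b U) (hF : DifferentiableOn ℂ F U)
    (hz : ContDiffOn ℝ 2 z U) (h : ∀ y ∈ U, PotentialEq b F z y) {y : E} (hy : y ∈ U) (w u : E) :
    fderiv ℝ (fderiv ℝ z) y w u + Complex.I * fderiv ℝ (fderiv ℝ z) y w (Complex.I • u) =
      -((fderiv ℝ b y w (F y) u + b y (fderiv ℂ F y w) u : ℝ) : ℂ)
        + Complex.I * ((fderiv ℝ b y w (Complex.I • F y) u
          + b y (Complex.I • fderiv ℂ F y w) u : ℝ) : ℂ) := by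
  obtain ⟨h1, -⟩ := hasFDerivAt_fderiv_of_contDiffOn hU hz hy
  have hb' : HasFDerivAt b (_root_.fderiv ℝ b y) y :=
    (hb.differentiableAt (hU.mem_nhds hy)).hasFDerivAt
  have hF' : HasFDerivAt F ((_root_.fderiv ℂ F y).restrictScalars ℝ) y :=
    ((hF.differentiableAt (hU.mem_nhds hy)).hasFDerivAt).restrictScalars ℝ
  have hl := (h1.clm_apply (hasFDerivAt_const u y)).add
    ((h1.clm_apply (hasFDerivAt_const (Complex.I • u) y)).const_mul Complex.I)
  have r1 := (hb'.clm_apply hF').clm_apply (hasFDerivAt_const u y)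
  have r2 := (hb'.clm_apply (hasFDerivAt_I_smul hF')).clm_apply (hasFDerivAt_const u y)
  have hr := ((Complex.ofRealCLM.hasFDerivAt.comp y r1).neg).add
    ((Complex.ofRealCLM.hasFDerivAt.comp y r2).const_mul Complex.I)
  have he := hr.unique (hl.congr_of_eventuallyEq (by
    filter_upwards [hU.mem_nhds hy] with x hx
    exact (h x hx u).symm))
  have := DFunLike.congr_fun he w
  simp at this
  rw [← this]
  push_cast
  ring

/-- The potential of the bracket. -/
def bracketPotential (F G : E → E) (zF zG : E → ℂ) (y : E) : ℂ :=
  1 / 2 * (fderiv ℝ zG y (F y) - Complex.I * fderiv ℝ zG y (Complex.I • F y)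
    - (fderiv ℝ zF y (G y) - Complex.I * fderiv ℝ zF y (Complex.I • G y)))

/-- The candidate is the (1,0)-derivative of `zG` along `F` minus that of `zF` along `G`. Under
`2∂̄` the terms where a first derivative of `zG` meets `F'`, or one of `zF` meets `G'`, cancel,
since `F'` and `G'` are complex linear. The second derivatives are symmetric, hence given by the
potential equations differentiated along `F`, `iF`, `G`, `iG`. They produce the bracket and
derivatives of `b`, and the latter cancel by closedness and `J`-invariance. -/
theorem potentialEq_bracket {b : E → E →L[ℝ] E →L[ℝ] ℝ} {F G : E → E} {zF zG : E → ℂ} {U : Set E}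
    (hU : IsOpen U) (hb : DifferentiableOn ℝ b U) (halt : ∀ y ∈ U, ∀ u v, b y u v = - b y v u)
    (hinv : ∀ y ∈ U, ∀ u v, b y (Complex.I • u) (Complex.I • v) = b y u v)
    (hclosed : ∀ y ∈ U, ∀ u v w,
      fderiv ℝ b y u v w + fderiv ℝ b y v w u + fderiv ℝ b y w u v = 0)
    (hF : DifferentiableOn ℂ F U) (hG : DifferentiableOn ℂ G U)
    (hzF : ContDiffOn ℝ 2 zF U) (hzG : ContDiffOn ℝ 2 zG U)
    (h : ∀ y ∈ U, PotentialEq b F zF y) (h' : ∀ y ∈ U, PotentialEq b G zG y) {y : E} (hy : y ∈ U) :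
    PotentialEq b (fun y => fderiv ℂ G y (F y) - fderiv ℂ F y (G y))
      (bracketPotential F G zF zG) y := by
  intro u
  have hb' : HasFDerivAt b (fderiv ℝ b y) y := (hb.differentiableAt (hU.mem_nhds hy)).hasFDerivAt
  have alt' : ∀ w u v, fderiv ℝ b y w u v = - fderiv ℝ b y w v u := by
    intro w u v
    have h1 := (hb'.clm_apply (hasFDerivAt_const u y)).clm_apply (hasFDerivAt_const v y)
    have h2 := ((hb'.clm_apply (hasFDerivAt_const v y)).clm_apply (hasFDerivAt_const u y)).neg
    have he := h1.unique (h2.congr_of_eventuallyEq (by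
      filter_upwards [hU.mem_nhds hy] with x hx
      exact halt x hx u v))
    simpa using DFunLike.congr_fun he w
  have inv' : ∀ w u v, fderiv ℝ b y w (Complex.I • u) (Complex.I • v) = fderiv ℝ b y w u v := by
    intro w u v
    have h1 := (hb'.clm_apply (hasFDerivAt_const u y)).clm_apply (hasFDerivAt_const v y)
    have h2 := ((hb'.clm_apply (hasFDerivAt_const (Complex.I • u) y)).clm_apply
      (hasFDerivAt_const (Complex.I • v) y))
    have he := h2.unique (h1.congr_of_eventuallyEq (by
      filter_upwards [hU.mem_nhds hy] with x hx
      exact hinv x hx u v))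
    simpa using DFunLike.congr_fun he w
  obtain ⟨hF2, symF⟩ := hasFDerivAt_fderiv_of_contDiffOn hU hzF hy
  obtain ⟨hG2, symG⟩ := hasFDerivAt_fderiv_of_contDiffOn hU hzG hy
  have hF' : HasFDerivAt F ((fderiv ℂ F y).restrictScalars ℝ) y :=
    ((hF.differentiableAt (hU.mem_nhds hy)).hasFDerivAt).restrictScalars ℝ
  have hG' : HasFDerivAt G ((fderiv ℂ G y).restrictScalars ℝ) y :=
    ((hG.differentiableAt (hU.mem_nhds hy)).hasFDerivAt).restrictScalars ℝ
  have hd := ((((hG2.clm_apply hF').sub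
    ((hG2.clm_apply (hasFDerivAt_I_smul hF')).const_mul Complex.I)).sub
    ((hF2.clm_apply hG').sub
    ((hF2.clm_apply (hasFDerivAt_I_smul hG')).const_mul Complex.I))).const_mul (1 / 2 : ℂ))
  have hd' : HasFDerivAt (bracketPotential F G zF zG) _ y := hd
  have II : ∀ v : E, Complex.I • Complex.I • v = -v := fun v => by
    rw [smul_smul, Complex.I_mul_I, neg_one_smul]
  have a1 := PotentialEq.fderiv hU hb hG hzG h' hy (F y) u
  have a2 := PotentialEq.fderiv hU hb hG hzG h' hy (Complex.I • F y) u
  have a3 := PotentialEq.fderiv hU hb hF hzF h hy (G y) u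
  have a4 := PotentialEq.fderiv hU hb hF hzF h hy (Complex.I • G y) u
  have c1 := hclosed y hy (F y) (G y) u
  have c2 := hclosed y hy (Complex.I • F y) (Complex.I • G y) u
  have c3 := hclosed y hy (F y) (Complex.I • G y) u
  have c4 := hclosed y hy (Complex.I • F y) (G y) u
  have i1 := inv' u (F y) (G y)
  have i2 := inv' u (Complex.I • F y) (G y)
  rw [II] at i2
  rw [alt' (G y) u (F y)] at c1
  rw [alt' (Complex.I • G y) u (Complex.I • F y)] at c2
  rw [alt' (Complex.I • G y) u (F y)] at c3
  rw [alt' (G y) u (Complex.I • F y)] at c4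
  have hval : ∀ v, fderiv ℝ (bracketPotential F G zF zG) y v =
      1 / 2 * (fderiv ℝ (fderiv ℝ zG) y v (F y) + fderiv ℝ zG y (fderiv ℂ F y v)
        - Complex.I * (fderiv ℝ (fderiv ℝ zG) y v (Complex.I • F y)
          + fderiv ℝ zG y (Complex.I • fderiv ℂ F y v))
        - (fderiv ℝ (fderiv ℝ zF) y v (G y) + fderiv ℝ zF y (fderiv ℂ G y v)
        - Complex.I * (fderiv ℝ (fderiv ℝ zF) y v (Complex.I • G y)
          + fderiv ℝ zF y (Complex.I • fderiv ℂ G y v)))) := by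
    intro v
    rw [hd'.fderiv]
    simp
    ring
  have LF (v : E) : fderiv ℂ F y (Complex.I • v) = Complex.I • fderiv ℂ F y v :=
    (fderiv ℂ F y).map_smul _ _
  have LG (v : E) : fderiv ℂ G y (Complex.I • v) = Complex.I • fderiv ℂ G y v :=
    (fderiv ℂ G y).map_smul _ _
  rw [hval, hval, symG u, symG u, symG (Complex.I • u), symG (Complex.I • u), symF u, symF u,
    symF (Complex.I • u), symF (Complex.I • u)]
  simp only [LF, LG, II, smul_sub, (b y).map_sub, (b y).map_neg, (fderiv ℝ b y u).map_neg,
    (fderiv ℝ zF y).map_neg, (fderiv ℝ zG y).map_neg, _root_.sub_apply, _root_.neg_apply,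
    Complex.ofReal_add, Complex.ofReal_sub, Complex.ofReal_neg] at a1 a2 a3 a4 i1 i2 ⊢
  have d1 := congrArg Complex.ofReal c1
  have d2 := congrArg Complex.ofReal c2
  have d3 := congrArg Complex.ofReal c3
  have d4 := congrArg Complex.ofReal c4
  have j1 := congrArg Complex.ofReal i1
  have j2 := congrArg Complex.ofReal i2
  push_cast at d1 d2 d3 d4 j1 j2
  have hI := Complex.I_mul_I
  -- The `a`'s remove the second derivatives of the potentials, the `d`'s are closedness on the
  -- pairs formed from `F`, `iF` and `G`, `iG`, and the `j`'s are invariance of the form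
  -- differentiated along `u`.
  linear_combination (1 / 2 : ℂ) * a1 - Complex.I / 2 * a2 - (1 / 2 : ℂ) * a3
    + Complex.I / 2 * a4 - (1 / 2 : ℂ) * d1 + (1 / 2 : ℂ) * d2 + Complex.I / 2 * (d3 + d4)
    - (1 / 2 : ℂ) * j1 + Complex.I / 2 * j2
    + (1 / 2 : ℂ) * (fderiv ℝ zG y (fderiv ℂ F y u) - fderiv ℝ zF y (fderiv ℂ G y u)
      + b y (fderiv ℂ G y (F y)) u - b y (fderiv ℂ F y (G y)) u
      - fderiv ℝ b y (Complex.I • F y) (Complex.I • G y) u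
      + fderiv ℝ b y (Complex.I • G y) (Complex.I • F y) u) * hI

end Local

/-! ### Brackets of Hamiltonian holomorphic fields, and Killing fields -/

section Global

theorem two_le_infty : (2 : ℕ∞ω) ≤ ∞ := WithTop.coe_le_coe.2 (le_top : (2 : ℕ∞) ≤ ⊤)

variable {E : Type*} [NormedAddCommGroup E] [NormedSpace ℂ E] [FiniteDimensional ℂ E]
  {M : Type*} [TopologicalSpace M] [ChartedSpace E M]

/-- The reading of a 2-tensor in a chart, as a continuous bilinear form. -/
def coeffForm (β : TwoTensor E M) (e : OpenPartialHomeomorph M E) (y : E) :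
    E →L[ℝ] E →L[ℝ] ℝ :=
  haveI : FiniteDimensional ℝ E := FiniteDimensional.complexToReal E
  LinearMap.toContinuousLinearMap
    ((LinearMap.toContinuousLinearMap : (E →ₗ[ℝ] ℝ) ≃ₗ[ℝ] (E →L[ℝ] ℝ)).toLinearMap ∘ₗ
      (form (pullback e.symm β) y))

theorem coeffForm_apply (β : TwoTensor E M) (e : OpenPartialHomeomorph M E) (y u v : E) :
    coeffForm β e y u v = coeff β e y u v := rfl

theorem contDiffOn_coeffForm {Ω : TwoTensor E M} (hΩ : IsKahlerForm Ω)
    {e : OpenPartialHomeomorph M E} (he : e ∈ atlas E M) :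
    ContDiffOn ℝ ∞ (coeffForm Ω e) e.target := by
  have : FiniteDimensional ℝ E := FiniteDimensional.complexToReal E
  refine contDiffOn_clm_apply.2 fun u => contDiffOn_clm_apply.2 fun v => ?_
  exact hΩ.smooth e he u v

theorem differentiableOn_coeffForm {Ω : TwoTensor E M} (hΩ : IsKahlerForm Ω)
    {e : OpenPartialHomeomorph M E} (he : e ∈ atlas E M) :
    DifferentiableOn ℝ (coeffForm Ω e) e.target :=
  (contDiffOn_coeffForm hΩ he).differentiableOn (by simp)

theorem fderiv_coeff {Ω : TwoTensor E M} (hΩ : IsKahlerForm Ω)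
    {e : OpenPartialHomeomorph M E} (he : e ∈ atlas E M) {y : E} (hy : y ∈ e.target) (u v w : E) :
    fderiv ℝ (fun z => coeff Ω e z v w) y u = fderiv ℝ (coeffForm Ω e) y u v w := by
  have h := ((differentiableOn_coeffForm hΩ he).differentiableAt
    (e.open_target.mem_nhds hy)).hasFDerivAt
  have h2 := (h.clm_apply (hasFDerivAt_const v y)).clm_apply (hasFDerivAt_const w y)
  have h3 : HasFDerivAt (fun z => coeff Ω e z v w) _ y := h2
  rw [h3.fderiv]
  simp

theorem contMDiff_of_chart [IsManifold 𝓘(ℂ, E) ω M] {F : Type*} [NormedAddCommGroup F]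
    [NormedSpace ℝ F] {f : M → F} {n : ℕ∞ω}
    (h : ∀ e ∈ atlas E M, ContDiffOn ℝ n (f ∘ e.symm) e.target) :
    ContMDiff 𝓘(ℝ, E) 𝓘(ℝ, F) n f := by
  intro x
  have he := chart_mem_atlas E x
  have hx : x ∈ (chartAt E x).source := mem_chart_source E x
  have h1 : ContMDiffAt 𝓘(ℝ, E) 𝓘(ℝ, F) n ((f ∘ (chartAt E x).symm) ∘ chartAt E x) x :=
    ContMDiffAt.comp x
      ((h _ he).contDiffAt ((chartAt E x).open_target.mem_nhds (mem_chart_target E x))).contMDiffAt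
      ((contMDiffAt_real (contMDiffAt_chart he hx)).of_le le_top)
  refine h1.congr_of_eventuallyEq ?_
  filter_upwards [(chartAt E x).open_source.mem_nhds hx] with z hz
  simp [(chartAt E x).left_inv hz]

variable [IsManifold 𝓘(ℂ, E) ω M]

theorem coeff_alt {Ω : TwoTensor E M} (hΩ : IsKahlerForm Ω)
    {e : OpenPartialHomeomorph M E} (he : e ∈ atlas E M) {y : E} (hy : y ∈ e.target) (u v : E) :
    coeffForm Ω e y u v = -coeffForm Ω e y v u := by
  rw [coeffForm_apply, coeffForm_apply, coeff_eq _ he hy, coeff_eq _ he hy, form_alt hΩ]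

theorem coeff_I_I {Ω : TwoTensor E M} (hΩ : IsKahlerForm Ω)
    {e : OpenPartialHomeomorph M E} (he : e ∈ atlas E M) {y : E} (hy : y ∈ e.target) (u v : E) :
    coeffForm Ω e y (Complex.I • u) (Complex.I • v) = coeffForm Ω e y u v := by
  rw [coeffForm_apply, coeffForm_apply, coeff_eq _ he hy, coeff_eq _ he hy,
    (chartFrame e y).map_smul, (chartFrame e y).map_smul, form_I_I hΩ]

theorem coeff_pos {Ω : TwoTensor E M} (hΩ : IsKahlerForm Ω)
    {e : OpenPartialHomeomorph M E} (he : e ∈ atlas E M) {y : E} (hy : y ∈ e.target) {v : E}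
    (hv : v ≠ 0) : 0 < coeffForm Ω e y v (Complex.I • v) := by
  rw [coeffForm_apply, coeff_eq _ he hy, map_smul]
  refine form_pos hΩ _ fun h => hv ?_
  rw [← chartCoframe_chartFrame he hy v, h, map_zero]

theorem coeffForm_closed {Ω : TwoTensor E M} (hΩ : IsKahlerForm Ω)
    {e : OpenPartialHomeomorph M E} (he : e ∈ atlas E M) {y : E} (hy : y ∈ e.target) (u v w : E) :
    fderiv ℝ (coeffForm Ω e) y u v w + fderiv ℝ (coeffForm Ω e) y v w u
      + fderiv ℝ (coeffForm Ω e) y w u v = 0 := by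
  rw [← fderiv_coeff hΩ he hy, ← fderiv_coeff hΩ he hy, ← fderiv_coeff hΩ he hy]
  exact hΩ.closed e he y hy u v w

/-- The potential of the bracket of two fields with potentials `ζ` and `ζ'`. -/
def bracketPot (Ξ Ξ' : (x : M) → TangentSpace 𝓘(ℂ, E) x) (ζ ζ' : M → ℂ) (x : M) : ℂ :=
  1 / 2 * (tangentMapAt ℝ ζ' x (vec Ξ x)
      - Complex.I * tangentMapAt ℝ ζ' x (Complex.I • vec Ξ x : E)
    - (tangentMapAt ℝ ζ x (vec Ξ' x)
      - Complex.I * tangentMapAt ℝ ζ x (Complex.I • vec Ξ' x : E)))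

theorem bracketPot_chart {Ξ Ξ' : (x : M) → TangentSpace 𝓘(ℂ, E) x} {ζ ζ' : M → ℂ}
    (hζ : ContMDiff 𝓘(ℝ, E) 𝓘(ℝ, ℂ) ∞ ζ) (hζ' : ContMDiff 𝓘(ℝ, E) 𝓘(ℝ, ℂ) ∞ ζ')
    {e : OpenPartialHomeomorph M E} (he : e ∈ atlas E M) {y : E} (hy : y ∈ e.target) :
    bracketPot Ξ Ξ' ζ ζ' (e.symm y) =
      bracketPotential (reading Ξ e) (reading Ξ' e) (ζ ∘ e.symm) (ζ' ∘ e.symm) y := by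
  have d1 : MDifferentiableAt 𝓘(ℝ, E) 𝓘(ℝ, ℂ) ζ (e.symm y) := hζ.mdifferentiable (by simp) _
  have d2 : MDifferentiableAt 𝓘(ℝ, E) 𝓘(ℝ, ℂ) ζ' (e.symm y) := hζ'.mdifferentiable (by simp) _
  rw [bracketPot, bracketPotential, ← tangentMapAt_chartFrame he hy d1,
    ← tangentMapAt_chartFrame he hy d1, ← tangentMapAt_chartFrame he hy d2,
    ← tangentMapAt_chartFrame he hy d2, (chartFrame e y).map_smul, (chartFrame e y).map_smul,
    chartFrame_reading Ξ he hy, chartFrame_reading Ξ' he hy]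

/-- The global candidate reads in every chart as the local one, so the computation on an open set of
the model space applies. -/
theorem isPotential_bracket {Ω : TwoTensor E M} (hΩ : IsKahlerForm Ω)
    {Ξ Ξ' : (x : M) → TangentSpace 𝓘(ℂ, E) x} {ζ ζ' : M → ℂ}
    (h : ContMDiff 𝓘(ℂ, E) 𝓘(ℂ, E).tangent ω (fun x => (⟨x, Ξ x⟩ : TangentBundle 𝓘(ℂ, E) M)))
    (h' : ContMDiff 𝓘(ℂ, E) 𝓘(ℂ, E).tangent ω (fun x => (⟨x, Ξ' x⟩ : TangentBundle 𝓘(ℂ, E) M)))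
    (hζ : IsPotential Ω Ξ ζ) (hζ' : IsPotential Ω Ξ' ζ') :
    IsPotential Ω (bracket Ξ Ξ') (bracketPot Ξ Ξ' ζ ζ') := by
  have : CompleteSpace E := FiniteDimensional.complete ℂ E
  have hch : ∀ e ∈ atlas E M, EqOn (bracketPot Ξ Ξ' ζ ζ' ∘ e.symm)
      (bracketPotential (reading Ξ e) (reading Ξ' e) (ζ ∘ e.symm) (ζ' ∘ e.symm)) e.target :=
    fun e he y hy => bracketPot_chart hζ.1 hζ'.1 he hy
  refine isPotential_of_chart_eq (contMDiff_of_chart fun e he => ?_) fun e he y hy u => ?_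
  · refine ContDiffOn.congr ?_ (hch e he)
    have c1 := contDiffOn_comp_chart_symm hζ.1 he
    have c2 := contDiffOn_comp_chart_symm hζ'.1 he
    have d1 := c1.fderiv_of_isOpen e.open_target (m := ∞) (by simp)
    have d2 := c2.fderiv_of_isOpen e.open_target (m := ∞) (by simp)
    have r1 : ContDiffOn ℝ ∞ (reading Ξ e) e.target :=
      ((contDiffOn_reading h he).restrict_scalars ℝ).of_le le_top
    have r2 : ContDiffOn ℝ ∞ (reading Ξ' e) e.target :=
      ((contDiffOn_reading h' he).restrict_scalars ℝ).of_le le_top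
    have s1 : ContDiffOn ℝ ∞ (fun y => Complex.I • reading Ξ e y) e.target :=
      r1.const_smul Complex.I
    have s2 : ContDiffOn ℝ ∞ (fun y => Complex.I • reading Ξ' e y) e.target :=
      r2.const_smul Complex.I
    exact contDiffOn_const.mul (((d2.clm_apply r1).sub (contDiffOn_const.mul
      (d2.clm_apply s1))).sub ((d1.clm_apply r2).sub (contDiffOn_const.mul (d1.clm_apply s2))))
  · have hev : bracketPot Ξ Ξ' ζ ζ' ∘ e.symm =ᶠ[𝓝 y] bracketPotential (reading Ξ e)
        (reading Ξ' e) (ζ ∘ e.symm) (ζ' ∘ e.symm) := by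
      filter_upwards [e.open_target.mem_nhds hy] with z hz
      exact hch e he hz
    rw [hev.fderiv_eq, reading_bracket h h' he hy]
    exact potentialEq_bracket e.open_target (differentiableOn_coeffForm hΩ he)
      (fun y hy => coeff_alt hΩ he hy) (fun y hy => coeff_I_I hΩ he hy)
      (fun y hy => coeffForm_closed hΩ he hy)
      ((contDiffOn_reading h he).differentiableOn (by simp))
      ((contDiffOn_reading h' he).differentiableOn (by simp))
      ((contDiffOn_comp_chart_symm hζ.1 he).of_le two_le_infty)
      ((contDiffOn_comp_chart_symm hζ'.1 he).of_le two_le_infty)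
      (fun y hy u => hζ.chart_eq he hy u) (fun y hy u => hζ'.chart_eq he hy u) hy u

theorem bracket_mem_hamFields {Ω : TwoTensor E M} (hΩ : IsKahlerForm Ω)
    {Ξ Ξ' : (x : M) → TangentSpace 𝓘(ℂ, E) x} (h : Ξ ∈ hamFields Ω) (h' : Ξ' ∈ hamFields Ω) :
    bracket Ξ Ξ' ∈ hamFields Ω := by
  have : CompleteSpace E := FiniteDimensional.complete ℂ E
  obtain ⟨c, ζ, hζ⟩ := h
  obtain ⟨c', ζ', hζ'⟩ := h'
  exact ⟨contMDiff_bracket c c', _, isPotential_bracket hΩ c c' hζ hζ'⟩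

theorem differentiableOn_reading {Ω : TwoTensor E M}
    {Ξ : (x : M) → TangentSpace 𝓘(ℂ, E) x} (h : Ξ ∈ hamFields Ω)
    {e : OpenPartialHomeomorph M E} (he : e ∈ atlas E M) :
    DifferentiableOn ℂ (reading Ξ e) e.target := by
  have : CompleteSpace E := FiniteDimensional.complete ℂ E
  exact (contDiffOn_reading h.1 he).differentiableOn (by simp)

theorem fderiv_reading_real {Ω : TwoTensor E M}
    {Ξ : (x : M) → TangentSpace 𝓘(ℂ, E) x} (h : Ξ ∈ hamFields Ω)
    {e : OpenPartialHomeomorph M E} (he : e ∈ atlas E M) {y : E} (hy : y ∈ e.target) (u : E) :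
    fderiv ℝ (reading Ξ e) y u = fderiv ℂ (reading Ξ e) y u := by
  have := (((differentiableOn_reading h he).differentiableAt
    (e.open_target.mem_nhds hy)).hasFDerivAt.restrictScalars ℝ).fderiv
  rw [this]
  rfl

/-- The Killing equation in a chart, in terms of the Kähler form. -/
theorem isKilling_iff {Ω : TwoTensor E M} (hΩ : IsKahlerForm Ω)
    {Ξ : (x : M) → TangentSpace 𝓘(ℂ, E) x} (h : Ξ ∈ hamFields Ω) :
    IsKilling (metric Ω) (fun x => reVec (Ξ x)) ↔ ∀ e ∈ atlas E M, ∀ y ∈ e.target, ∀ u v : E,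
      fderiv ℝ (coeffForm Ω e) y (reading Ξ e y) u v
        + coeffForm Ω e y (fderiv ℂ (reading Ξ e) y u) v
        + coeffForm Ω e y u (fderiv ℂ (reading Ξ e) y v) = 0 := by
  have key : ∀ e ∈ atlas E M, ∀ y ∈ e.target, ∀ u v : E,
      fderiv ℝ (fun z => coeff (metric Ω) e z u v) y (reading Ξ e y)
      + coeff (metric Ω) e y (fderiv ℝ (reading Ξ e) y u) v
      + coeff (metric Ω) e y u (fderiv ℝ (reading Ξ e) y v) =
      fderiv ℝ (coeffForm Ω e) y (reading Ξ e y) u (Complex.I • v)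
        + coeffForm Ω e y (fderiv ℂ (reading Ξ e) y u) (Complex.I • v)
        + coeffForm Ω e y u (fderiv ℂ (reading Ξ e) y (Complex.I • v)) := by
    intro e he y hy u v
    have hev : (fun z => coeff (metric Ω) e z u v) =ᶠ[𝓝 y]
        fun z => coeff Ω e z u (Complex.I • v) := by
      filter_upwards [e.open_target.mem_nhds hy] with z hz
      exact coeff_metric he hz u v
    rw [hev.fderiv_eq, fderiv_coeff hΩ he hy, coeff_metric he hy, coeff_metric he hy,
      fderiv_reading_real h he hy, fderiv_reading_real h he hy, (fderiv ℂ _ y).map_smul]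
    rfl
  constructor
  · intro H e he y hy u v
    have := (key e he y hy u (-(Complex.I • v))).symm.trans (H e he y hy u (-(Complex.I • v)))
    simpa [smul_smul] using this
  · intro H e he y hy u v
    exact (key e he y hy u v).trans (H e he y hy u _)

/-- Differentiate the potential equation at `iu` along `u` and at `u` along `iu`, and subtract the
real parts. The mixed second derivatives cancel by symmetry. What is left of the form is, by
closedness, minus its Lie derivative along the field, evaluated at `(u, iu)`. It vanishes because a
holomorphic Killing field preserves the Kähler form. -/
theorem hessian_im_of_isKilling {Ω : TwoTensor E M} (hΩ : IsKahlerForm Ω)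
    {Ξ : (x : M) → TangentSpace 𝓘(ℂ, E) x} (h : Ξ ∈ hamFields Ω)
    (hK : IsKilling (metric Ω) (fun x => reVec (Ξ x))) {ζ : M → ℂ} (hζ : IsPotential Ω Ξ ζ)
    {e : OpenPartialHomeomorph M E} (he : e ∈ atlas E M) {y : E} (hy : y ∈ e.target) (u : E) :
    (fderiv ℝ (fderiv ℝ (ζ ∘ e.symm)) y u u
      + fderiv ℝ (fderiv ℝ (ζ ∘ e.symm)) y (Complex.I • u) (Complex.I • u)).im = 0 := by
  have c2 : ContDiffOn ℝ 2 (ζ ∘ e.symm) e.target :=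
    (contDiffOn_comp_chart_symm hζ.1 he).of_le two_le_infty
  have hd := PotentialEq.fderiv e.open_target (differentiableOn_coeffForm hΩ he)
    (differentiableOn_reading h he) c2 (fun y hy u => hζ.chart_eq he hy u) hy
  have e1 := hd u (Complex.I • u)
  have e2 := hd (Complex.I • u) u
  have hs := (hasFDerivAt_fderiv_of_contDiffOn e.open_target c2 hy).2
  have k := (isKilling_iff hΩ h).1 hK e he y hy u (Complex.I • u)
  have c := coeffForm_closed hΩ he hy (reading Ξ e y) u (Complex.I • u)
  have a1 : fderiv ℝ (coeffForm Ω e) y u (Complex.I • u) (reading Ξ e y)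
      = - fderiv ℝ (coeffForm Ω e) y u (reading Ξ e y) (Complex.I • u) := by
    have hb := ((differentiableOn_coeffForm hΩ he).differentiableAt
      (e.open_target.mem_nhds hy)).hasFDerivAt
    have h1 := (hb.clm_apply (hasFDerivAt_const (Complex.I • u) y)).clm_apply
      (hasFDerivAt_const (reading Ξ e y) y)
    have h2 := ((hb.clm_apply (hasFDerivAt_const (reading Ξ e y) y)).clm_apply
      (hasFDerivAt_const (Complex.I • u) y)).neg
    have he := h1.unique (h2.congr_of_eventuallyEq (by
      filter_upwards [e.open_target.mem_nhds hy] with x hx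
      exact coeff_alt hΩ he hx _ _))
    simpa using DFunLike.congr_fun he u
  have a2 := coeff_alt hΩ he hy u (fderiv ℂ (reading Ξ e) y (Complex.I • u))
  have II : Complex.I • Complex.I • u = -u := by rw [smul_smul, Complex.I_mul_I, neg_one_smul]
  rw [II, map_neg] at e1
  have f1 := congrArg Complex.re e1
  have f2 := congrArg Complex.re e2
  have hs2 := congrArg Complex.re (hs u (Complex.I • u))
  simp only [Complex.add_re, Complex.neg_re, Complex.mul_re, Complex.I_re, Complex.I_im,
    Complex.ofReal_re, Complex.ofReal_im, Complex.neg_im, zero_mul, one_mul, zero_sub, mul_zero,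
    sub_zero, add_zero, neg_neg] at f1 f2 hs2
  rw [Complex.add_im]
  linarith

end Global

/-! ### The maximum principle, and the potentials of Killing fields -/

section MaximumPrinciple

variable {E : Type*} [NormedAddCommGroup E] [NormedSpace ℂ E]

/-- A function whose complex Hessian vanishes is harmonic on complex lines. -/
theorem harmonicAt_comp_line {U : Set E} (hU : IsOpen U) {f : E → ℝ} (hf : ContDiffOn ℝ 2 f U)
    (h : ∀ y ∈ U, ∀ u, fderiv ℝ (fderiv ℝ f) y u u
      + fderiv ℝ (fderiv ℝ f) y (Complex.I • u) (Complex.I • u) = 0)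
    (y u : E) {s : ℂ} (hs : y + s • u ∈ U) :
    InnerProductSpace.HarmonicAt (fun s : ℂ => f (y + s • u)) s := by
  have hL : ∀ s : ℂ, HasFDerivAt (fun s : ℂ => y + s • u)
      ((ContinuousLinearMap.id ℝ ℂ).smulRight u) s := fun s => by
    simpa using ((hasFDerivAt_id (𝕜 := ℝ) s).smul_const u).const_add y
  have hLc : ContDiff ℝ 2 (fun s : ℂ => y + s • u) :=
    contDiff_const.add (contDiff_id.smul contDiff_const)
  have hV : IsOpen ((fun s : ℂ => y + s • u) ⁻¹' U) := hU.preimage hLc.continuous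
  have h2 : ∀ t ∈ (fun s : ℂ => y + s • u) ⁻¹' U, ∀ v w : ℂ,
      fderiv ℝ (fderiv ℝ (fun s : ℂ => f (y + s • u))) t v w =
        fderiv ℝ (fderiv ℝ f) (y + t • u) (v • u) (w • u) := by
    intro t ht v w
    have e1 : fderiv ℝ (fun s : ℂ => f (y + s • u)) =ᶠ[𝓝 t]
        fun s => (fderiv ℝ f (y + s • u)).comp ((ContinuousLinearMap.id ℝ ℂ).smulRight u) := by
      filter_upwards [hV.mem_nhds ht] with z hz
      have hd : HasFDerivAt f (fderiv ℝ f (y + z • u)) (y + z • u) :=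
        ((hf.differentiableOn (by simp)).differentiableAt (hU.mem_nhds hz)).hasFDerivAt
      exact (hd.comp z (hL z)).fderiv
    have d2 := ((hasFDerivAt_fderiv_of_contDiffOn hU hf ht).1.comp t (hL t)).clm_comp
      (hasFDerivAt_const ((ContinuousLinearMap.id ℝ ℂ).smulRight u) t)
    have d2' : HasFDerivAt (fun s : ℂ => (fderiv ℝ f (y + s • u)).comp
      ((ContinuousLinearMap.id ℝ ℂ).smulRight u)) _ t := d2
    rw [e1.fderiv_eq, d2'.fderiv]
    simp
  refine ⟨(hf.contDiffAt (hU.mem_nhds hs)).comp s hLc.contDiffAt, ?_⟩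
  rw [InnerProductSpace.laplacian_eq_iteratedFDeriv_complexPlane]
  filter_upwards [hV.mem_nhds hs] with t ht
  simp only [iteratedFDeriv_two_apply, Matrix.cons_val_zero, Matrix.cons_val_one, Pi.zero_apply]
  rw [h2 t ht, h2 t ht, one_smul]
  exact h _ ht u

/-- On the complex line through `y` (parameter 0) and `z` (parameter 1) the function is harmonic
with a maximum at 0. It is the real part of a holomorphic function there, and the maximum modulus
principle applies to the exponential. -/
theorem eqOn_ball_of_isMaxOn_of_hessian {y : E} {r : ℝ} {f : E → ℝ}
    (hf : ContDiffOn ℝ 2 f (Metric.ball y r))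
    (h : ∀ z ∈ Metric.ball y r, ∀ u, fderiv ℝ (fderiv ℝ f) z u u
      + fderiv ℝ (fderiv ℝ f) z (Complex.I • u) (Complex.I • u) = 0)
    (hm : ∀ z ∈ Metric.ball y r, f z ≤ f y) {z : E} (hz : z ∈ Metric.ball y r) : f z = f y := by
  by_cases hzy : z = y
  · rw [hzy]
  have hn : 0 < ‖z - y‖ := norm_pos_iff.2 (sub_ne_zero.2 hzy)
  have hmem : ∀ s ∈ Metric.ball (0 : ℂ) (r / ‖z - y‖), y + s • (z - y) ∈ Metric.ball y r := by
    intro s hs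
    rw [mem_ball_zero_iff, lt_div_iff₀ hn] at hs
    rwa [mem_ball_iff_norm, add_sub_cancel_left, norm_smul]
  have hharm : InnerProductSpace.HarmonicOnNhd (fun s : ℂ => f (y + s • (z - y)))
      (Metric.ball 0 (r / ‖z - y‖)) := fun s hs =>
    harmonicAt_comp_line Metric.isOpen_ball hf h y (z - y) (hmem s hs)
  obtain ⟨F, hF, hre⟩ := hharm.exists_analyticOnNhd_ball_re_eq
  have h1 : (1 : ℂ) ∈ Metric.ball (0 : ℂ) (r / ‖z - y‖) := by
    rw [mem_ball_zero_iff, lt_div_iff₀ hn, norm_one, one_mul]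
    exact mem_ball_iff_norm.1 hz
  have h0 : (0 : ℂ) ∈ Metric.ball (0 : ℂ) (r / ‖z - y‖) := by
    rw [mem_ball_zero_iff, norm_zero]
    exact (norm_nonneg _).trans_lt (mem_ball_zero_iff.1 h1)
  -- Since `‖exp F‖ = exp (Re F)`, a maximum of the real part of `F` is a maximum of this modulus.
  have hd : DifferentiableOn ℂ (fun s => Complex.exp (F s)) (Metric.ball 0 (r / ‖z - y‖)) :=
    hF.differentiableOn.cexp
  have hmax : IsMaxOn (norm ∘ fun s => Complex.exp (F s)) (Metric.ball 0 (r / ‖z - y‖)) 0 := by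
    intro s hs
    have e1 := hre hs
    have e2 := hre h0
    simp only at e1 e2
    simp only [Set.mem_ofPred_eq, Function.comp, Complex.norm_exp, Real.exp_le_exp, e1, e2]
    simpa using hm _ (hmem s hs)
  have := Complex.eq_const_of_exists_max hd h0 hmax h1
  have h3 : ‖Complex.exp (F 1)‖ = ‖Complex.exp (F 0)‖ := congrArg norm this
  have e1 := hre h1
  have e2 := hre h0
  simp only at e1 e2
  rw [Complex.norm_exp, Complex.norm_exp, Real.exp_eq_exp, e1, e2] at h3
  simpa using h3

variable {M : Type*} [TopologicalSpace M] [ChartedSpace E M] [IsManifold 𝓘(ℂ, E) ω M]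

/-- A function with vanishing complex Hessian on a compact connected manifold is constant. -/
theorem eq_of_hessian_eq_zero [CompactSpace M] [PreconnectedSpace M]
    {f : M → ℝ} (hf : ContMDiff 𝓘(ℝ, E) 𝓘(ℝ, ℝ) ∞ f)
    (h : ∀ e ∈ atlas E M, ∀ y ∈ e.target, ∀ u, fderiv ℝ (fderiv ℝ (f ∘ e.symm)) y u u
      + fderiv ℝ (fderiv ℝ (f ∘ e.symm)) y (Complex.I • u) (Complex.I • u) = 0) (x x' : M) :
    f x = f x' := by
  obtain ⟨x₀, -, hx₀⟩ := isCompact_univ.exists_isMaxOn ⟨x, mem_univ x⟩ hf.continuous.continuousOn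
  have hmax : ∀ z, f z ≤ f x₀ := fun z => hx₀ (mem_univ z)
  -- The set where the maximum is attained is closed by continuity; the local statement makes it
  -- open, and connectedness finishes.
  have hopen : IsOpen {z | f z = f x₀} := by
    rw [isOpen_iff_mem_nhds]
    intro z hz
    have he := chart_mem_atlas E z
    set e := chartAt E z with he_def
    have hzs : z ∈ e.source := mem_chart_source E z
    obtain ⟨r, hr, hball⟩ := Metric.isOpen_iff.1 e.open_target _ (e.map_source hzs)
    have hc : ContDiffOn ℝ 2 (f ∘ e.symm) (Metric.ball (e z) r) :=
      ((contDiffOn_comp_chart_symm hf he).of_le two_le_infty).mono hball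
    have hloc : ∀ y ∈ Metric.ball (e z) r, (f ∘ e.symm) y = (f ∘ e.symm) (e z) := fun y hy =>
      eqOn_ball_of_isMaxOn_of_hessian hc (fun y hy u => h e he y (hball hy) u)
        (fun y _ => by
          simp only [Function.comp, e.left_inv hzs]
          rw [hz]
          exact hmax _) hy
    have hnb : e.source ∩ e ⁻¹' Metric.ball (e z) r ∈ 𝓝 z :=
      (e.continuousOn.isOpen_inter_preimage e.open_source Metric.isOpen_ball).mem_nhds
        ⟨hzs, Metric.mem_ball_self hr⟩
    filter_upwards [hnb] with w hw
    have := hloc _ hw.2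
    simp only [Function.comp, e.left_inv hzs, e.left_inv hw.1] at this
    exact this.trans hz
  have hclosed : IsClosed {z | f z = f x₀} := isClosed_eq hf.continuous continuous_const
  have huniv : {z | f z = f x₀} = univ := IsClopen.eq_univ ⟨hclosed, hopen⟩ ⟨x₀, rfl⟩
  have hx : x ∈ {z | f z = f x₀} := huniv ▸ mem_univ x
  have hx' : x' ∈ {z | f z = f x₀} := huniv ▸ mem_univ x'
  exact hx.trans hx'.symm

/-- This is the global input on Killing fields: their potentials are real up to a constant, so
conjugation turns the equation for `∂̄ζ` into one for `∂ζ`. -/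
theorem im_potential_const_of_isKilling [FiniteDimensional ℂ E] [CompactSpace M]
    [PreconnectedSpace M] {Ω : TwoTensor E M} (hΩ : IsKahlerForm Ω)
    {Ξ : (x : M) → TangentSpace 𝓘(ℂ, E) x} (h : Ξ ∈ hamFields Ω)
    (hK : IsKilling (metric Ω) (fun x => reVec (Ξ x))) {ζ : M → ℂ} (hζ : IsPotential Ω Ξ ζ)
    (x x' : M) : (ζ x).im = (ζ x').im := by
  have hc : ContMDiff 𝓘(ℝ, E) 𝓘(ℝ, ℝ) ∞ (fun x => (ζ x).im) :=
    Complex.imCLM.contMDiff.comp hζ.1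
  refine eq_of_hessian_eq_zero (f := fun x => (ζ x).im) hc (fun e he y hy u => ?_) x x'
  have c2 : ContDiffOn ℝ 2 (ζ ∘ e.symm) e.target :=
    (contDiffOn_comp_chart_symm hζ.1 he).of_le two_le_infty
  have e1 : fderiv ℝ ((fun x => (ζ x).im) ∘ e.symm) =ᶠ[𝓝 y]
      fun z => Complex.imCLM.comp (fderiv ℝ (ζ ∘ e.symm) z) := by
    filter_upwards [e.open_target.mem_nhds hy] with z hz
    exact (Complex.imCLM.hasFDerivAt.comp z ((c2.differentiableOn (by simp)).differentiableAt
      (e.open_target.mem_nhds hz)).hasFDerivAt).fderiv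
  have d2 : HasFDerivAt (fun z => Complex.imCLM.comp (fderiv ℝ (ζ ∘ e.symm) z)) _ y :=
    (hasFDerivAt_const Complex.imCLM y).clm_comp
      (hasFDerivAt_fderiv_of_contDiffOn e.open_target c2 hy).1
  rw [e1.fderiv_eq, d2.fderiv]
  have := hessian_im_of_isKilling hΩ h hK hζ he hy u
  simpa using this

end MaximumPrinciple

/-! ### The Riemannian volume: existence, uniqueness, pull-back -/

section Volume

variable {E : Type*} [NormedAddCommGroup E] [NormedSpace ℂ E] [FiniteDimensional ℂ E]
  {M : Type*} [TopologicalSpace M] [ChartedSpace E M]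

/-- The Gram determinant of a 2-tensor in a chart. -/
def gramDet (g : TwoTensor E M) (e : OpenPartialHomeomorph M E) (y : E) : ℝ :=
  (Matrix.of fun k l => coeff g e y (Module.finBasis ℝ E k) (Module.finBasis ℝ E l)).det

/-- The density of the Riemannian volume in a chart. -/
def density (g : TwoTensor E M) (e : OpenPartialHomeomorph M E) (y : E) : ENNReal :=
  ENNReal.ofReal √(gramDet g e y)

/-- The Gram matrix changes by congruence with the matrix of `A`. -/
theorem det_of_comp (B B' : E →ₗ[ℝ] E →ₗ[ℝ] ℝ) (A : E →L[ℝ] E)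
    (h : ∀ u v, B u v = B' (A u) (A v)) :
    (Matrix.of fun k l => B (Module.finBasis ℝ E k) (Module.finBasis ℝ E l)).det =
      A.det ^ 2 * (Matrix.of fun k l => B' (Module.finBasis ℝ E k) (Module.finBasis ℝ E l)).det := by
  have h1 (B : E →ₗ[ℝ] E →ₗ[ℝ] ℝ) :
      (Matrix.of fun k l => B (Module.finBasis ℝ E k) (Module.finBasis ℝ E l)) =
      LinearMap.toMatrix₂ (Module.finBasis ℝ E) (Module.finBasis ℝ E) B := by
    ext k l
    rw [LinearMap.toMatrix₂_apply, Matrix.of_apply]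
  have h2 : B = B'.compl₁₂ (A : E →ₗ[ℝ] E) (A : E →ₗ[ℝ] E) := by
    ext u v
    exact h u v
  rw [h1, h1, h2, LinearMap.toMatrix₂_compl₁₂ (Module.finBasis ℝ E) (Module.finBasis ℝ E) (Module.finBasis ℝ E)
      (Module.finBasis ℝ E),
    Matrix.det_mul, Matrix.det_mul, Matrix.det_transpose, LinearMap.det_toMatrix,
    ContinuousLinearMap.det]
  ring

variable [IsManifold 𝓘(ℂ, E) ω M] [MeasurableSpace E] [BorelSpace E]

theorem measurableSet_chart_image [MeasurableSpace M] [BorelSpace M]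
    (e : OpenPartialHomeomorph M E) {s : Set M} (hs : MeasurableSet s) (hse : s ⊆ e.source) :
    MeasurableSet (e '' s) := by
  have h1 : e '' s = e.target ∩ e.symm ⁻¹' s := by
    rw [e.image_eq_target_inter_inv_preimage hse]
  have h2 : Measurable (e.target.domRestrict e.symm) := by
    exact (continuousOn_iff_continuous_domRestrict.1 e.continuousOn_symm).measurable
  have h3 := e.open_target.measurableSet.subtype_image (h2 hs)
  rw [h1]
  convert! h3 using 1
  ext y
  simp [and_comm]

variable [T2Space M]

/-- Change of variables for Riemannian densities. -/
theorem setLIntegral_density_image [MeasurableSpace M] [BorelSpace M]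
    {φ : M → M} {T : M → E →L[ℝ] E} (hT : ∀ x, HasTangentMapAt ℝ φ (T x) x)
    (hφ : Function.Injective φ) (g : TwoTensor E M)
    {e e' : OpenPartialHomeomorph M E} (he : e ∈ atlas E M) (he' : e' ∈ atlas E M) {s : Set M}
    (hs : MeasurableSet s) (hse : s ⊆ e.source) (hse' : MapsTo φ s e'.source) :
    ∫⁻ y in e' '' (φ '' s), density g e' y ∂(Module.finBasis ℝ E).addHaar =
      ∫⁻ y in e '' s, density (pullback φ g) e y ∂(Module.finBasis ℝ E).addHaar := by
  set A : E → E →L[ℝ] E := fun y =>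
    ((chartCoframe e' (e' (φ (e.symm y)))).restrictScalars ℝ).comp
      ((T (e.symm y)).comp ((chartFrame e y).restrictScalars ℝ)) with hA
  have himg : e' '' (φ '' s) = (e' ∘ φ ∘ e.symm) '' (e '' s) := by
    rw [image_image, image_image]
    refine image_congr fun x hx => ?_
    simp [e.left_inv (hse hx)]
  have hsy : ∀ y ∈ e '' s, y ∈ e.target ∧ φ (e.symm y) ∈ e'.source ∧ e.symm y ∈ s := by
    rintro _ ⟨x, hx, rfl⟩
    rw [e.left_inv (hse hx)]
    exact ⟨e.map_source (hse hx), hse' hx, hx⟩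
  have hder : ∀ y ∈ e '' s, HasFDerivWithinAt (e' ∘ φ ∘ e.symm) (A y) (e '' s) y := by
    intro y hy
    obtain ⟨h1, h2, -⟩ := hsy y hy
    have c1 := (hasTangentMapAt_chart_symm he h1).real
    have c2 := (hT (e.symm y)).comp c1
    have c3 := (hasTangentMapAt_chart he' (e'.map_source h2)).real
    rw [e'.left_inv h2] at c3
    have c4 : HasTangentMapAt ℝ (e' ∘ φ ∘ e.symm) (A y) y :=
      HasTangentMapAt.comp (f := φ ∘ e.symm) c3 c2
    exact (hasTangentMapAt_iff_hasFDerivAt.1 c4).hasFDerivWithinAt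
  have hinj : InjOn (e' ∘ φ ∘ e.symm) (e '' s) := by
    intro y hy z hz hyz
    obtain ⟨h1, h2, -⟩ := hsy y hy
    obtain ⟨k1, k2, -⟩ := hsy z hz
    exact e.symm.injOn h1 k1 (hφ (e'.injOn h2 k2 hyz))
  rw [himg, lintegral_image_eq_lintegral_abs_det_fderiv_mul _
    (measurableSet_chart_image e hs hse) hder hinj]
  refine setLIntegral_congr_fun (measurableSet_chart_image e hs hse) fun y hy => ?_
  obtain ⟨h1, h2, -⟩ := hsy y hy
  have hB : ∀ u v : E, pullback e.symm (pullback φ g) y u v =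
      pullback e'.symm g (e' (φ (e.symm y))) (A y u) (A y v) := by
    intro u v
    have k1 := coeff_eq (pullback φ g) he h1 u v
    have k2 := coeff_eq g he' (e'.map_source h2) (A y u) (A y v)
    have k3 : ∀ u, chartFrame e' (e' (φ (e.symm y))) (A y u) = T (e.symm y) (chartFrame e y u) := by
      intro u
      exact chartFrame_chartCoframe he' (e'.map_source h2) _
    rw [form_pullback, (hT _).eq] at k1
    rw [k3, k3, e'.left_inv h2] at k2
    exact k1.trans k2.symm
  -- Here `A y` is the derivative of `φ` in the two charts. The square root of the Gram determinant
  -- therefore changes by `|det A|`, which is the factor in the change of variables.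
  have hdet : gramDet (pullback φ g) e y = (A y).det ^ 2 * gramDet g e' (e' (φ (e.symm y))) :=
    det_of_comp (form (pullback e.symm (pullback φ g)) y)
      (form (pullback e'.symm g) (e' (φ (e.symm y)))) (A y) hB
  simp only [density, hdet, Function.comp]
  rw [Real.sqrt_mul (sq_nonneg _), Real.sqrt_sq_eq_abs, ENNReal.ofReal_mul (abs_nonneg _)]

/-- A countable cover by chart domains is made disjoint, so that a measure is determined by, and can
be glued from, its values on subsets of charts. -/
theorem exists_chart_partition [CompactSpace M] [Nonempty M] [MeasurableSpace M] [BorelSpace M] :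
    ∃ (e : ℕ → OpenPartialHomeomorph M E) (A : ℕ → Set M), (∀ n, e n ∈ atlas E M) ∧
      (∀ n, A n ⊆ (e n).source) ∧ (∀ n, MeasurableSet (A n)) ∧
      Pairwise (Function.onFun Disjoint A) ∧ ⋃ n, A n = univ := by
  obtain ⟨s, hs, hsU⟩ := countable_cover_nhds_of_sigmaCompact
    (fun x : M => (chartAt E x).open_source.mem_nhds (mem_chart_source E x))
  have hne : s.Nonempty := by
    by_contra h
    rw [not_nonempty_iff_eq_empty] at h
    rw [h] at hsU
    simp only [mem_empty_iff_false, iUnion_of_empty, iUnion_empty] at hsU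
    exact empty_ne_univ hsU
  obtain ⟨f, hf⟩ := hs.exists_eq_range hne
  refine ⟨fun n => chartAt E (f n), disjointed fun n => (chartAt E (f n)).source,
    fun n => chart_mem_atlas E _, fun n => disjointed_subset _ n,
    fun n => MeasurableSet.disjointed (fun n => (chartAt E (f n)).open_source.measurableSet) n,
    disjoint_disjointed _, ?_⟩
  rw [iUnion_disjointed, ← hsU, hf, biUnion_range]

/-- The preimage of `s` is cut along the partition; the images of the pieces all lie in the single
chart `e'`, where the change of variables is applied to each. The identity map gives independence of
the charts, a general `φ` the behaviour under pull-back. -/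
theorem tsum_setLIntegral_density [MeasurableSpace M] [BorelSpace M]
    {φ : M ≃ₜ M} {T : M → E →L[ℝ] E} (hT : ∀ x, HasTangentMapAt ℝ φ (T x) x)
    (g : TwoTensor E M)
    {e : ℕ → OpenPartialHomeomorph M E} {A : ℕ → Set M} (he : ∀ n, e n ∈ atlas E M)
    (hA : ∀ n, A n ⊆ (e n).source) (hAm : ∀ n, MeasurableSet (A n))
    (hd : Pairwise (Function.onFun Disjoint A)) (hU : ⋃ n, A n = univ)
    {e' : OpenPartialHomeomorph M E} (he' : e' ∈ atlas E M) {s : Set M} (hs : MeasurableSet s)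
    (hse : s ⊆ e'.source) :
    ∑' n, ∫⁻ y in e n '' (φ ⁻¹' s ∩ A n), density (pullback φ g) (e n) y
      ∂(Module.finBasis ℝ E).addHaar =
      ∫⁻ y in e' '' s, density g e' y ∂(Module.finBasis ℝ E).addHaar := by
  have hm : ∀ n, MeasurableSet (φ ⁻¹' s ∩ A n) := fun n =>
    (φ.continuous.measurable hs).inter (hAm n)
  have hmi : ∀ n, MeasurableSet (φ '' (φ ⁻¹' s ∩ A n)) := fun n => by
    rw [φ.image_eq_preimage_symm]
    exact φ.symm.continuous.measurable (hm n)
  have hsub : ∀ n, φ '' (φ ⁻¹' s ∩ A n) ⊆ s := by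
    rintro n _ ⟨x, hx, rfl⟩
    exact hx.1
  have h1 : ⋃ n, e' '' (φ '' (φ ⁻¹' s ∩ A n)) = e' '' s := by
    rw [← image_iUnion, ← image_iUnion, ← inter_iUnion, hU, inter_univ,
      image_preimage_eq s φ.surjective]
  rw [← h1, lintegral_iUnion]
  · refine tsum_congr fun n => ?_
    rw [setLIntegral_density_image hT φ.injective g (he n) he' (hm n)
      (inter_subset_right.trans (hA n)) (fun x hx => hse hx.1)]
  · exact fun n => measurableSet_chart_image e' (hmi n) ((hsub n).trans hse)
  · intro i j hij
    refine Disjoint.image (u := s) ?_ (e'.injOn.mono hse) (hsub i) (hsub j)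
    exact disjoint_image_of_injective φ.injective
      ((hd hij).mono inter_subset_right inter_subset_right)

/-- The part over a chart of the Riemannian volume. -/
def chartMeasure [Nonempty M] [MeasurableSpace M] (g : TwoTensor E M)
    (e : OpenPartialHomeomorph M E) : Measure M :=
  -- The constant value off `e.target` only serves measurability of the map; the restricted measure
  -- does not see it.
  open Classical in
  Measure.map (e.target.piecewise e.symm fun _ => Classical.arbitrary M)
    (((Module.finBasis ℝ E).addHaar.restrict e.target).withDensity (density g e))

theorem measurable_piecewise_chart_symm [MeasurableSpace M] [BorelSpace M]
    (e : OpenPartialHomeomorph M E) (x : M) [∀ y, Decidable (y ∈ e.target)] :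
    Measurable (e.target.piecewise e.symm fun _ => x) := by
  refine measurable_of_restrict_of_restrict_compl e.open_target.measurableSet ?_ ?_
  · rw [domRestrict_piecewise]
    exact (continuousOn_iff_continuous_domRestrict.1 e.continuousOn_symm).measurable
  · rw [domRestrict_piecewise_compl]
    exact measurable_const

theorem chartMeasure_apply [Nonempty M] [MeasurableSpace M] [BorelSpace M] (g : TwoTensor E M)
    (e : OpenPartialHomeomorph M E) {s : Set M} (hs : MeasurableSet s) (hse : s ⊆ e.source) :
    chartMeasure g e s = ∫⁻ y in e '' s, density g e y ∂(Module.finBasis ℝ E).addHaar := by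
  classical
  have hm := measurable_piecewise_chart_symm e (Classical.arbitrary M)
  rw [chartMeasure, Measure.map_apply (by convert! hm) hs, withDensity_apply _ (by
    convert! hm hs), Measure.restrict_restrict (by convert! hm hs)]
  congr 2
  rw [e.image_eq_target_inter_inv_preimage hse, inter_comm]
  ext y
  simp only [mem_inter_iff, mem_preimage]
  refine and_congr_right fun hy => ?_
  rw [piecewise_eq_of_mem _ _ _ hy]

theorem pullback_id (g : TwoTensor E M) : pullback id g = g := by
  funext x
  have h : HasTangentMapAt ℝ (id : M → M) (ContinuousLinearMap.id ℝ E) x := hasMFDerivAt_id x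
  refine LinearMap.ext fun u => LinearMap.ext fun v => ?_
  have := form_pullback id g x u v
  rw [h.eq] at this
  exact this

theorem exists_isRiemannianVolume [CompactSpace M] [Nonempty M] [MeasurableSpace M] [BorelSpace M]
    (g : TwoTensor E M) : ∃ ν, IsRiemannianVolume g ν := by
  obtain ⟨e, A, he, hA, hAm, hd, hU⟩ := exists_chart_partition (E := E) (M := M)
  refine ⟨Measure.sum fun n => (chartMeasure g (e n)).restrict (A n), fun e' he' s hs hse => ?_⟩
  -- The change of variables for the identity shows that the measure glued from the partition has
  -- the right density in every chart.
  have h := tsum_setLIntegral_density (φ := Homeomorph.refl M)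
    (T := fun _ => ContinuousLinearMap.id ℝ E) (fun x => hasMFDerivAt_id x) g he hA hAm hd hU
    he' hs hse
  refine Eq.trans ?_ h
  rw [Measure.sum_apply _ hs]
  refine tsum_congr fun n => ?_
  rw [Measure.restrict_apply hs, chartMeasure_apply g (e n) (hs.inter (hAm n))
    (inter_subset_right.trans (hA n))]
  have hid : pullback (Homeomorph.refl M) g = g := pullback_id g
  rw [hid]
  rfl

theorem IsRiemannianVolume.unique [CompactSpace M] [Nonempty M] [MeasurableSpace M] [BorelSpace M]
    {g : TwoTensor E M} {ν ν' : Measure M} (h : IsRiemannianVolume g ν)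
    (h' : IsRiemannianVolume g ν') : ν = ν' := by
  obtain ⟨e, A, he, hA, hAm, -, hU⟩ := exists_chart_partition (E := E) (M := M)
  rw [Measure.ext_iff_of_iUnion_eq_univ hU]
  refine fun n => Measure.ext fun s hs => ?_
  rw [Measure.restrict_apply hs, Measure.restrict_apply hs,
    h _ (he n) _ (hs.inter (hAm n)) (inter_subset_right.trans (hA n)),
    h' _ (he n) _ (hs.inter (hAm n)) (inter_subset_right.trans (hA n))]

theorem isRiemannianVolume_volumeOf [CompactSpace M] [Nonempty M] [MeasurableSpace M]
    [BorelSpace M] (g : TwoTensor E M) : IsRiemannianVolume g (volumeOf g) :=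
  Classical.epsilon_spec (exists_isRiemannianVolume g)

/-- The push-forward has the defining property of the Riemannian volume of `g`, by the change of
variables on each piece of the partition, and uniqueness identifies the two. -/
theorem map_volumeOf_pullback [CompactSpace M] [Nonempty M] [MeasurableSpace M] [BorelSpace M]
    (φ : M ≃ₜ M) {T : M → E →L[ℝ] E} (hT : ∀ x, HasTangentMapAt ℝ φ (T x) x)
    (g : TwoTensor E M) : Measure.map φ (volumeOf (pullback φ g)) = volumeOf g := by
  refine IsRiemannianVolume.unique (g := g) (fun e' he' s hs hse => ?_)
    (isRiemannianVolume_volumeOf g)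
  obtain ⟨e, A, he, hA, hAm, hd, hU⟩ := exists_chart_partition (E := E) (M := M)
  refine Eq.trans ?_ (tsum_setLIntegral_density hT g he hA hAm hd hU he' hs hse)
  have hm : ∀ n, MeasurableSet (φ ⁻¹' s ∩ A n) := fun n =>
    (φ.continuous.measurable hs).inter (hAm n)
  have h1 : volumeOf (pullback φ g) (φ ⁻¹' s) = ∑' n, volumeOf (pullback φ g) (φ ⁻¹' s ∩ A n) := by
    rw [← measure_iUnion (fun i j hij => (hd hij).mono inter_subset_right inter_subset_right) hm,
      ← inter_iUnion, hU, inter_univ]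
  rw [Measure.map_apply φ.continuous.measurable hs, h1]
  refine tsum_congr fun n => ?_
  rw [isRiemannianVolume_volumeOf (pullback φ g) _ (he n) _ (hm n)
    (inter_subset_right.trans (hA n))]
  rfl

end Volume

/-! ### Derivatives of determinants, and the divergence theorem in a vector space -/

section Divergence

/-- Jacobi's formula, along a direction `K * m`. -/
theorem fderiv_det {E : Type*} [NormedAddCommGroup E] [NormedSpace ℝ E] {ι : Type*} [Fintype ι]
    [DecidableEq ι] {m : E → ι → ι → ℝ} {m' : E →L[ℝ] ι → ι → ℝ} {y : E} (hm : HasFDerivAt m m' y)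
    {w : E} {K : Matrix ι ι ℝ} (hK : Matrix.of (m' w) = K * Matrix.of (m y)) :
    HasFDerivAt (fun z => (Matrix.of (m z)).det)
      (fderiv ℝ (fun z => (Matrix.of (m z)).det) y) y ∧
    fderiv ℝ (fun z => (Matrix.of (m z)).det) y w = K.trace * (Matrix.of (m y)).det := by
  have hd : Differentiable ℝ (fun A : ι → ι → ℝ => (Matrix.of A).det) := by
    simp only [Matrix.det_apply, Matrix.of_apply]
    fun_prop
  have h1 := (hd (m y)).hasFDerivAt.comp y hm
  have h1' : HasFDerivAt (fun z => (Matrix.of (m z)).det) _ y := h1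
  refine ⟨h1'.differentiableAt.hasFDerivAt, ?_⟩
  rw [h1'.fderiv, ContinuousLinearMap.comp_apply]
  have h2 : HasDerivAt (fun t : ℝ => m y + t • m' w) (m' w) 0 := by
    simpa using ((hasDerivAt_id (0 : ℝ)).smul_const (m' w)).const_add (m y)
  have h3 : HasDerivAt (fun t : ℝ => (Matrix.of (m y + t • m' w)).det)
      (fderiv ℝ (fun A : ι → ι → ℝ => (Matrix.of A).det) (m y) (m' w)) 0 := by
    have e1 : HasFDerivAt (fun A : ι → ι → ℝ => (Matrix.of A).det)
        (fderiv ℝ (fun A : ι → ι → ℝ => (Matrix.of A).det) (m y)) (m y + (0 : ℝ) • m' w) := by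
      rw [zero_smul, add_zero]
      exact (hd (m y)).hasFDerivAt
    exact e1.comp_hasDerivAt (0 : ℝ) h2
  have h4 : ∀ t : ℝ, (Matrix.of (m y + t • m' w)).det =
      (1 + t • K).det * (Matrix.of (m y)).det := by
    intro t
    have : Matrix.of (m y + t • m' w) = (1 + t • K) * Matrix.of (m y) := by
      rw [add_mul, one_mul, smul_mul_assoc, ← hK]
      rfl
    rw [this, Matrix.det_mul]
  -- The expansion `det (1 + tK) = 1 + t tr K + O(t²)` has a polynomial remainder, which can be
  -- differentiated.
  have h5 : HasDerivAt (fun t : ℝ => (1 + t • K).det) K.trace 0 := by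
    have hp (t : ℝ) := Matrix.det_one_add_smul t K
    simp only [hp]
    have e1 := (Polynomial.hasDerivAt (Matrix.det (1 + (Polynomial.X : Polynomial ℝ)
      • K.map Polynomial.C)).divX.divX (0 : ℝ)).mul (((hasDerivAt_id (0 : ℝ)).pow 2))
    have e2 := ((hasDerivAt_id (0 : ℝ)).const_mul K.trace).const_add 1
    refine (e2.add e1).congr_deriv ?_
    simp
  have h6 := h5.mul_const (Matrix.of (m y)).det
  rw [← h3.deriv, ← h6.deriv]
  congr 1
  funext t
  exact h4 t

variable {E : Type*} [NormedAddCommGroup E] [NormedSpace ℝ E] [FiniteDimensional ℝ E]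

/-- If the derivative of a form along `w` is minus the action of `A`, so is that of its Gram
determinant. -/
theorem fderiv_det_form {ι : Type*} [Fintype ι] [DecidableEq ι] (β : Module.Basis ι ℝ E)
    {b : E → E →L[ℝ] E →L[ℝ] ℝ} {y : E} (hb : DifferentiableAt ℝ b y) {w : E} {A : E →L[ℝ] E}
    (h : ∀ u v, fderiv ℝ b y w u v = -b y (A u) v - b y u (A v))
    (hdet : (Matrix.of fun k l => b y (β k) (β l)).det ≠ 0) :
    DifferentiableAt ℝ (fun z => (Matrix.of fun k l => b z (β k) (β l)).det) y ∧
    fderiv ℝ (fun z => (Matrix.of fun k l => b z (β k) (β l)).det) y w =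
      -2 * LinearMap.trace ℝ E A * (Matrix.of fun k l => b y (β k) (β l)).det := by
  set m : E → ι → ι → ℝ := fun z k l => b z (β k) (β l) with hm
  have h1 : HasFDerivAt m (ContinuousLinearMap.pi fun k => ContinuousLinearMap.pi fun l =>
      ((fderiv ℝ b y).flip (β k)).flip (β l)) y := by
    refine hasFDerivAt_pi.2 fun k => hasFDerivAt_pi.2 fun l => ?_
    have := (hb.hasFDerivAt.clm_apply (hasFDerivAt_const (β k) y)).clm_apply
      (hasFDerivAt_const (β l) y)
    refine this.congr_fderiv ?_
    ext u
    simp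
  set P : Matrix ι ι ℝ := Matrix.of (m y) with hP
  set Am : Matrix ι ι ℝ := LinearMap.toMatrix β β (A : E →ₗ[ℝ] E) with hAm
  have hPu : IsUnit P.det := isUnit_iff_ne_zero.2 hdet
  have hA : ∀ k, A (β k) = ∑ j, Am j k • β j := fun k => by
    conv_lhs => rw [← β.sum_repr (A (β k))]
    simp only [hAm, LinearMap.toMatrix_apply, ContinuousLinearMap.coe_coe]
  -- The derivative of the Gram matrix `P` is `-Aᵀ P - P A`. Factoring out `P` on the right puts it
  -- in the form required by Jacobi's formula, and the left factor has trace `-2 tr A`.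
  have hK : Matrix.of ((ContinuousLinearMap.pi fun k => ContinuousLinearMap.pi fun l =>
      ((fderiv ℝ b y).flip (β k)).flip (β l) : E →L[ℝ] ι → ι → ℝ) w) =
      (-Am.transpose - P * Am * P⁻¹) * P := by
    rw [sub_mul, mul_assoc, Matrix.nonsing_inv_mul _ hPu, mul_one]
    ext k l
    have e1 : b y (A (β k)) (β l) = (Am.transpose * P) k l := by
      rw [hA, Matrix.mul_apply, map_sum, sum_apply]
      simp [hP, hm]
    have e2 : b y (β k) (A (β l)) = (P * Am) k l := by
      rw [hA, Matrix.mul_apply, map_sum]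
      simp [hP, hm, mul_comm]
    have e3 := h (β k) (β l)
    rw [e1, e2] at e3
    simpa using e3
  obtain ⟨g1, g2⟩ := fderiv_det h1 hK
  refine ⟨g1.differentiableAt, g2.trans ?_⟩
  have ht : (P * Am * P⁻¹).trace = Am.trace := by
    rw [Matrix.trace_mul_comm, ← mul_assoc, Matrix.nonsing_inv_mul _ hPu, one_mul]
  rw [Matrix.trace_sub, Matrix.trace_neg, Matrix.trace_transpose, ht,
    LinearMap.trace_eq_matrix_trace ℝ β]
  ring

variable [MeasurableSpace E] [BorelSpace E]

/-- Integration by parts against the constant function 1. -/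
theorem integral_fderiv_eq_zero {f : E → ℝ} (hf : ContDiff ℝ 1 f) (hc : HasCompactSupport f)
    (μ : Measure E) [μ.IsAddHaarMeasure] (v : E) : ∫ y, fderiv ℝ f y v ∂μ = 0 := by
  have hd : Continuous fun y => fderiv ℝ f y v :=
    (hf.continuous_fderiv (by simp)).clm_apply continuous_const
  have hdc : HasCompactSupport fun y => fderiv ℝ f y v := hc.fderiv_apply (𝕜 := ℝ) v
  have h := integral_mul_fderiv_eq_neg_fderiv_mul_of_integrable (μ := μ) (𝕜 := ℝ)
    (f := fun _ : E => (1 : ℝ)) (g := f) (v := v) (by simp)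
    (by simpa using hd.integrable_of_hasCompactSupport hdc)
    (by simpa using hf.continuous.integrable_of_hasCompactSupport hc)
    (fun x _ => differentiableAt_const _) (fun x _ => hf.differentiable (by simp) x)
  simpa using h

/-- The integral of the divergence of a compactly supported field vanishes. -/
theorem integral_trace_fderiv_eq_zero {H : E → E} (hH : ContDiff ℝ 1 H)
    (hc : HasCompactSupport H) (μ : Measure E) [μ.IsAddHaarMeasure] :
    ∫ y, LinearMap.trace ℝ E (fderiv ℝ H y) ∂μ = 0 := by
  set β := Module.finBasis ℝ E
  set c : Fin (Module.finrank ℝ E) → E →L[ℝ] ℝ := fun k =>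
    LinearMap.toContinuousLinearMap (β.coord k)
  have h1 : ∀ y, LinearMap.trace ℝ E (fderiv ℝ H y) =
      ∑ k, fderiv ℝ (fun z => c k (H z)) y (β k) := by
    intro y
    rw [LinearMap.trace_eq_matrix_trace ℝ β, Matrix.trace]
    refine Finset.sum_congr rfl fun k _ => ?_
    have := ((c k).hasFDerivAt (x := H y)).comp y (hH.differentiable (by simp) y).hasFDerivAt
    have h2 : HasFDerivAt (fun z => c k (H z)) _ y := this
    rw [h2.fderiv, Matrix.diag_apply, LinearMap.toMatrix_apply]
    rfl
  have hs : ∀ k, ContDiff ℝ 1 (fun z => c k (H z)) := fun k => (c k).contDiff.comp hH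
  have hcs : ∀ k, HasCompactSupport (fun z => c k (H z)) := fun k =>
    hc.comp_left (g := c k) (map_zero _)
  simp only [h1]
  rw [integral_finsetSum]
  · exact Finset.sum_eq_zero fun k _ => integral_fderiv_eq_zero (hs k) (hcs k) μ (β k)
  · intro k _
    exact (((hs k).continuous_fderiv (by simp)).clm_apply
      continuous_const).integrable_of_hasCompactSupport ((hcs k).fderiv_apply (𝕜 := ℝ) (β k))

end Divergence

/-! ### The volume of a Kähler metric -/

section KahlerVolume

variable {E : Type*} [NormedAddCommGroup E] [NormedSpace ℂ E] [FiniteDimensional ℂ E]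
  {M : Type*} [TopologicalSpace M] [ChartedSpace E M] [IsManifold 𝓘(ℂ, E) ω M]
  {Ω : TwoTensor E M}

theorem gramDet_metric_pos (hΩ : IsKahlerForm Ω) {e : OpenPartialHomeomorph M E}
    (he : e ∈ atlas E M) {y : E} (hy : y ∈ e.target) : 0 < gramDet (metric Ω) e y := by
  have hc : ∀ u v, coeff (metric Ω) e y u v = coeffForm Ω e y u (Complex.I • v) := fun u v =>
    coeff_metric he hy u v
  refine Matrix.PosDef.det_pos (Matrix.PosDef.of_dotProduct_mulVec_pos ?_ fun x hx => ?_)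
  · ext k l
    rw [Matrix.conjTranspose_apply, Matrix.of_apply, Matrix.of_apply, hc, hc, star_trivial,
      coeff_alt hΩ he hy, ← coeff_I_I hΩ he hy (Complex.I • _), smul_smul, Complex.I_mul_I,
      neg_one_smul, map_neg, neg_apply, neg_neg]
  · set v := ∑ k, x k • Module.finBasis ℝ E k with hv
    have hv0 : v ≠ 0 := fun h => hx <| by
      funext k
      exact Fintype.linearIndependent_iff.1 (Module.finBasis ℝ E).linearIndependent x h k
    have h1 := coeff_pos hΩ he hy hv0
    convert! h1 using 1
    have h2 : Complex.I • v = ∑ k, x k • (Complex.I • Module.finBasis ℝ E k) := by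
      rw [hv, Finset.smul_sum]
      exact Finset.sum_congr rfl fun k _ => smul_comm _ _ _
    rw [h2, hv]
    simp only [dotProduct, Matrix.mulVec, Matrix.of_apply, map_sum, map_smul, star_trivial,
      smul_apply, sum_apply, smul_eq_mul, hc, Finset.mul_sum]
    rw [Finset.sum_comm]
    refine Finset.sum_congr rfl fun k _ => Finset.sum_congr rfl fun l _ => ?_
    ring

/-- Since `g = Ω(·, J·)`, the two Gram matrices differ by the constant matrix of `J`. Thus a field
preserving the form preserves the metric volume, whether or not it preserves the metric. -/
theorem gramDet_metric {e : OpenPartialHomeomorph M E}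
    (he : e ∈ atlas E M) {y : E} (hy : y ∈ e.target) : gramDet (metric Ω) e y =
      (Matrix.of fun k l =>
        coeffForm Ω e y (Module.finBasis ℝ E k) (Module.finBasis ℝ E l)).det *
      (LinearMap.toMatrix (Module.finBasis ℝ E) (Module.finBasis ℝ E)
        (Complex.I • LinearMap.id : E →ₗ[ℝ] E)).det := by
  rw [gramDet, ← Matrix.det_mul]
  congr 1
  ext k l
  rw [Matrix.of_apply, coeff_metric he hy, Matrix.mul_apply, ← coeffForm_apply]
  conv_lhs => rw [← (Module.finBasis ℝ E).sum_repr (Complex.I • Module.finBasis ℝ E l)]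
  rw [map_sum]
  refine Finset.sum_congr rfl fun j _ => ?_
  rw [map_smul, smul_eq_mul, mul_comm, LinearMap.toMatrix_apply]
  rfl

theorem contDiffOn_gramDet (hΩ : IsKahlerForm Ω) {e : OpenPartialHomeomorph M E}
    (he : e ∈ atlas E M) : ContDiffOn ℝ ∞ (gramDet (metric Ω) e) e.target := by
  have h : ∀ u v, ContDiffOn ℝ ∞ (fun y => coeff (metric Ω) e y u v) e.target := fun u v =>
    (hΩ.smooth e he u (Complex.I • v)).congr fun y hy => coeff_metric he hy u v
  unfold gramDet
  simp only [Matrix.det_apply, Matrix.of_apply]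
  exact ContDiffOn.sum fun σ _ => (contDiffOn_prod fun k _ => h _ _).const_smul _

theorem continuousOn_sqrt_gramDet (hΩ : IsKahlerForm Ω) {e : OpenPartialHomeomorph M E}
    (he : e ∈ atlas E M) : ContinuousOn (fun y => √(gramDet (metric Ω) e y)) e.target :=
  (contDiffOn_gramDet hΩ he).continuousOn.sqrt

variable [MeasurableSpace E] [BorelSpace E] [CompactSpace M] [T2Space M]
  [MeasurableSpace M] [BorelSpace M]

theorem isFiniteMeasure_volumeOf [Nonempty M] (hΩ : IsKahlerForm Ω) :
    IsFiniteMeasure (volumeOf (metric Ω)) := by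
  have : FiniteDimensional ℝ E := FiniteDimensional.complexToReal E
  refine ⟨isCompact_univ.measure_lt_top_of_nhdsWithin fun x _ => ?_⟩
  set e := chartAt E x
  have he : e ∈ atlas E M := chart_mem_atlas E x
  have hx : x ∈ e.source := mem_chart_source E x
  obtain ⟨r, hr, hre⟩ := Metric.nhds_basis_closedBall.mem_iff.1
    (e.open_target.mem_nhds (e.map_source hx))
  have ho : IsOpen (e.source ∩ e ⁻¹' Metric.ball (e x) r) :=
    e.isOpen_inter_preimage Metric.isOpen_ball
  refine ⟨e.source ∩ e ⁻¹' Metric.ball (e x) r, mem_nhdsWithin_of_mem_nhds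
    (ho.mem_nhds ⟨hx, Metric.mem_ball_self hr⟩), ?_⟩
  rw [isRiemannianVolume_volumeOf (metric Ω) e he _ ho.measurableSet inter_subset_left]
  have hsub : e '' (e.source ∩ e ⁻¹' Metric.ball (e x) r) ⊆ Metric.closedBall (e x) r := by
    rintro _ ⟨z, hz, rfl⟩
    exact Metric.ball_subset_closedBall hz.2
  refine (lintegral_mono_set hsub).trans_lt ?_
  exact (((continuousOn_sqrt_gramDet hΩ he).mono hre).integrableOn_compact
    (isCompact_closedBall _ _)).lintegral_lt_top

theorem volumeOf_univ_ne_zero [Nonempty M] (hΩ : IsKahlerForm Ω) :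
    volumeOf (metric Ω) univ ≠ 0 := by
  have : FiniteDimensional ℝ E := FiniteDimensional.complexToReal E
  intro h0
  obtain ⟨x⟩ := ‹Nonempty M›
  set e := chartAt E x
  have he : e ∈ atlas E M := chart_mem_atlas E x
  have hx : x ∈ e.source := mem_chart_source E x
  have h1 := isRiemannianVolume_volumeOf (metric Ω) e he _ e.open_source.measurableSet subset_rfl
  rw [measure_mono_null (subset_univ _) h0, e.image_source_eq_target, eq_comm] at h1
  change ∫⁻ y in e.target, ENNReal.ofReal √(gramDet (metric Ω) e y) ∂_ = 0 at h1
  rw [lintegral_eq_zero_iff' (((continuousOn_sqrt_gramDet hΩ he).aemeasurable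
      e.open_target.measurableSet).ennreal_ofReal)] at h1
  rw [Filter.EventuallyEq, ae_restrict_iff' e.open_target.measurableSet] at h1
  have h2 : (Module.finBasis ℝ E).addHaar e.target = 0 := by
    refine measure_mono_null (fun y hy => ?_) (ae_iff.1 h1)
    rw [mem_ofPred_eq]
    intro hn
    have h3 : ENNReal.ofReal √(gramDet (metric Ω) e y) = 0 := hn hy
    exact (ENNReal.ofReal_pos.2 (Real.sqrt_pos.2 (gramDet_metric_pos hΩ he hy))).ne' h3
  exact (e.open_target.measure_pos _ ⟨e x, e.map_source hx⟩).ne' h2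

/-- On the chart domain the volume agrees with the measure transported from the chart; the integrand
vanishes elsewhere. -/
theorem integral_volumeOf [Nonempty M] (hΩ : IsKahlerForm Ω) {e : OpenPartialHomeomorph M E}
    (he : e ∈ atlas E M) {f : M → ℝ} (hf : Continuous f) (h0 : ∀ x, x ∉ e.source → f x = 0) :
    ∫ x, f x ∂(volumeOf (metric Ω)) = ∫ y in e.target,
      √(gramDet (metric Ω) e y) * f (e.symm y) ∂(Module.finBasis ℝ E).addHaar := by
  classical
  have : FiniteDimensional ℝ E := FiniteDimensional.complexToReal E
  have hs : MeasurableSet e.source := e.open_source.measurableSet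
  have ht : MeasurableSet e.target := e.open_target.measurableSet
  have h1 : (volumeOf (metric Ω)).restrict e.source =
      (chartMeasure (metric Ω) e).restrict e.source := by
    refine Measure.ext fun s hsm => ?_
    rw [Measure.restrict_apply hsm, Measure.restrict_apply hsm,
      chartMeasure_apply _ _ (hsm.inter hs) inter_subset_right,
      isRiemannianVolume_volumeOf (metric Ω) e he _ (hsm.inter hs) inter_subset_right]
    rfl
  have hm := measurable_piecewise_chart_symm e (Classical.arbitrary M)
  have hpre : (e.target.piecewise e.symm fun _ => Classical.arbitrary M) ⁻¹' e.source ∩ e.target =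
      e.target := by
    refine inter_eq_right.2 fun y hy => ?_
    rw [mem_preimage, piecewise_eq_of_mem _ _ _ hy]
    exact e.map_target hy
  rw [← setIntegral_eq_integral_of_forall_compl_eq_zero h0, h1, chartMeasure,
    setIntegral_map hs hf.measurable.aestronglyMeasurable (by convert! hm.aemeasurable)]
  rw [setIntegral_withDensity_eq_setIntegral_toReal_smul₀]
  · rw [Measure.restrict_restrict (by convert! hm hs)]
    rw [hpre]
    refine setIntegral_congr_fun ht fun y hy => ?_
    simp only [smul_eq_mul, density]
    rw [ENNReal.toReal_ofReal (Real.sqrt_nonneg _), piecewise_eq_of_mem _ _ _ hy]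
  · refine AEMeasurable.restrict ?_
    exact ((continuousOn_sqrt_gramDet hΩ he).aemeasurable ht).ennreal_ofReal
  · exact ae_of_all _ fun y => ENNReal.ofReal_lt_top
  · convert! hm hs

end KahlerVolume

/-! ### Hamiltonian fields of a symplectic form on an open set -/

section Symplectic

variable {E : Type*} [NormedAddCommGroup E] [NormedSpace ℝ E] [FiniteDimensional ℝ E]
  {b : E → E →L[ℝ] E →L[ℝ] ℝ} {U : Set E} {X : E → E}

/-- A nondegenerate form is an invertible map to the dual, so `X` is the inverse applied to `β`, and
inversion is smooth near an invertible map. -/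
theorem contDiffOn_of_form_eq {β : E → E →L[ℝ] ℝ} (hU : IsOpen U) (hb : ContDiffOn ℝ 1 b U)
    (hnd : ∀ y ∈ U, ∀ u, (∀ v, b y u v = 0) → u = 0) (hβ : ContDiffOn ℝ 1 β U)
    (hX : ∀ y ∈ U, b y (X y) = β y) : ContDiffOn ℝ 1 X U := by
  have : CompleteSpace E := FiniteDimensional.complete ℝ E
  have hinj : ∀ y ∈ U, (b y).toLinearMap.ker = ⊥ := fun y hy => by
    rw [LinearMap.ker_eq_bot']
    intro u hu
    refine hnd y hy u fun v => ?_
    rw [show b y u = 0 from hu]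
    rfl
  have hrank : Module.finrank ℝ E = Module.finrank ℝ (E →L[ℝ] ℝ) := by
    rw [← (LinearMap.toContinuousLinearMap (𝕜 := ℝ) (E := E) (F' := ℝ)).finrank_eq]
    exact (Subspace.dual_finrank_eq (K := ℝ) (V := E)).symm
  have hinv : ∀ y ∈ U, (b y).IsInvertible := fun y hy => by
    refine ⟨(LinearEquiv.ofInjectiveOfFinrankEq (b y).toLinearMap
      (LinearMap.ker_eq_bot.1 (hinj y hy)) hrank).toContinuousLinearEquiv, ?_⟩
    ext u v
    rfl
  have h1 : ContDiffOn ℝ 1 (fun y => (b y).inverse (β y)) U := by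
    refine ContDiffOn.clm_apply (fun y hy => ?_) hβ
    exact ((hinv y hy).contDiffAt_map_inverse.comp y
      (hb.contDiffAt (hU.mem_nhds hy))).contDiffWithinAt
  refine h1.congr fun y hy => ?_
  rw [← hX y hy, (hinv y hy).inverse_apply_self]

/-- A Hamiltonian field preserves the symplectic form. -/
theorem fderiv_form_hamiltonian {a : E → ℝ} (hU : IsOpen U) (hb : DifferentiableOn ℝ b U)
    (halt : ∀ y ∈ U, ∀ u v, b y u v = -b y v u)
    (hclosed : ∀ y ∈ U, ∀ u v w,
      fderiv ℝ b y u v w + fderiv ℝ b y v w u + fderiv ℝ b y w u v = 0)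
    (ha : ContDiffOn ℝ 2 a U) (hX : DifferentiableOn ℝ X U)
    (h : ∀ y ∈ U, b y (X y) = -fderiv ℝ a y) {y : E} (hy : y ∈ U) (u v : E) :
    fderiv ℝ b y (X y) u v = -b y (fderiv ℝ X y u) v - b y u (fderiv ℝ X y v) := by
  have hUy := hU.mem_nhds hy
  obtain ⟨h1, h2⟩ := hasFDerivAt_fderiv_of_contDiffOn hU ha hy
  have hb' := (hb.differentiableAt hUy).hasFDerivAt
  have hX' := (hX.differentiableAt hUy).hasFDerivAt
  have h3 : (fun z => b z (X z)) =ᶠ[𝓝 y] fun z => -fderiv ℝ a z := by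
    filter_upwards [hUy] with z hz using h z hz
  have h4 := (hb'.clm_apply hX').congr_of_eventuallyEq h3.symm |>.unique h1.neg
  have h5 : ∀ s t, fderiv ℝ b y s (X y) t + b y (fderiv ℝ X y s) t =
      -fderiv ℝ (fderiv ℝ a) y s t := fun s t => by
    have := DFunLike.congr_fun (DFunLike.congr_fun h4 s) t
    simp only [add_apply, ContinuousLinearMap.comp_apply, neg_apply,
      ContinuousLinearMap.flip_apply] at this
    linarith
  have h6 : ∀ s u v, fderiv ℝ b y s u v = -fderiv ℝ b y s v u := fun s u v => by
    have e : (fun z => b z u v) =ᶠ[𝓝 y] fun z => -b z v u := by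
      filter_upwards [hUy] with z hz using halt z hz u v
    have e1 := (hb'.clm_apply (hasFDerivAt_const u y)).clm_apply (hasFDerivAt_const v y)
    have e2 := (hb'.clm_apply (hasFDerivAt_const v y)).clm_apply (hasFDerivAt_const u y)
    have e3 := (e1.congr_of_eventuallyEq e.symm).unique e2.neg
    simpa using DFunLike.congr_fun e3 s
  -- Cartan's formula: the antisymmetric part of `a1` and `a2` says that the contraction with `X` is
  -- closed, and `a3` is closedness of the form.
  have a1 := h5 u v
  have a2 := h5 v u
  have a3 := hclosed y hy (X y) u v
  have a4 := h2 u v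
  have a5 := h6 v (X y) u
  have a6 := h6 u v (X y)
  have a7 := halt y hy (fderiv ℝ X y v) u
  linarith

end Symplectic

/-! ### Poisson brackets and Liouville's theorem -/

section Poisson

variable {E : Type*} [NormedAddCommGroup E] [NormedSpace ℂ E] [FiniteDimensional ℂ E]
  {M : Type*} [TopologicalSpace M] [ChartedSpace E M]
  {Ω : TwoTensor E M}

/-- The vector which the form `Ω` pairs to `-α`. -/
def hamVec (Ω : TwoTensor E M) (x : M) (α : E →L[ℝ] ℝ) : E :=
  Classical.epsilon fun X => ∀ v, form Ω x X v = -α v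

/-- Positivity makes the form injective into the dual, hence surjective by dimension, so the choice
in `hamVec` is of an existing vector. -/
theorem form_hamVec (hΩ : IsKahlerForm Ω) (x : M) (α : E →L[ℝ] ℝ) (v : E) :
    form Ω x (hamVec Ω x α) v = -α v := by
  have : FiniteDimensional ℝ E := FiniteDimensional.complexToReal E
  have hinj : Function.Injective (form Ω x) := by
    refine LinearMap.ker_eq_bot.1 (LinearMap.ker_eq_bot'.2 fun u hu => ?_)
    by_contra h
    have := form_pos hΩ x h
    rw [hu] at this
    exact lt_irrefl _ this
  have hsurj : Function.Surjective (form Ω x) :=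
    (LinearMap.injective_iff_surjective_of_finrank_eq_finrank
      (Subspace.dual_finrank_eq (K := ℝ) (V := E)).symm).1 hinj
  have hex : ∃ X, ∀ v, form Ω x X v = -α v := by
    obtain ⟨X, hX⟩ := hsurj (-(α : E →ₗ[ℝ] ℝ))
    exact ⟨X, fun v => by rw [hX]; rfl⟩
  exact Classical.epsilon_spec (p := fun X => ∀ v, form Ω x X v = -α v) hex v

theorem form_nondegenerate (hΩ : IsKahlerForm Ω) (x : M) {u : E} (h : ∀ v, form Ω x u v = 0) :
    u = 0 := by
  by_contra hu
  have := form_pos hΩ x hu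
  rw [h] at this
  exact lt_irrefl _ this

variable [IsManifold 𝓘(ℂ, E) ω M]

/-- The Hamiltonian field of a function in a chart. -/
def hamField (Ω : TwoTensor E M) (a : M → ℝ) (e : OpenPartialHomeomorph M E) (y : E) : E :=
  chartCoframe e y (hamVec Ω (e.symm y) (tangentMapAt ℝ a (e.symm y)))

theorem coeffForm_hamField (hΩ : IsKahlerForm Ω) {a : M → ℝ} (ha : ContMDiff 𝓘(ℝ, E) 𝓘(ℝ, ℝ) ∞ a)
    {e : OpenPartialHomeomorph M E} (he : e ∈ atlas E M) {y : E} (hy : y ∈ e.target) :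
    coeffForm Ω e y (hamField Ω a e y) = -fderiv ℝ (a ∘ e.symm) y := by
  ext v
  rw [coeffForm_apply, coeff_eq _ he hy, hamField, chartFrame_chartCoframe he hy,
    form_hamVec hΩ, tangentMapAt_chartFrame he hy (ha.mdifferentiable (by simp) _)]
  rfl

theorem contDiffOn_hamField (hΩ : IsKahlerForm Ω) {a : M → ℝ}
    (ha : ContMDiff 𝓘(ℝ, E) 𝓘(ℝ, ℝ) ∞ a)
    {e : OpenPartialHomeomorph M E} (he : e ∈ atlas E M) :
    ContDiffOn ℝ 1 (hamField Ω a e) e.target := by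
  have : FiniteDimensional ℝ E := FiniteDimensional.complexToReal E
  refine contDiffOn_of_form_eq (b := coeffForm Ω e) (β := fun y => -fderiv ℝ (a ∘ e.symm) y)
    e.open_target ((contDiffOn_coeffForm hΩ he).of_le (by simp)) (fun y hy u hu => ?_) ?_
    fun y hy => coeffForm_hamField hΩ ha he hy
  · by_contra h
    have := coeff_pos hΩ he hy h
    rw [hu] at this
    exact lt_irrefl _ this
  · exact (((contDiffOn_comp_chart_symm ha he).of_le two_le_infty).fderiv_of_isOpen
      e.open_target (by norm_num)).neg

/-- The Poisson bracket of two functions. -/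
def poisson (Ω : TwoTensor E M) (a f : M → ℝ) (x : M) : ℝ :=
  tangentMapAt ℝ f x (hamVec Ω x (tangentMapAt ℝ a x))

theorem poisson_chart {a f : M → ℝ}
    (hf : ContMDiff 𝓘(ℝ, E) 𝓘(ℝ, ℝ) ∞ f)
    {e : OpenPartialHomeomorph M E} (he : e ∈ atlas E M) {y : E} (hy : y ∈ e.target) :
    poisson Ω a f (e.symm y) = fderiv ℝ (f ∘ e.symm) y (hamField Ω a e y) := by
  rw [← tangentMapAt_chartFrame he hy (hf.mdifferentiable (by simp) _), hamField,
    chartFrame_chartCoframe he hy]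
  rfl

theorem continuous_poisson (hΩ : IsKahlerForm Ω) {a f : M → ℝ}
    (ha : ContMDiff 𝓘(ℝ, E) 𝓘(ℝ, ℝ) ∞ a) (hf : ContMDiff 𝓘(ℝ, E) 𝓘(ℝ, ℝ) ∞ f) :
    Continuous (poisson Ω a f) := by
  have : ContMDiff 𝓘(ℝ, E) 𝓘(ℝ, ℝ) 0 (poisson Ω a f) := by
    refine contMDiff_of_chart fun e he => ?_
    have h1 : ContDiffOn ℝ 0 (fun y => fderiv ℝ (f ∘ e.symm) y (hamField Ω a e y)) e.target :=
      (((contDiffOn_comp_chart_symm hf he).of_le (n := ∞) (m := 1) (by simp)).fderiv_of_isOpen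
        e.open_target (by norm_num)).clm_apply ((contDiffOn_hamField hΩ ha he).of_le (by simp))
    exact h1.congr fun y hy => poisson_chart hf he hy
  exact this.continuous

variable [MeasurableSpace E] [BorelSpace E] [CompactSpace M] [T2Space M]
  [MeasurableSpace M] [BorelSpace M]

/-- The Hamiltonian field has divergence zero for the volume density. It preserves the form, so
Jacobi's formula gives the derivative of the Gram determinant of the form; that of the metric
differs by a constant factor, and the square root halves the exponent. -/
theorem fderiv_sqrt_gramDet (hΩ : IsKahlerForm Ω) {a : M → ℝ}
    (ha : ContMDiff 𝓘(ℝ, E) 𝓘(ℝ, ℝ) ∞ a)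
    {e : OpenPartialHomeomorph M E} (he : e ∈ atlas E M) {y : E} (hy : y ∈ e.target) :
    DifferentiableAt ℝ (fun z => √(gramDet (metric Ω) e z)) y ∧
    fderiv ℝ (fun z => √(gramDet (metric Ω) e z)) y (hamField Ω a e y) =
      -LinearMap.trace ℝ E (fderiv ℝ (hamField Ω a e) y) * √(gramDet (metric Ω) e y) := by
  have : FiniteDimensional ℝ E := FiniteDimensional.complexToReal E
  have hpos := gramDet_metric_pos hΩ he hy
  have hg := gramDet_metric (Ω := Ω) he hy
  have hne : (Matrix.of fun k l =>
      coeffForm Ω e y (Module.finBasis ℝ E k) (Module.finBasis ℝ E l)).det ≠ 0 := fun h0 => by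
    rw [hg, h0, zero_mul] at hpos
    exact lt_irrefl _ hpos
  obtain ⟨k1, k2⟩ := fderiv_det_form (Module.finBasis ℝ E)
    ((differentiableOn_coeffForm hΩ he).differentiableAt (e.open_target.mem_nhds hy))
    (w := hamField Ω a e y) (A := fderiv ℝ (hamField Ω a e) y)
    (fun u v => fderiv_form_hamiltonian e.open_target (differentiableOn_coeffForm hΩ he)
      (fun y hy => coeff_alt hΩ he hy) (fun y hy => coeffForm_closed hΩ he hy)
      ((contDiffOn_comp_chart_symm ha he).of_le two_le_infty)
      ((contDiffOn_hamField hΩ ha he).differentiableOn (by simp))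
      (fun y hy => coeffForm_hamField hΩ ha he hy) hy u v) hne
  have h1 := k1.hasFDerivAt.mul_const (LinearMap.toMatrix (Module.finBasis ℝ E)
    (Module.finBasis ℝ E) (Complex.I • LinearMap.id : E →ₗ[ℝ] E)).det
  have h2 : HasFDerivAt (gramDet (metric Ω) e) _ y := h1.congr_of_eventuallyEq <| by
    filter_upwards [e.open_target.mem_nhds hy] with z hz using gramDet_metric he hz
  have h3 := h2.sqrt hpos.ne'
  refine ⟨h3.differentiableAt, ?_⟩
  rw [h3.fderiv, smul_apply, smul_apply, k2, smul_eq_mul, smul_eq_mul]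
  have hs : √(gramDet (metric Ω) e y) ≠ 0 := (Real.sqrt_pos.2 hpos).ne'
  have hss := Real.mul_self_sqrt hpos.le
  rw [hg] at hss hs ⊢
  field_simp
  rw [sq, hss]

/-- Liouville's theorem for functions supported in a chart. -/
theorem integral_poisson_of_tsupport [Nonempty M] (hΩ : IsKahlerForm Ω) {a f : M → ℝ}
    (ha : ContMDiff 𝓘(ℝ, E) 𝓘(ℝ, ℝ) ∞ a) (hf : ContMDiff 𝓘(ℝ, E) 𝓘(ℝ, ℝ) ∞ f)
    {e : OpenPartialHomeomorph M E} (he : e ∈ atlas E M) (hs : tsupport f ⊆ e.source) :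
    ∫ x, poisson Ω a f x ∂(volumeOf (metric Ω)) = 0 := by
  have : FiniteDimensional ℝ E := FiniteDimensional.complexToReal E
  have h0 : ∀ x, x ∉ e.source → poisson Ω a f x = 0 := by
    intro x hx
    have h1 : f =ᶠ[𝓝 x] fun _ => 0 := notMem_tsupport_iff_eventuallyEq.1 fun h => hx (hs h)
    have h2 : HasTangentMapAt ℝ f (0 : E →L[ℝ] ℝ) x :=
      HasTangentMapAt.congr_of_eventuallyEq (hasMFDerivAt_const 0 x) h1
    rw [poisson, h2.eq]
    rfl
  rw [integral_volumeOf hΩ he (continuous_poisson hΩ ha hf) h0]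
  -- In the chart `H` is the density times `f` times the Hamiltonian field. It is extended by zero,
  -- smoothly because `f` has compact support in the chart domain.
  set H : E → E := e.target.indicator fun y =>
    (√(gramDet (metric Ω) e y) * f (e.symm y)) • hamField Ω a e y with hH
  set K : Set E := e '' tsupport f with hK
  have hKc : IsCompact K := (isClosed_tsupport f).isCompact.image_of_continuousOn
    (e.continuousOn.mono hs)
  have hKt : K ⊆ e.target := by
    rintro _ ⟨x, hx, rfl⟩
    exact e.map_source (hs hx)
  have hHK : ∀ y, y ∉ K → H y = 0 := by
    intro y hy
    rw [hH, indicator_apply_eq_zero]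
    intro hyt
    have : f (e.symm y) = 0 := by
      by_contra hne
      exact hy ⟨e.symm y, subset_tsupport f hne, e.right_inv hyt⟩
    rw [this, mul_zero, zero_smul]
  have hHev : ∀ y, y ∉ K → H =ᶠ[𝓝 y] fun _ => 0 := by
    intro y hy
    filter_upwards [hKc.isClosed.isOpen_compl.mem_nhds hy] with z hz using hHK z hz
  have hHt : ∀ y ∈ e.target, H =ᶠ[𝓝 y] fun y =>
      (√(gramDet (metric Ω) e y) * f (e.symm y)) • hamField Ω a e y := by
    intro y hy
    filter_upwards [e.open_target.mem_nhds hy] with z hz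
    rw [hH, indicator_of_mem hz]
  have hfe : ContDiffOn ℝ ∞ (fun y => f (e.symm y)) e.target := contDiffOn_comp_chart_symm hf he
  have hsm : ContDiff ℝ 1 H := by
    rw [contDiff_iff_contDiffAt]
    intro y
    by_cases hy : y ∈ K
    · refine ContDiffAt.congr_of_eventuallyEq ?_ (hHt y (hKt hy))
      have hn := e.open_target.mem_nhds (hKt hy)
      have c1 : ContDiffAt ℝ 1 (fun z => √(gramDet (metric Ω) e z)) y :=
        (((contDiffOn_gramDet hΩ he).contDiffAt hn).of_le (by simp)).sqrt
          (gramDet_metric_pos hΩ he (hKt hy)).ne'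
      have c2 : ContDiffAt ℝ 1 (fun z => f (e.symm z)) y := (hfe.contDiffAt hn).of_le (by simp)
      exact (c1.mul c2).smul ((contDiffOn_hamField hΩ ha he).contDiffAt hn)
    · exact contDiffAt_const.congr_of_eventuallyEq (hHev y hy)
  have hHc : HasCompactSupport H := HasCompactSupport.intro hKc hHK
  -- The right-hand side zero becomes the integral of the divergence of `H`. Density times field is
  -- divergence free, so only the derivative of `f` along the field, times the density, survives.
  rw [← integral_trace_fderiv_eq_zero hsm hHc (Module.finBasis ℝ E).addHaar,
    ← setIntegral_eq_integral_of_forall_compl_eq_zero (s := e.target)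
      (f := fun y => LinearMap.trace ℝ E (fderiv ℝ H y))]
  · refine setIntegral_congr_fun e.open_target.measurableSet fun y hy => ?_
    have hn := e.open_target.mem_nhds hy
    obtain ⟨k1, k2⟩ := fderiv_sqrt_gramDet hΩ ha he hy
    have k3 := (hfe.contDiffAt hn).differentiableAt (by simp)
    have k4 := ((contDiffOn_hamField hΩ ha he).contDiffAt hn).differentiableAt (by simp)
    have k5 := ((k1.hasFDerivAt.mul k3.hasFDerivAt).smul k4.hasFDerivAt).congr_of_eventuallyEq
      (hHt y hy)
    have k6 : fderiv ℝ (f ∘ e.symm) y = fderiv ℝ (fun y => f (e.symm y)) y := rfl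
    simp only [k5.fderiv]
    rw [poisson_chart hf he hy, ContinuousLinearMap.toLinearMap_add, map_add,
      ContinuousLinearMap.toLinearMap_smul, map_smul]
    have k7 : LinearMap.trace ℝ E (((√(gramDet (metric Ω) e y) • fderiv ℝ (fun y => f (e.symm y)) y
        + f (e.symm y) • fderiv ℝ (fun z => √(gramDet (metric Ω) e z)) y).smulRight
          (hamField Ω a e y) : E →L[ℝ] E) : E →ₗ[ℝ] E) =
        √(gramDet (metric Ω) e y) * fderiv ℝ (fun y => f (e.symm y)) y (hamField Ω a e y)
        + f (e.symm y) * fderiv ℝ (fun z => √(gramDet (metric Ω) e z)) y (hamField Ω a e y) := by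
      exact LinearMap.trace_smulRight _ _
    rw [k7, k2, k6, smul_eq_mul, Pi.mul_apply]
    ring
  · intro y hy
    have : y ∉ K := fun h => hy (hKt h)
    rw [(hHev y this).fderiv_eq, fderiv_fun_const]
    simp

omit [FiniteDimensional ℂ E] [IsManifold 𝓘(ℂ, E) ω M] [MeasurableSpace E] [BorelSpace E]
  [CompactSpace M] [T2Space M] [MeasurableSpace M] [BorelSpace M] in
theorem hasTangentMapAt_sum {ι : Type*} (s : Finset ι) {f : ι → M → ℝ} {f' : ι → E →L[ℝ] ℝ}
    {x : M} (h : ∀ i ∈ s, HasTangentMapAt ℝ (f i) (f' i) x) :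
    HasTangentMapAt ℝ (fun y => ∑ i ∈ s, f i y) (∑ i ∈ s, f' i) x := by
  classical
  induction s using Finset.induction_on with
  | empty => exact hasMFDerivAt_const (0 : ℝ) x
  | insert i T hi ih =>
    simp only [Finset.sum_insert hi]
    exact HasMFDerivAt.add (h i (Finset.mem_insert_self i T))
      (ih fun j hj => h j (Finset.mem_insert_of_mem hj))

/-- Liouville's theorem: Hamiltonian fields preserve the volume. -/
theorem integral_poisson [Nonempty M] (hΩ : IsKahlerForm Ω) {a f : M → ℝ}
    (ha : ContMDiff 𝓘(ℝ, E) 𝓘(ℝ, ℝ) ∞ a) (hf : ContMDiff 𝓘(ℝ, E) 𝓘(ℝ, ℝ) ∞ f) :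
    ∫ x, poisson Ω a f x ∂(volumeOf (metric Ω)) = 0 := by
  have : FiniteDimensional ℝ E := FiniteDimensional.complexToReal E
  have : IsManifold 𝓘(ℝ, E) ∞ M := isManifold_real ∞
  have := isFiniteMeasure_volumeOf hΩ
  -- A subordinate partition of unity writes `f` as a sum of functions supported in charts, finite
  -- by compactness, and the Poisson bracket is linear in `f`.
  obtain ⟨χ, hχ⟩ := SmoothPartitionOfUnity.exists_isSubordinate_chartAt_source 𝓘(ℝ, E) M
  have hfin : {i | (Function.support (χ i)).Nonempty}.Finite := by
    have := χ.locallyFinite.finite_nonempty_of_compact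
    exact this
  set S := hfin.toFinset
  have hsum : ∀ x, f x = ∑ i ∈ S, χ i x * f x := by
    intro x
    have h1 := χ.sum_eq_one (mem_univ x)
    rw [finsum_eq_sum_of_support_subset (s := S)] at h1
    · rw [← Finset.sum_mul, h1, one_mul]
    · intro i hi
      exact hfin.mem_toFinset.2 ⟨x, hi⟩
  have hsm : ∀ i, ContMDiff 𝓘(ℝ, E) 𝓘(ℝ, ℝ) ∞ (fun x => χ i x * f x) := fun i =>
    (χ i).contMDiff.mul hf
  have hp : ∀ x, poisson Ω a f x = ∑ i ∈ S, poisson Ω a (fun x => χ i x * f x) x := by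
    intro x
    have h1 : HasTangentMapAt ℝ (fun x => ∑ i ∈ S, χ i x * f x)
        (∑ i ∈ S, (tangentMapAt ℝ (fun x => χ i x * f x) x : E →L[ℝ] ℝ)) x := by
      exact hasTangentMapAt_sum S fun i _ => MDifferentiableAt.hasTangentMapAt
        ((hsm i).mdifferentiable (by simp) x)
    have h2 : f = fun x => ∑ i ∈ S, χ i x * f x := funext hsum
    simp only [poisson]
    have h3 : tangentMapAt ℝ f x = _ := (congrArg (fun g => tangentMapAt ℝ g x) h2).trans h1.eq
    rw [h3, sum_apply]
  simp only [hp]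
  rw [integral_finsetSum]
  · refine Finset.sum_eq_zero fun i _ => integral_poisson_of_tsupport hΩ ha (hsm i)
      (chart_mem_atlas E i) ((tsupport_mul_subset_left).trans (hχ i))
  · intro i _
    exact (continuous_poisson hΩ ha (hsm i)).integrable_of_hasCompactSupport
      (HasCompactSupport.of_compactSpace _)

end Poisson

/-! ### Uniqueness of potentials, the moment map, and its value on brackets -/

section Potentials

variable {E : Type*} [NormedAddCommGroup E] [NormedSpace ℂ E] [FiniteDimensional ℂ E]
  {M : Type*} [TopologicalSpace M] [ChartedSpace E M]
  {Ω : TwoTensor E M}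

theorem tangentMapAt_re {ζ : M → ℂ} (hζ : ContMDiff 𝓘(ℝ, E) 𝓘(ℝ, ℂ) ∞ ζ) (x : M) (v : E) :
    (tangentMapAt ℝ (fun x => (ζ x).re) x : E →L[ℝ] ℝ) v =
      ((tangentMapAt ℝ ζ x : E →L[ℝ] ℂ) v).re := by
  have h1 := MDifferentiableAt.hasTangentMapAt (hζ.mdifferentiable (by simp) x)
  have h2 : HasTangentMapAt ℝ (Complex.reCLM : ℂ → ℝ) Complex.reCLM (ζ x) :=
    hasTangentMapAt_iff_hasFDerivAt.2 Complex.reCLM.hasFDerivAt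
  have h3 : HasTangentMapAt ℝ (fun x => (ζ x).re) _ x := h2.comp h1
  rw [h3.eq]
  rfl

theorem tangentMapAt_im {ζ : M → ℂ} (hζ : ContMDiff 𝓘(ℝ, E) 𝓘(ℝ, ℂ) ∞ ζ) (x : M) (v : E) :
    (tangentMapAt ℝ (fun x => (ζ x).im) x : E →L[ℝ] ℝ) v =
      ((tangentMapAt ℝ ζ x : E →L[ℝ] ℂ) v).im := by
  have h1 := MDifferentiableAt.hasTangentMapAt (hζ.mdifferentiable (by simp) x)
  have h2 : HasTangentMapAt ℝ (Complex.imCLM : ℂ → ℝ) Complex.imCLM (ζ x) :=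
    hasTangentMapAt_iff_hasFDerivAt.2 Complex.imCLM.hasFDerivAt
  have h3 : HasTangentMapAt ℝ (fun x => (ζ x).im) _ x := h2.comp h1
  rw [h3.eq]
  rfl

theorem form_I_left (hΩ : IsKahlerForm Ω) (x : M) (u v : E) :
    form Ω x (Complex.I • u) v = -form Ω x u (Complex.I • v) := by
  rw [← form_I_I hΩ x (Complex.I • u) v, smul_smul, Complex.I_mul_I, neg_one_smul, map_neg,
    LinearMap.neg_apply]

/-- A Hamiltonian holomorphic field, in terms of the real and imaginary parts of its potential. -/
theorem IsPotential.vec_eq (hΩ : IsKahlerForm Ω) {Ξ : (x : M) → TangentSpace 𝓘(ℂ, E) x}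
    {ζ : M → ℂ} (hζ : IsPotential Ω Ξ ζ) (x : M) :
    vec Ξ x = hamVec Ω x (tangentMapAt ℝ (fun x => (ζ x).re) x)
      + Complex.I • hamVec Ω x (tangentMapAt ℝ (fun x => (ζ x).im) x) := by
  rw [← sub_eq_zero]
  refine form_nondegenerate hΩ x fun v => ?_
  have h := congrArg Complex.re ((isPotential_iff.1 hζ).2 x v)
  simp only [Complex.add_re, Complex.mul_re, Complex.I_re, Complex.I_im, Complex.neg_re,
    Complex.ofReal_re, Complex.ofReal_im] at h
  rw [map_sub, map_add, LinearMap.sub_apply, LinearMap.add_apply, form_I_left hΩ,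
    form_hamVec hΩ, form_hamVec hΩ, tangentMapAt_re hζ.1, tangentMapAt_im hζ.1]
  linarith

/-- The right-hand side is the complex bilinear Poisson bracket of `ζ` and `ζ'`. It arises by
writing the field as `X_a + J X_b` with `a`, `b` the real and imaginary parts of `ζ`, and using the
equation of `ζ'` on `X_a` and `X_b`. Liouville's theorem then applies to each term. -/
theorem bracketPot_eq_poisson (hΩ : IsKahlerForm Ω) {Ξ Ξ' : (x : M) → TangentSpace 𝓘(ℂ, E) x}
    {ζ ζ' : M → ℂ} (hζ : IsPotential Ω Ξ ζ) (hζ' : IsPotential Ω Ξ' ζ') (x : M) :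
    bracketPot Ξ Ξ' ζ ζ' x =
      ((poisson Ω (fun x => (ζ x).re) (fun x => (ζ' x).re) x : ℂ)
        - poisson Ω (fun x => (ζ x).im) (fun x => (ζ' x).im) x)
      + Complex.I * (poisson Ω (fun x => (ζ x).re) (fun x => (ζ' x).im) x
        + poisson Ω (fun x => (ζ x).im) (fun x => (ζ' x).re) x) := by
  have hF := hζ.vec_eq hΩ x
  simp only [poisson, tangentMapAt_re hζ'.1, tangentMapAt_im hζ'.1]
  set A := hamVec Ω x (tangentMapAt ℝ (fun x => (ζ x).re) x) with hA
  set B := hamVec Ω x (tangentMapAt ℝ (fun x => (ζ x).im) x) with hB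
  have eA := (isPotential_iff.1 hζ').2 x A
  have eB := (isPotential_iff.1 hζ').2 x B
  have fA : ∀ v, form Ω x v A = ((tangentMapAt ℝ ζ x : E →L[ℝ] ℂ) v).re := fun v => by
    rw [form_alt hΩ, hA, form_hamVec hΩ, neg_neg, tangentMapAt_re hζ.1]
  have fB : ∀ v, form Ω x v B = ((tangentMapAt ℝ ζ x : E →L[ℝ] ℂ) v).im := fun v => by
    rw [form_alt hΩ, hB, form_hamVec hΩ, neg_neg, tangentMapAt_im hζ.1]
  rw [fA, fA] at eA
  rw [fB, fB] at eB
  have hIF : Complex.I • vec Ξ x = Complex.I • A - B := by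
    rw [hF, smul_add, smul_smul, Complex.I_mul_I, neg_one_smul, sub_eq_add_neg]
  rw [bracketPot, hIF, hF, map_add, map_sub]
  generalize (tangentMapAt ℝ ζ' x : E →L[ℝ] ℂ) A = p at *
  generalize (tangentMapAt ℝ ζ' x : E →L[ℝ] ℂ) B = q at *
  generalize (tangentMapAt ℝ ζ' x : E →L[ℝ] ℂ) (Complex.I • A) = r at *
  generalize (tangentMapAt ℝ ζ' x : E →L[ℝ] ℂ) (Complex.I • B) = s at *
  generalize (tangentMapAt ℝ ζ x : E →L[ℝ] ℂ) (vec Ξ' x) = t at *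
  generalize (tangentMapAt ℝ ζ x : E →L[ℝ] ℂ) (Complex.I • vec Ξ' x) = w at *
  rw [Complex.ext_iff] at *
  simp only [Complex.add_re, Complex.mul_re, Complex.I_re, Complex.I_im, Complex.neg_re,
    Complex.ofReal_re, Complex.ofReal_im, Complex.add_im, Complex.mul_im, Complex.neg_im,
    Complex.sub_re, Complex.sub_im, Complex.div_ofNat_re, Complex.div_ofNat_im, Complex.one_re,
    Complex.one_im] at *
  constructor <;> linarith [eA.1, eA.2, eB.1, eB.2]

variable [IsManifold 𝓘(ℂ, E) ω M]

/-- Two potentials of the same field differ by a constant. -/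
theorem IsPotential.eq_add_const [CompactSpace M] [PreconnectedSpace M]
    {Ξ : (x : M) → TangentSpace 𝓘(ℂ, E) x} {ζ ζ' : M → ℂ} (hζ : IsPotential Ω Ξ ζ)
    (hζ' : IsPotential Ω Ξ ζ') : ∃ k, ∀ x, ζ x = ζ' x + k := by
  have : IsManifold 𝓘(ℂ, E) 1 M := IsManifold.of_le (n := ω) le_top
  have hmd : MDifferentiable 𝓘(ℂ, E) 𝓘(ℂ, ℂ) (fun x => ζ x - ζ' x) := by
    intro x
    set e := chartAt E x
    have he : e ∈ atlas E M := chart_mem_atlas E x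
    have hx : x ∈ e.source := mem_chart_source E x
    have hy : e x ∈ e.target := e.map_source hx
    have h1 := hasFDerivAt_comp_chart_symm he hy (hζ.1.mdifferentiable (by simp) _)
    have h2 := hasFDerivAt_comp_chart_symm he hy (hζ'.1.mdifferentiable (by simp) _)
    have h3 := h1.sub h2
    set D := fderiv ℝ (ζ ∘ e.symm - ζ' ∘ e.symm) (e x)
    have h4 : HasFDerivAt (ζ ∘ e.symm - ζ' ∘ e.symm) D (e x) := h3.differentiableAt.hasFDerivAt
    -- The two potentials have the same `∂̄`, so their difference satisfies the Cauchy-Riemann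
    -- equations; a holomorphic function on a compact connected manifold is constant.
    have hD : ∀ u, D (Complex.I • u) = Complex.I * D u := by
      intro u
      have e1 := hζ.chart_eq he hy u
      have e2 := hζ'.chart_eq he hy u
      have e3 : ∀ v, D v = fderiv ℝ (ζ ∘ e.symm) (e x) v - fderiv ℝ (ζ' ∘ e.symm) (e x) v := by
        intro v
        have : D = _ := h3.fderiv
        rw [this, h1.fderiv, h2.fderiv]
        rfl
      rw [e3, e3]
      linear_combination (-Complex.I) * e1 + Complex.I * e2
        + (fderiv ℝ (ζ ∘ e.symm) (e x) (Complex.I • u)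
          - fderiv ℝ (ζ' ∘ e.symm) (e x) (Complex.I • u)) * Complex.I_mul_I
    let D' : E →L[ℂ] ℂ :=
      { toFun := D
        map_add' := D.map_add
        map_smul' := fun c u => by
          have hc : c • u = c.re • u + c.im • (Complex.I • u) := by
            conv_lhs => rw [← Complex.re_add_im c]
            rw [add_smul, mul_smul]
            rfl
          rw [hc, map_add, map_smul, map_smul, hD, RingHom.id_apply]
          conv_rhs => rw [← Complex.re_add_im c]
          simp only [Complex.real_smul, smul_eq_mul]
          ring
        cont := D.continuous }
    have h5 : HasFDerivAt (ζ ∘ e.symm - ζ' ∘ e.symm) D' (e x) :=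
      hasFDerivAt_of_restrictScalars ℝ h4 rfl
    have h6 := hasTangentMapAt_chart he hy
    rw [e.left_inv hx] at h6
    have h7 : HasTangentMapAt ℂ ((ζ ∘ e.symm - ζ' ∘ e.symm) ∘ e) _ x :=
      (hasTangentMapAt_iff_hasFDerivAt.2 h5).comp h6
    refine (h7.congr_of_eventuallyEq ?_).mdifferentiableAt
    filter_upwards [e.open_source.mem_nhds hx] with z hz
    simp [e.left_inv hz]
  obtain ⟨k, hk⟩ := hmd.exists_eq_const_of_compactSpace
  refine ⟨k, fun x => ?_⟩
  have := congrFun hk x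
  simp only [Function.const_apply] at this
  rw [← this]
  ring

variable [MeasurableSpace E] [BorelSpace E] [CompactSpace M] [T2Space M]
  [MeasurableSpace M] [BorelSpace M]

theorem integral_bracketPot [Nonempty M] (hΩ : IsKahlerForm Ω)
    {Ξ Ξ' : (x : M) → TangentSpace 𝓘(ℂ, E) x} {ζ ζ' : M → ℂ} (hζ : IsPotential Ω Ξ ζ)
    (hζ' : IsPotential Ω Ξ' ζ') : ∫ x, bracketPot Ξ Ξ' ζ ζ' x ∂(volumeOf (metric Ω)) = 0 := by
  have := isFiniteMeasure_volumeOf hΩ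
  have hr : ∀ {ζ : M → ℂ}, ContMDiff 𝓘(ℝ, E) 𝓘(ℝ, ℂ) ∞ ζ →
      ContMDiff 𝓘(ℝ, E) 𝓘(ℝ, ℝ) ∞ (fun x => (ζ x).re) := fun h => Complex.reCLM.contMDiff.comp h
  have hi : ∀ {ζ : M → ℂ}, ContMDiff 𝓘(ℝ, E) 𝓘(ℝ, ℂ) ∞ ζ →
      ContMDiff 𝓘(ℝ, E) 𝓘(ℝ, ℝ) ∞ (fun x => (ζ x).im) := fun h => Complex.imCLM.contMDiff.comp h
  have hI : ∀ {a f : M → ℝ}, ContMDiff 𝓘(ℝ, E) 𝓘(ℝ, ℝ) ∞ a → ContMDiff 𝓘(ℝ, E) 𝓘(ℝ, ℝ) ∞ f →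
      Integrable (fun x => (poisson Ω a f x : ℂ)) (volumeOf (metric Ω)) := fun ha hf =>
    ((continuous_poisson hΩ ha hf).integrable_of_hasCompactSupport
      (HasCompactSupport.of_compactSpace _)).ofReal
  have h0 : ∀ {a f : M → ℝ}, ContMDiff 𝓘(ℝ, E) 𝓘(ℝ, ℝ) ∞ a → ContMDiff 𝓘(ℝ, E) 𝓘(ℝ, ℝ) ∞ f →
      ∫ x, (poisson Ω a f x : ℂ) ∂(volumeOf (metric Ω)) = 0 := fun ha hf => by
    rw [integral_complex_ofReal, integral_poisson hΩ ha hf, Complex.ofReal_zero]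
  have i1 := hI (hr hζ.1) (hr hζ'.1)
  have i2 := hI (hi hζ.1) (hi hζ'.1)
  have i3 := hI (hr hζ.1) (hi hζ'.1)
  have i4 := hI (hi hζ.1) (hr hζ'.1)
  simp only [bracketPot_eq_poisson hΩ hζ hζ']
  have j1 : Integrable (fun x => (poisson Ω (fun x => (ζ x).re) (fun x => (ζ' x).re) x : ℂ)
      - poisson Ω (fun x => (ζ x).im) (fun x => (ζ' x).im) x) (volumeOf (metric Ω)) := i1.sub i2
  have j2 : Integrable (fun x => Complex.I *
      ((poisson Ω (fun x => (ζ x).re) (fun x => (ζ' x).im) x : ℂ)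
        + poisson Ω (fun x => (ζ x).im) (fun x => (ζ' x).re) x)) (volumeOf (metric Ω)) :=
    (i3.add i4).const_mul _
  rw [integral_add j1 j2, integral_sub i1 i2, integral_const_mul,
    integral_add i3 i4, h0 (hr hζ.1) (hr hζ'.1), h0 (hi hζ.1) (hi hζ'.1),
    h0 (hr hζ.1) (hi hζ'.1), h0 (hi hζ.1) (hr hζ'.1)]
  simp

theorem IsPotential.eq_of_integral_eq_zero [PreconnectedSpace M] {μ : Measure M}
    [IsFiniteMeasure μ] (hμ : μ univ ≠ 0)
    {Ξ : (x : M) → TangentSpace 𝓘(ℂ, E) x} {ζ ζ' : M → ℂ} (hζ : IsPotential Ω Ξ ζ)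
    (hζ' : IsPotential Ω Ξ ζ') (h : ∫ x, ζ x ∂μ = 0) (h' : ∫ x, ζ' x ∂μ = 0) : ζ = ζ' := by
  obtain ⟨k, hk⟩ := hζ.eq_add_const hζ'
  have hi : Integrable ζ' μ := hζ'.1.continuous.integrable_of_hasCompactSupport
    (HasCompactSupport.of_compactSpace _)
  have h1 : ∫ x, ζ x ∂μ = ∫ x, ζ' x ∂μ + μ.real univ • k := by
    simp only [hk]
    rw [integral_add hi (integrable_const k), integral_const]
  rw [h, h', zero_add] at h1
  have h2 : μ.real univ ≠ 0 := (measureReal_ne_zero_iff).2 hμ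
  have h3 : k = 0 := (smul_eq_zero.1 h1.symm).resolve_left h2
  funext x
  rw [hk, h3, add_zero]

/-- Only a finite nonzero volume is required of `Ω`, so that the statement also serves for pulled
back forms. -/
theorem IsMomentMap.unique [PreconnectedSpace M]
    {𝔥 : Submodule ℂ ((x : M) → TangentSpace 𝓘(ℂ, E) x)}
    [IsFiniteMeasure (volumeOf (metric Ω))] (hμ : volumeOf (metric Ω) univ ≠ 0)
    {ξ ξ' : M → Module.Dual ℂ 𝔥} (h : IsMomentMap 𝔥 Ω ξ) (h' : IsMomentMap 𝔥 Ω ξ') : ξ = ξ' := by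
  funext x
  refine LinearMap.ext fun Ξ => ?_
  exact congrFun ((h Ξ).1.eq_of_integral_eq_zero hμ (h' Ξ).1 (h Ξ).2 (h' Ξ).2) x

theorem exists_isMomentMap [ConnectedSpace M] (hΩ : IsKahlerForm Ω) :
    ∃ ξ, IsMomentMap (hamFields Ω) Ω ξ := by
  have := isFiniteMeasure_volumeOf hΩ
  have hμ := volumeOf_univ_ne_zero hΩ
  have h1 : ∀ Ξ : hamFields Ω, ∃ ζ, IsPotential Ω Ξ.1 ζ ∧ ∫ x, ζ x ∂(volumeOf (metric Ω)) = 0 := by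
    rintro ⟨Ξ, hΞ, ζ, hζ⟩
    have hi : Integrable ζ (volumeOf (metric Ω)) :=
      hζ.1.continuous.integrable_of_hasCompactSupport (HasCompactSupport.of_compactSpace _)
    set k : ℂ := -(⨍ x, ζ x ∂(volumeOf (metric Ω)))
    refine ⟨fun x => ζ x + k, ?_, ?_⟩
    · rw [isPotential_iff] at hζ ⊢
      refine ⟨hζ.1.add contMDiff_const, fun x v => ?_⟩
      have h2 : HasTangentMapAt ℝ (fun x => ζ x + k) (tangentMapAt ℝ ζ x + 0 : E →L[ℝ] ℂ) x :=
        HasMFDerivAt.add (MDifferentiableAt.hasTangentMapAt (hζ.1.mdifferentiable (by simp) x))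
          (hasMFDerivAt_const k x)
      rw [h2.eq, add_zero]
      exact hζ.2 x v
    · have h2 : (volumeOf (metric Ω)).real univ ≠ 0 := (measureReal_ne_zero_iff).2 hμ
      rw [integral_add hi (integrable_const k), integral_const, smul_neg,
        measure_smul_average, add_neg_cancel]
  choose Z hZ hZ0 using h1
  refine ⟨fun x =>
    { toFun := fun Ξ => Z Ξ x
      map_add' := fun Ξ Ξ' => ?_
      map_smul' := fun c Ξ => ?_ }, fun Ξ => ⟨hZ Ξ, hZ0 Ξ⟩⟩
  -- Linearity in the field follows from uniqueness of the potential with mean value zero.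
  · have hi : ∀ Ξ, Integrable (Z Ξ) (volumeOf (metric Ω)) := fun Ξ =>
      (hZ Ξ).1.continuous.integrable_of_hasCompactSupport (HasCompactSupport.of_compactSpace _)
    refine congrFun ((hZ (Ξ + Ξ')).eq_of_integral_eq_zero hμ (isPotential_add (hZ Ξ) (hZ Ξ'))
      (hZ0 _) ?_) x
    simp only [Pi.add_apply]
    rw [integral_add (hi Ξ) (hi Ξ'), hZ0, hZ0, add_zero]
  · refine congrFun ((hZ (c • Ξ)).eq_of_integral_eq_zero hμ (isPotential_smul c (hZ Ξ))
      (hZ0 _) ?_) x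
    rw [integral_const_mul, hZ0, mul_zero]

theorem isMomentMap_momentMap [ConnectedSpace M] (hΩ : IsKahlerForm Ω) :
    IsMomentMap (hamFields Ω) Ω (momentMap (hamFields Ω) Ω) :=
  Classical.epsilon_spec (exists_isMomentMap hΩ)

/-- The moment map of a bracket. -/
theorem momentMap_bracket [ConnectedSpace M] (hΩ : IsKahlerForm Ω) (Ξ Ξ' : hamFields Ω) (x : M) :
    momentMap (hamFields Ω) Ω x ⟨bracket Ξ.1 Ξ'.1, bracket_mem_hamFields hΩ Ξ.2 Ξ'.2⟩ =
      bracketPot Ξ.1 Ξ'.1 (fun x => momentMap (hamFields Ω) Ω x Ξ)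
        (fun x => momentMap (hamFields Ω) Ω x Ξ') x := by
  have := isFiniteMeasure_volumeOf hΩ
  have h := isMomentMap_momentMap hΩ
  have h1 := h ⟨bracket Ξ.1 Ξ'.1, bracket_mem_hamFields hΩ Ξ.2 Ξ'.2⟩
  exact congrFun (h1.1.eq_of_integral_eq_zero (volumeOf_univ_ne_zero hΩ)
    (isPotential_bracket hΩ Ξ.2.1 Ξ'.2.1 (h Ξ).1 (h Ξ').1) h1.2
    (integral_bracketPot hΩ (h Ξ).1 (h Ξ').1)) x

end Potentials

/-! ### Local flows of holomorphic fields and their dependence on the initial value -/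

section Flow

universe u

variable {E : Type u} [NormedAddCommGroup E] [NormedSpace ℂ E]

/-- `γ` is a family of solutions of `γ' = f(γ)` in `U`, for the times in `(-ε, ε)` and the initial
values at distance less than `r` from `x₀`. -/
structure IsLocalFlow (f : E → E) (U : Set E) (x₀ : E) (r ε : ℝ) (γ : E → ℝ → E) : Prop where
  r_pos : 0 < r
  ε_pos : 0 < ε
  zero : ∀ x ∈ Metric.ball x₀ r, γ x 0 = x
  mem : ∀ x ∈ Metric.ball x₀ r, ∀ t ∈ Ioo (-ε) ε, γ x t ∈ U
  deriv : ∀ x ∈ Metric.ball x₀ r, ∀ t ∈ Ioo (-ε) ε, HasDerivAt (γ x) (f (γ x t)) t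

theorem dist_le_of_solutions {f : E → E} {s : Set E} {K : NNReal} (hf : LipschitzOnWith K f s)
    {ε : ℝ} {α β : ℝ → E} (hα : ∀ t ∈ Ioo (-ε) ε, HasDerivAt α (f (α t)) t)
    (hβ : ∀ t ∈ Ioo (-ε) ε, HasDerivAt β (f (β t)) t) (hαs : ∀ t ∈ Ioo (-ε) ε, α t ∈ s)
    (hβs : ∀ t ∈ Ioo (-ε) ε, β t ∈ s) {t : ℝ} (ht : t ∈ Ico 0 ε) :
    dist (α t) (β t) ≤ dist (α 0) (β 0) * Real.exp (K * t) := by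
  have hsub : ∀ s ∈ Icc 0 t, s ∈ Ioo (-ε) ε := fun s hs =>
    ⟨by linarith [ht.1, ht.2, hs.1], hs.2.trans_lt ht.2⟩
  have hsub' : ∀ s ∈ Ico 0 t, s ∈ Ioo (-ε) ε := fun s hs => hsub s ⟨hs.1, hs.2.le⟩
  have h := dist_le_of_trajectories_ODE_of_mem (v := fun _ => f) (s := fun _ => s) (K := K)
    (f := α) (g := β) (a := 0) (b := t) (δ := dist (α 0) (β 0)) (fun _ _ => hf)
    (fun s hs => (hα s (hsub s hs)).continuousAt.continuousWithinAt)
    (fun s hs => (hα s (hsub' s hs)).hasDerivWithinAt)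
    (fun s hs => hαs s (hsub' s hs))
    (fun s hs => (hβ s (hsub s hs)).continuousAt.continuousWithinAt)
    (fun s hs => (hβ s (hsub' s hs)).hasDerivWithinAt)
    (fun s hs => hβs s (hsub' s hs)) le_rfl t ⟨ht.1, le_rfl⟩
  simpa using h

/-- The Picard-Lindelöf fixed point also stays in the ball of radius `a`. This confinement keeps
solutions in the domain and makes the Lipschitz estimates available. -/
theorem exists_solution_mem_closedBall [CompleteSpace E] {f : ℝ → E → E} {tmin tmax : ℝ}
    {t₀ : Icc tmin tmax} {x₀ x : E} {a r L K : NNReal} (hf : IsPicardLindelof f t₀ x₀ a r L K)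
    (hx : x ∈ Metric.closedBall x₀ r) :
    ∃ α : ℝ → E, α t₀ = x ∧ (∀ t, α t ∈ Metric.closedBall x₀ a) ∧
      ∀ t ∈ Icc tmin tmax, HasDerivWithinAt α (f t (α t)) (Icc tmin tmax) t := by
  obtain ⟨α, hα⟩ := ODE.FunSpace.exists_isFixedPt_next hf hx
  refine ⟨α.compProj, by rw [ODE.FunSpace.compProj_val, ← hα, ODE.FunSpace.next_apply₀],
    fun t => α.compProj_mem_closedBall hf.mul_max_le, fun t ht => ?_⟩
  refine (ODE.hasDerivWithinAt_picard_Icc t₀.2 hf.continuousOn_uncurry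
    α.continuous_compProj.continuousOn (fun _ ht' => α.compProj_mem_closedBall hf.mul_max_le)
    x ht).congr_of_mem (fun t' ht' => ?_) ht
  nth_rw 1 [← hα]
  rw [ODE.FunSpace.compProj_of_mem ht', ODE.FunSpace.next_apply]

theorem exists_isLocalFlow_continuousOn [CompleteSpace E] {f : E → E} {U : Set E} (hU : IsOpen U)
    (hf : ContDiffOn ℂ ∞ f U) {x₀ : E} (hx₀ : x₀ ∈ U) :
    ∃ r ε γ, IsLocalFlow f U x₀ r ε γ ∧
      ∀ t ∈ Ico 0 ε, ContinuousOn (fun x => γ x t) (Metric.ball x₀ r) := by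
  have h1 : ContDiffAt ℝ 1 f x₀ :=
    ((hf.contDiffAt (hU.mem_nhds hx₀)).restrict_scalars ℝ).of_le (by simp)
  obtain ⟨K, s, hs, hl⟩ := h1.exists_lipschitzOnWith
  obtain ⟨a, ha, has⟩ := Metric.nhds_basis_closedBall.mem_iff.1
    (inter_mem hs (hU.mem_nhds hx₀))
  set L : ℝ := K * a + ‖f x₀‖ + 1 with hL
  have hL0 : 0 < L := by positivity
  have hl' : LipschitzOnWith K f (Metric.closedBall x₀ a) := hl.mono fun x hx => (has hx).1
  have hb : ∀ x ∈ Metric.closedBall x₀ a, ‖f x‖ ≤ L := fun x hx => by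
    have h2 : ‖f x - f x₀‖ ≤ K * ‖x - x₀‖ :=
      hl'.norm_sub_le hx (Metric.mem_closedBall_self ha.le)
    have h3 : ‖x - x₀‖ ≤ a := by rwa [← dist_eq_norm]
    have h4 : ‖f x‖ ≤ ‖f x - f x₀‖ + ‖f x₀‖ := norm_le_norm_sub_add _ _
    have h5 : K * ‖x - x₀‖ ≤ K * a := by gcongr
    linarith
  -- Solutions start within `a / 2` of `x₀` and move with speed at most `L`, so they stay in the
  -- ball of radius `a` up to this time.
  set ε : ℝ := a / 2 / L with hε
  have hε0 : 0 < ε := by positivity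
  have hmem : (0 : ℝ) ∈ Icc (-ε) ε := ⟨by linarith, hε0.le⟩
  have hP : IsPicardLindelof (fun _ => f) (tmin := -ε) (tmax := ε) ⟨0, hmem⟩
      x₀ ⟨a, ha.le⟩ ⟨a / 2, by positivity⟩ ⟨L, hL0.le⟩ K := by
    refine IsPicardLindelof.of_time_independent hb hl' ?_
    change L * max (ε - 0) (0 - -ε) ≤ a - a / 2
    rw [sub_zero, zero_sub, neg_neg, max_self, hε, mul_div_cancel₀ _ hL0.ne']
    linarith
  have hex : ∀ x ∈ Metric.ball x₀ (a / 2), ∃ α : ℝ → E, α 0 = x ∧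
      (∀ t ∈ Ioo (-ε) ε, α t ∈ Metric.closedBall x₀ a) ∧
      ∀ t ∈ Ioo (-ε) ε, HasDerivAt α (f (α t)) t := fun x hx => by
    have hx' : x ∈ Metric.closedBall x₀ (⟨a / 2, by positivity⟩ : NNReal) :=
      Metric.ball_subset_closedBall hx
    obtain ⟨α, h2, h3, h4⟩ := exists_solution_mem_closedBall hP hx'
    exact ⟨α, h2, fun t _ => h3 t, fun t ht =>
      (h4 t (Ioo_subset_Icc_self ht)).hasDerivAt (Icc_mem_nhds ht.1 ht.2)⟩
  choose! γ hγ0 hγm hγ using hex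
  refine ⟨a / 2, ε, γ, ⟨by positivity, hε0, hγ0, fun x hx t ht => (has (hγm x hx t ht)).2, hγ⟩,
    fun t ht => ?_⟩
  have : LipschitzOnWith (Real.toNNReal (Real.exp (K * t))) (fun x => γ x t)
      (Metric.ball x₀ (a / 2)) := by
    refine LipschitzOnWith.of_dist_le_mul fun x hx z hz => ?_
    rw [Real.coe_toNNReal _ (Real.exp_pos _).le]
    have := dist_le_of_solutions hl' (hγ x hx) (hγ z hz) (hγm x hx) (hγm z hz) ht
    rwa [hγ0 x hx, hγ0 z hz, mul_comm] at this
  exact this.continuousOn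

/-- The solutions of the linearised equation approximate differences of solutions. -/
theorem norm_sub_sub_le_of_solutions {f : E → E} {f' : E → E →L[ℂ] E} {B : Set E}
    (hB : Convex ℝ B) (hf : ∀ x ∈ B, HasFDerivWithinAt f (f' x) B x) {K K' : NNReal}
    (hK : ∀ x ∈ B, ‖f' x‖ ≤ K) (hK' : LipschitzOnWith K' f' B)
    {ε : ℝ} {α β : ℝ → E} {Y : ℝ → E →L[ℂ] E} (hα : ∀ t ∈ Ioo (-ε) ε, HasDerivAt α (f (α t)) t)
    (hβ : ∀ t ∈ Ioo (-ε) ε, HasDerivAt β (f (β t)) t) (hαs : ∀ t ∈ Ioo (-ε) ε, α t ∈ B)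
    (hβs : ∀ t ∈ Ioo (-ε) ε, β t ∈ B)
    (hY : ∀ t ∈ Ioo (-ε) ε, HasDerivAt Y ((f' (α t)).comp (Y t)) t)
    (hY0 : Y 0 = ContinuousLinearMap.id ℂ E) {t : ℝ} (ht : t ∈ Ico 0 ε) :
    ‖β t - α t - Y t (β 0 - α 0)‖ ≤
      gronwallBound 0 K (K' * Real.exp (K * ε) ^ 2 * ‖β 0 - α 0‖ ^ 2) t := by
  have hsub : ∀ s ∈ Icc 0 t, s ∈ Ioo (-ε) ε := fun s hs =>
    ⟨by linarith [ht.1, ht.2, hs.1], hs.2.trans_lt ht.2⟩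
  have hsub' : ∀ s ∈ Ico 0 t, s ∈ Ioo (-ε) ε := fun s hs => hsub s ⟨hs.1, hs.2.le⟩
  set d := β 0 - α 0 with hd
  have hu : ∀ s ∈ Ioo (-ε) ε, HasDerivAt (fun s => β s - α s - Y s d)
      (f (β s) - f (α s) - (f' (α s)) (Y s d)) s := fun s hs => by
    have h1 : HasDerivAt (fun s => Y s d) (f' (α s) (Y s d)) s :=
      (((ContinuousLinearMap.apply ℂ E d).restrictScalars ℝ).hasFDerivAt).comp_hasDerivAt s (hY s hs)
    exact ((hβ s hs).sub (hα s hs)).sub h1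
  have hfl : LipschitzOnWith K f B := by
    refine LipschitzOnWith.of_dist_le_mul fun x hx z hz => ?_
    rw [dist_eq_norm, dist_eq_norm]
    exact hB.norm_image_sub_le_of_norm_hasFDerivWithin_le (𝕜 := ℂ) hf hK hz hx
  have hrem : ∀ x ∈ B, ∀ z ∈ B, ‖f z - f x - f' x (z - x)‖ ≤ K' * ‖z - x‖ ^ 2 := by
    intro x hx z hz
    have hseg : segment ℝ x z ⊆ B := hB.segment_subset hx hz
    have h1 : ∀ y ∈ segment ℝ x z,
        HasFDerivWithinAt (fun y => f y - f' x y) (f' y - f' x) (segment ℝ x z) y := fun y hy =>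
      ((hf y (hseg hy)).mono hseg).sub (f' x).hasFDerivWithinAt
    have h2 : ∀ y ∈ segment ℝ x z, ‖f' y - f' x‖ ≤ K' * ‖z - x‖ := fun y hy => by
      refine (hK'.norm_sub_le (hseg hy) hx).trans ?_
      gcongr
      exact norm_sub_le_of_mem_segment hy
    have h3 := (convex_segment x z).norm_image_sub_le_of_norm_hasFDerivWithin_le (𝕜 := ℂ) h1 h2
      (left_mem_segment ℝ x z) (right_mem_segment ℝ x z)
    rw [map_sub]
    convert! h3 using 1
    · congr 1
      abel
    · ring
  have h := norm_le_gronwallBound_of_norm_deriv_right_le (E := E) (f := fun s => β s - α s - Y s d)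
    (f' := fun s => f (β s) - f (α s) - (f' (α s)) (Y s d)) (δ := 0) (K := K)
    (ε := K' * Real.exp (K * ε) ^ 2 * ‖d‖ ^ 2) (a := 0) (b := t)
    (fun s hs => (hu s (hsub s hs)).continuousAt.continuousWithinAt)
    (fun s hs => (hu s (hsub' s hs)).hasDerivWithinAt) (by simp [hY0, hd]) ?_ t ⟨ht.1, le_rfl⟩
  · simpa using h
  · intro s hs
    have hs' := hsub' s hs
    -- The first term is the linear part for Grönwall. The second is the Taylor remainder of `f`,
    -- quadratic in `β s - α s` and so, by `dist_le_of_solutions`, in the initial distance.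
    have e1 : f (β s) - f (α s) - (f' (α s)) (Y s d) =
        f' (α s) (β s - α s - Y s d) + (f (β s) - f (α s) - f' (α s) (β s - α s)) := by
      rw [map_sub (f' (α s)) (β s - α s)]
      abel
    have e2 := hrem _ (hαs s hs') _ (hβs s hs')
    have e3 := dist_le_of_solutions hfl hβ hα hβs hαs
      (⟨hs.1, hs.2.trans ht.2⟩ : s ∈ Ico 0 ε)
    rw [dist_eq_norm, dist_eq_norm, ← hd] at e3
    have e4 : ‖β s - α s‖ ≤ ‖d‖ * Real.exp (K * ε) := e3.trans (by
      gcongr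
      exact hs'.2.le)
    rw [e1]
    refine (norm_add_le _ _).trans (add_le_add ?_ (e2.trans ?_))
    · exact ((f' (α s)).le_opNorm _).trans (by
        gcongr
        exact hK _ (hαs s hs'))
    · calc (K' : ℝ) * ‖β s - α s‖ ^ 2 ≤ K' * (‖d‖ * Real.exp (K * ε)) ^ 2 := by gcongr
        _ = _ := by ring

/-- The error made by the linearised flow is quadratic in the distance of the initial values, hence
`o(‖z - x‖)`. -/
theorem hasFDerivAt_of_solutions {f : E → E} {f' : E → E →L[ℂ] E} {B : Set E}
    (hB : Convex ℝ B) (hf : ∀ x ∈ B, HasFDerivWithinAt f (f' x) B x) {K K' : NNReal}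
    (hK : ∀ x ∈ B, ‖f' x‖ ≤ K) (hK' : LipschitzOnWith K' f' B) {x₀ : E} {r ε : ℝ}
    {γ : E → ℝ → E} (hγ : IsLocalFlow f B x₀ r ε γ) {x : E} (hx : x ∈ Metric.ball x₀ r)
    {Y : ℝ → E →L[ℂ] E} (hY : ∀ t ∈ Ioo (-ε) ε, HasDerivAt Y ((f' (γ x t)).comp (Y t)) t)
    (hY0 : Y 0 = ContinuousLinearMap.id ℂ E) {t : ℝ} (ht : t ∈ Ico 0 ε) :
    HasFDerivAt (fun z => γ z t) (Y t) x := by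
  -- With initial value zero the Grönwall bound is linear in the inhomogeneity, which is the
  -- quadratic error here.
  obtain ⟨C, hC⟩ : ∃ C : ℝ, ∀ δ, gronwallBound 0 K δ t = δ * C := by
    by_cases h : (K : ℝ) = 0
    · refine ⟨t, fun δ => ?_⟩
      rw [h, gronwallBound_K0]
      ring
    · refine ⟨(Real.exp (K * t) - 1) / K, fun δ => ?_⟩
      rw [gronwallBound_of_K_ne_0 h]
      ring
  set C' : ℝ := K' * Real.exp (K * ε) ^ 2 * C
  have hb : ∀ z ∈ Metric.ball x₀ r, ‖γ z t - γ x t - Y t (z - x)‖ ≤ C' * ‖z - x‖ ^ 2 := by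
    intro z hz
    have := norm_sub_sub_le_of_solutions hB hf hK hK' (hγ.deriv x hx) (hγ.deriv z hz)
      (hγ.mem x hx) (hγ.mem z hz) hY hY0 ht
    rw [hγ.zero z hz, hγ.zero x hx, hC] at this
    refine this.trans (le_of_eq ?_)
    ring
  rw [hasFDerivAt_iff_isLittleO]
  have h1 : (fun z => γ z t - γ x t - Y t (z - x)) =O[𝓝 x] fun z => ‖z - x‖ ^ 2 := by
    refine Asymptotics.IsBigO.of_bound C' ?_
    filter_upwards [Metric.isOpen_ball.mem_nhds hx] with z hz
    rw [norm_pow, norm_norm]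
    exact hb z hz
  refine h1.trans_isLittleO ?_
  have h2 : Tendsto (fun z => z - x) (𝓝 x) (𝓝 0) := by
    have : Tendsto (fun z => z - x) (𝓝 x) (𝓝 (x - x)) := tendsto_id.sub_const x
    rwa [sub_self] at this
  exact (Asymptotics.isLittleO_norm_pow_id one_lt_two).comp_tendsto h2

/-- A local flow of class `C^n`, with the linearised flow. -/
structure IsSmoothLocalFlow (n : ℕ) (f : E → E) (U : Set E) (x₀ : E) (r ε : ℝ) (γ : E → ℝ → E)
    (Y : E → ℝ → E →L[ℂ] E) : Prop extends IsLocalFlow f U x₀ r ε γ where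
  contDiffOn : ∀ t ∈ Ico 0 ε, ContDiffOn ℂ n (fun x => γ x t) (Metric.ball x₀ r)
  linear_zero : ∀ x ∈ Metric.ball x₀ r, Y x 0 = ContinuousLinearMap.id ℂ E
  linear_deriv : ∀ x ∈ Metric.ball x₀ r, ∀ t ∈ Ioo (-ε) ε,
    HasDerivAt (Y x) ((fderiv ℂ f (γ x t)).comp (Y x t)) t
  hasFDerivAt : ∀ x ∈ Metric.ball x₀ r, ∀ t ∈ Ico 0 ε, HasFDerivAt (fun z => γ z t) (Y x t) x

/-- The flow together with its linearisation solves an equation of the same kind on `E × (E →L[ℂ]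
E)`. The inductive hypothesis there makes the linearisation `Y` of class `C^n`; since `Y` is the
derivative of the flow, the flow is of class `C^(n+1)`. Hence the induction must range over all
spaces. -/
theorem exists_isSmoothLocalFlow_succ [CompleteSpace E] {f : E → E} {U : Set E} (hU : IsOpen U)
    (hf : ContDiffOn ℂ ∞ f U) {x₀ : E} (hx₀ : x₀ ∈ U) {n : ℕ}
    (ih : ∀ (F : E × (E →L[ℂ] E) → E × (E →L[ℂ] E)) (V : Set (E × (E →L[ℂ] E))), IsOpen V →
      ContDiffOn ℂ ∞ F V → ∀ p ∈ V, ∃ r ε γ, IsLocalFlow F V p r ε γ ∧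
        ∀ t ∈ Ico 0 ε, ContDiffOn ℂ n (fun x => γ x t) (Metric.ball p r)) :
    ∃ r ε γ Y, IsSmoothLocalFlow (n + 1) f U x₀ r ε γ Y := by
  have hf' : ContDiffOn ℂ ∞ (fderiv ℂ f) U := hf.fderiv_of_isOpen hU (by simp)
  have h1 : ContDiffAt ℂ 1 (fderiv ℂ f) x₀ := (hf'.contDiffAt (hU.mem_nhds hx₀)).of_le (by simp)
  obtain ⟨K', s, hs, hl⟩ := h1.exists_lipschitzOnWith
  have h2 : ∀ᶠ x in 𝓝 x₀, ‖fderiv ℂ f x‖ < ‖fderiv ℂ f x₀‖ + 1 :=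
    h1.continuousAt.norm.eventually_lt continuousAt_const (lt_add_one _)
  -- A ball is taken because the remainder estimates need a convex set on which `fderiv ℂ f` is
  -- bounded and Lipschitz.
  obtain ⟨a, ha, has⟩ := Metric.nhds_basis_ball.mem_iff.1
    (inter_mem (inter_mem hs (hU.mem_nhds hx₀)) h2)
  set B := Metric.ball x₀ a with hB
  have hBU : B ⊆ U := fun x hx => (has hx).1.2
  set F : E × (E →L[ℂ] E) → E × (E →L[ℂ] E) := fun p => (f p.1, (fderiv ℂ f p.1).comp p.2) with hF
  have hFs : ContDiffOn ℂ ∞ F (B ×ˢ univ) := by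
    have hm : MapsTo Prod.fst (B ×ˢ (univ : Set (E →L[ℂ] E))) U := fun p hp => hBU hp.1
    refine ContDiffOn.prodMk (hf.comp contDiffOn_fst hm) ?_
    exact (hf'.comp contDiffOn_fst hm).clm_comp contDiffOn_snd
  obtain ⟨r, ε, Γ, hΓ, hΓs⟩ := ih F (B ×ˢ univ) (Metric.isOpen_ball.prod isOpen_univ) hFs
    (x₀, ContinuousLinearMap.id ℂ E) ⟨Metric.mem_ball_self ha, mem_univ _⟩
  have hemb : ∀ x ∈ Metric.ball x₀ r, (x, ContinuousLinearMap.id ℂ E) ∈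
      Metric.ball (x₀, ContinuousLinearMap.id ℂ E) r := fun x hx => by
    rw [Metric.mem_ball, Prod.dist_eq, dist_self]
    exact max_lt hx hΓ.r_pos
  set γ : E → ℝ → E := fun x t => (Γ (x, ContinuousLinearMap.id ℂ E) t).1 with hγ
  set Y : E → ℝ → E →L[ℂ] E := fun x t => (Γ (x, ContinuousLinearMap.id ℂ E) t).2 with hY
  have hγB : IsLocalFlow f B x₀ r ε γ :=
    ⟨hΓ.r_pos, hΓ.ε_pos, fun x hx => congrArg Prod.fst (hΓ.zero _ (hemb x hx)),
      fun x hx t ht => (hΓ.mem _ (hemb x hx) t ht).1,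
      fun x hx t ht => (hΓ.deriv _ (hemb x hx) t ht).fst⟩
  have hY0 : ∀ x ∈ Metric.ball x₀ r, Y x 0 = ContinuousLinearMap.id ℂ E := fun x hx =>
    congrArg Prod.snd (hΓ.zero _ (hemb x hx))
  have hYd : ∀ x ∈ Metric.ball x₀ r, ∀ t ∈ Ioo (-ε) ε,
      HasDerivAt (Y x) ((fderiv ℂ f (γ x t)).comp (Y x t)) t := fun x hx t ht =>
    (hΓ.deriv _ (hemb x hx) t ht).snd
  have hfB : ∀ x ∈ B, HasFDerivWithinAt f (fderiv ℂ f x) B x := fun x hx =>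
    ((hf.differentiableOn (by simp)).differentiableAt
      (hU.mem_nhds (hBU hx))).hasFDerivAt.hasFDerivWithinAt
  have hfd : ∀ x ∈ Metric.ball x₀ r, ∀ t ∈ Ico 0 ε, HasFDerivAt (fun z => γ z t) (Y x t) x :=
    fun x hx t ht => hasFDerivAt_of_solutions (f' := fderiv ℂ f) (K := ‖fderiv ℂ f x₀‖₊ + 1)
      (convex_ball x₀ a) hfB (fun x hx => by simpa using (has hx).2.le)
      (hl.mono fun x hx => (has hx).1.1) hγB hx (hYd x hx) (hY0 x hx) ht
  refine ⟨r, ε, γ, Y, ⟨⟨hΓ.r_pos, hΓ.ε_pos, hγB.zero, fun x hx t ht => hBU (hγB.mem x hx t ht),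
    hγB.deriv⟩, fun t ht => ?_, hY0, hYd, hfd⟩⟩
  have hYs : ContDiffOn ℂ n (fun x => Y x t) (Metric.ball x₀ r) :=
    contDiff_snd.comp_contDiffOn ((hΓs t ht).comp
      (contDiff_id.prodMk contDiff_const).contDiffOn hemb)
  rw [show ((n + 1 : ℕ) : ℕ∞ω) = (n : ℕ∞ω) + 1 by push_cast; rfl,
    contDiffOn_succ_iff_fderiv_of_isOpen Metric.isOpen_ball]
  refine ⟨fun x hx => (hfd x hx t ht).differentiableAt.differentiableWithinAt, by simp, ?_⟩
  exact hYs.congr fun x hx => (hfd x hx t ht).fderiv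

theorem exists_isLocalFlow_contDiffOn (n : ℕ) : ∀ {E : Type u} [NormedAddCommGroup E]
    [NormedSpace ℂ E] [CompleteSpace E] {f : E → E} {U : Set E}, IsOpen U → ContDiffOn ℂ ∞ f U →
    ∀ {x₀ : E}, x₀ ∈ U → ∃ r ε γ, IsLocalFlow f U x₀ r ε γ ∧
      ∀ t ∈ Ico 0 ε, ContDiffOn ℂ n (fun x => γ x t) (Metric.ball x₀ r) := by
  induction n with
  | zero =>
    intro E _ _ _ f U hU hf x₀ hx₀
    obtain ⟨r, ε, γ, h1, h2⟩ := exists_isLocalFlow_continuousOn hU hf hx₀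
    exact ⟨r, ε, γ, h1, fun t ht => contDiffOn_zero.2 (h2 t ht)⟩
  | succ n ih =>
    intro E _ _ _ f U hU hf x₀ hx₀
    obtain ⟨r, ε, γ, Y, h⟩ := exists_isSmoothLocalFlow_succ hU hf hx₀ (n := n)
      fun F V hV hF p hp => ih hV hF hp
    exact ⟨r, ε, γ, h.toIsLocalFlow, h.contDiffOn⟩

/-- Holomorphic vector fields have local flows of class `C^n`. -/
theorem exists_isSmoothLocalFlow [CompleteSpace E] {f : E → E} {U : Set E} (hU : IsOpen U)
    (hf : ContDiffOn ℂ ∞ f U) {x₀ : E} (hx₀ : x₀ ∈ U) (n : ℕ) :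
    ∃ r ε γ Y, IsSmoothLocalFlow (n + 1) f U x₀ r ε γ Y :=
  exists_isSmoothLocalFlow_succ hU hf hx₀ fun _ _ hV hF _ hp =>
    exists_isLocalFlow_contDiffOn n hV hF hp

end Flow

/-! ### The linearised flow on a bracket-invariant family of fields -/

section Transport

variable {E : Type*} [NormedAddCommGroup E] [NormedSpace ℂ E]

theorem hasDerivAt_exp_neg_smul {V : Type*} [NormedAddCommGroup V] [NormedSpace ℂ V]
    [CompleteSpace V] (A : V →L[ℂ] V) (v : V) (t : ℝ) :
    HasDerivAt (fun t : ℝ => NormedSpace.exp (t • -A) v) (-A (NormedSpace.exp (t • -A) v)) t := by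
  have h1 := hasDerivAt_exp_smul_const' (𝕂 := ℝ) (-A) t
  exact (((ContinuousLinearMap.apply ℂ V v).restrictScalars ℝ).hasFDerivAt).comp_hasDerivAt t h1

/-- A family of fields, spanned by `ρ i`, which is preserved by the bracket with `F`, is transported
by the linearised flow of `F`. -/
theorem linear_flow_eq {ι : Type*} [Fintype ι] {F : E → E} {U : Set E} (hU : IsOpen U)
    (hF : ContDiffOn ℂ ∞ F U)
    {ρ : ι → E → E} (hρ : ∀ i, DifferentiableOn ℂ (ρ i) U) {A : (ι → ℂ) →L[ℂ] (ι → ℂ)}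
    (hA : ∀ y ∈ U, ∀ v : ι → ℂ, ∑ i, v i • fderiv ℂ (ρ i) y (F y)
      - fderiv ℂ F y (∑ i, v i • ρ i y) = ∑ i, A v i • ρ i y)
    {ε : ℝ} {α : ℝ → E} (hα : ∀ t ∈ Ioo (-ε) ε, HasDerivAt α (F (α t)) t)
    (hαU : ∀ t ∈ Ioo (-ε) ε, α t ∈ U) {Y : ℝ → E →L[ℂ] E}
    (hY : ∀ t ∈ Ioo (-ε) ε, HasDerivAt Y ((fderiv ℂ F (α t)).comp (Y t)) t)
    (hY0 : Y 0 = ContinuousLinearMap.id ℂ E) (v : ι → ℂ) {t : ℝ} (ht : t ∈ Ico 0 ε) :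
    Y t (∑ i, v i • ρ i (α 0)) = ∑ i, NormedSpace.exp (t • -A) v i • ρ i (α t) := by
  have hsub : ∀ s ∈ Icc 0 t, s ∈ Ioo (-ε) ε := fun s hs =>
    ⟨by linarith [ht.1, ht.2, hs.1], hs.2.trans_lt ht.2⟩
  set d := ∑ i, v i • ρ i (α 0) with hd
  set c : ℝ → ι → ℂ := fun t => NormedSpace.exp (t • -A) v with hc
  have hcd : ∀ s, HasDerivAt c (-A (c s)) s := fun s => hasDerivAt_exp_neg_smul A v s
  -- Along the curve `(∑ cᵢ ρᵢ)' = F'(∑ cᵢ ρᵢ) + ∑ (A c)ᵢ ρᵢ + ∑ cᵢ' ρᵢ`, so `c' = -A c` makes the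
  -- sum a solution of the linearised equation. Then `u` solves that equation with initial value
  -- zero and vanishes by Grönwall.
  set u : ℝ → E := fun s => Y s d - ∑ i, c s i • ρ i (α s) with hu
  have hud : ∀ s ∈ Ioo (-ε) ε, HasDerivAt u (fderiv ℂ F (α s) (u s)) s := by
    intro s hs
    have h1 : HasDerivAt (fun s => Y s d) (fderiv ℂ F (α s) (Y s d)) s :=
      (((ContinuousLinearMap.apply ℂ E d).restrictScalars ℝ).hasFDerivAt).comp_hasDerivAt s (hY s hs)
    have h2 : ∀ i, HasDerivAt (fun s => c s i • ρ i (α s))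
        (c s i • fderiv ℂ (ρ i) (α s) (F (α s)) + (-A (c s)) i • ρ i (α s)) s := fun i => by
      have e1 := hasDerivAt_pi.1 (hcd s) i
      have e2 := (((hρ i).differentiableAt (hU.mem_nhds (hαU s hs))).hasFDerivAt.restrictScalars
        ℝ).comp_hasDerivAt s (hα s hs)
      exact e1.smul e2
    have h3 := h1.sub (HasDerivAt.fun_sum fun i (_ : i ∈ Finset.univ) => h2 i)
    refine h3.congr_deriv ?_
    have h4 := hA _ (hαU s hs) (c s)
    rw [Finset.sum_add_distrib, hu]
    simp only [Pi.neg_apply, neg_smul, Finset.sum_neg_distrib]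
    rw [← h4, map_sub]
    abel
  have hK : ∃ K, ∀ s ∈ Icc 0 t, ‖fderiv ℂ F (α s)‖ ≤ K := by
    have hcont : ContinuousOn (fun s => fderiv ℂ F (α s)) (Icc 0 t) := by
      refine ((hF.fderiv_of_isOpen hU (m := ∞) (by simp)).continuousOn).comp
        (fun s hs => (hα s (hsub s hs)).continuousAt.continuousWithinAt)
        fun s hs => hαU s (hsub s hs)
    exact isCompact_Icc.exists_bound_of_continuousOn hcont
  obtain ⟨K, hK⟩ := hK
  have h0 := eq_zero_of_abs_deriv_le_mul_abs_self_of_eq_zero_right (f := u)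
    (f' := fun s => fderiv ℂ F (α s) (u s)) (K := K) (a := 0) (b := t)
    (fun s hs => (hud s (hsub s hs)).continuousAt.continuousWithinAt)
    (fun s hs => (hud s (hsub s ⟨hs.1, hs.2.le⟩)).hasDerivWithinAt)
    (by simp [hu, hc, hY0, hd])
    (fun s hs => ((fderiv ℂ F (α s)).le_opNorm _).trans (by
      gcongr
      exact hK s ⟨hs.1, hs.2.le⟩)) t ⟨ht.1, le_rfl⟩
  exact sub_eq_zero.1 h0

end Transport

/-! ### Local flows on the manifold -/

section Flows

variable {E : Type*} [NormedAddCommGroup E] [NormedSpace ℂ E]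
  {M : Type*} [TopologicalSpace M] [ChartedSpace E M] [IsManifold 𝓘(ℂ, E) ω M]
  {W : (x : M) → TangentSpace 𝓘(ℂ, E) x}

theorem contMDiff_reVec [CompleteSpace E]
    (hW : ContMDiff 𝓘(ℂ, E) 𝓘(ℂ, E).tangent ω (fun x => (⟨x, W x⟩ : TangentBundle 𝓘(ℂ, E) M)))
    [IsManifold 𝓘(ℝ, E) 1 M] :
    ContMDiff 𝓘(ℝ, E) 𝓘(ℝ, E).tangent 1
      (fun x => (⟨x, reVec (W x)⟩ : TangentBundle 𝓘(ℝ, E) M)) := by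
  intro x
  rw [Bundle.contMDiffAt_section]
  have he := chart_mem_atlas E x
  have hx : x ∈ (chartAt E x).source := mem_chart_source E x
  have h0 : ContDiffAt ℝ 1 (reading W (chartAt E x)) (chartAt E x x) :=
    (((contDiffOn_reading hW he).contDiffAt ((chartAt E x).open_target.mem_nhds
      (mem_chart_target E x))).restrict_scalars ℝ).of_le le_top
  have h1 : ContMDiffAt 𝓘(ℝ, E) 𝓘(ℝ, E) 1 (reading W (chartAt E x) ∘ chartAt E x) x :=
    ContMDiffAt.comp x h0.contMDiffAt ((contMDiffAt_real (contMDiffAt_chart he hx)).of_le le_top)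
  refine h1.congr_of_eventuallyEq ?_
  filter_upwards [(chartAt E x).open_source.mem_nhds hx] with z hz
  have h2 := DFunLike.congr_fun (TangentBundle.continuousLinearMapAt_trivializationAt
    (I := 𝓘(ℝ, E)) hz) (reVec (W z))
  have h3 : reading W (chartAt E x) (chartAt E x z) = (tangentMapAt ℝ (chartAt E x)
    ((chartAt E x).symm (chartAt E x z)) : E →L[ℝ] E) (vec W ((chartAt E x).symm (chartAt E x z)))
    := rfl
  rw [(chartAt E x).left_inv hz] at h3
  rw [Function.comp, h3]
  rw [Bundle.Trivialization.continuousLinearMapAt_apply,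
    Bundle.Trivialization.linearMapAt_apply, if_pos (by exact hz)] at h2
  exact h2

theorem hasTangentMapAt_chart_symm_curve {e : OpenPartialHomeomorph M E} (he : e ∈ atlas E M)
    {c : ℝ → E} {t : ℝ} (ht : c t ∈ e.target) (hc : HasDerivAt c (reading W e (c t)) t) :
    HasTangentMapAt ℝ (e.symm ∘ c) ((1 : ℝ →L[ℝ] ℝ).smulRight (vec W (e.symm (c t)))) t := by
  have h1 : HasTangentMapAt ℝ c _ t := hasTangentMapAt_iff_hasFDerivAt.2 hc.hasFDerivAt
  have h2 := HasTangentMapAt.comp (hasTangentMapAt_chart_symm he ht).real h1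
  convert! h2 using 1
  ext
  simp [chartFrame_reading W he ht]

/-- This is the local flow in a chart, with one time interval for all initial points in `N`. The
derivative of the flow is computed on the span of the invariant family `κ`, where it acts through
the exponential of `-A`. -/
theorem exists_local_flow [CompleteSpace E]
    (hW : ContMDiff 𝓘(ℂ, E) 𝓘(ℂ, E).tangent ω (fun x => (⟨x, W x⟩ : TangentBundle 𝓘(ℂ, E) M)))
    {ι : Type*} [Fintype ι] {κ : ι → (x : M) → TangentSpace 𝓘(ℂ, E) x}
    (hκ : ∀ i, ContMDiff 𝓘(ℂ, E) 𝓘(ℂ, E).tangent ω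
      (fun x => (⟨x, κ i x⟩ : TangentBundle 𝓘(ℂ, E) M)))
    {A : (ι → ℂ) →L[ℂ] (ι → ℂ)}
    (hA : ∀ v x, ∑ i, v i • vec (bracket W (κ i)) x = ∑ i, A v i • vec (κ i) x)
    (n : ℕ) (x₀ : M) :
    ∃ N : Set M, IsOpen N ∧ x₀ ∈ N ∧ ∃ ε > 0, ∃ G : M → ℝ → M, ∀ z ∈ N, G z 0 = z ∧
      (∀ t ∈ Ioo (-ε) ε, HasTangentMapAt ℝ (G z)
        ((1 : ℝ →L[ℝ] ℝ).smulRight (vec W (G z t))) t) ∧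
      ∀ t ∈ Ico 0 ε, ContMDiffAt 𝓘(ℂ, E) 𝓘(ℂ, E) (n + 1 : ℕ) (fun z => G z t) z ∧
        ∃ T : E →L[ℂ] E, HasTangentMapAt ℂ (fun z => G z t) T z ∧
          ∀ v : ι → ℂ, T (∑ i, v i • vec (κ i) z) =
            ∑ i, NormedSpace.exp (t • -A) v i • vec (κ i) (G z t) := by
  set e := chartAt E x₀
  have he : e ∈ atlas E M := chart_mem_atlas E x₀
  have hx₀ : x₀ ∈ e.source := mem_chart_source E x₀
  have hF : ContDiffOn ℂ ∞ (reading W e) e.target := (contDiffOn_reading hW he).of_le le_top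
  obtain ⟨r, ε, γ, Y, h⟩ := exists_isSmoothLocalFlow e.open_target hF (e.map_source hx₀) n
  refine ⟨e.source ∩ e ⁻¹' Metric.ball (e x₀) r, e.isOpen_inter_preimage Metric.isOpen_ball,
    ⟨hx₀, Metric.mem_ball_self h.r_pos⟩, ε, h.ε_pos, fun z t => e.symm (γ (e z) t), ?_⟩
  rintro z ⟨hz, hzr⟩
  refine ⟨(congrArg e.symm (h.zero _ hzr)).trans (e.left_inv hz), fun t ht => ?_, fun t ht => ?_⟩
  · exact hasTangentMapAt_chart_symm_curve he (h.mem _ hzr t ht) (h.deriv _ hzr t ht)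
  have ht' : t ∈ Ioo (-ε) ε := ⟨by linarith [h.ε_pos, ht.1], ht.2⟩
  have hmem := h.mem _ hzr t ht'
  have h1 : ContMDiffAt 𝓘(ℂ, E) 𝓘(ℂ, E) (n + 1 : ℕ) (fun y => γ y t) (e z) :=
    ((h.contDiffOn t ht).contDiffAt (Metric.isOpen_ball.mem_nhds hzr)).contMDiffAt
  have h2 : ContMDiffAt 𝓘(ℂ, E) 𝓘(ℂ, E) (n + 1 : ℕ) e z := (contMDiffAt_chart he hz).of_le le_top
  have h3 : ContMDiffAt 𝓘(ℂ, E) 𝓘(ℂ, E) (n + 1 : ℕ) e.symm (γ (e z) t) :=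
    (contMDiffAt_chart_symm he hmem).of_le le_top
  refine ⟨ContMDiffAt.comp z (g := e.symm) (f := fun z => γ (e z) t) h3
    (ContMDiffAt.comp z (g := fun y => γ y t) (f := e) h1 h2), ?_⟩
  have k1 := hasTangentMapAt_chart he (e.map_source hz)
  rw [e.left_inv hz] at k1
  have k2 : HasTangentMapAt ℂ (fun y => γ y t) (Y (e z) t) (e z) :=
    hasTangentMapAt_iff_hasFDerivAt.2 (h.hasFDerivAt _ hzr t ht)
  have k3 := hasTangentMapAt_chart_symm he hmem
  refine ⟨_, HasTangentMapAt.comp (f := fun z => γ (e z) t) k3 (HasTangentMapAt.comp k2 k1),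
    fun v => ?_⟩
  have hr : ∀ (B : (x : M) → TangentSpace 𝓘(ℂ, E) x) y, y ∈ e.target →
      chartCoframe e y (vec B (e.symm y)) = reading B e y := fun B y hy => (reading_eq B he hy).symm
  have hlin := linear_flow_eq (ρ := fun i => reading (κ i) e) (A := A) e.open_target hF
    (fun i => ((contDiffOn_reading (hκ i) he).differentiableOn (by simp)))
    (fun y hy v => ?_) (h.deriv _ hzr) (h.mem _ hzr) (h.linear_deriv _ hzr)
    (h.linear_zero _ hzr) v ht
  · have k4 : chartCoframe e (e z) (∑ i, v i • vec (κ i) z) =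
        ∑ i, v i • reading (κ i) e (γ (e z) 0) := by
      rw [map_sum, h.zero _ hzr]
      refine Finset.sum_congr rfl fun i _ => ?_
      rw [map_smul, ← hr _ _ (e.map_source hz), e.left_inv hz]
    rw [ContinuousLinearMap.comp_apply, ContinuousLinearMap.comp_apply, k4, hlin, map_sum]
    refine Finset.sum_congr rfl fun i _ => ?_
    rw [map_smul, chartFrame_reading (κ i) he hmem]
  · have k5 := congrArg (chartCoframe e y) (hA v (e.symm y))
    rw [map_sum, map_sum] at k5
    simp only [map_smul, hr _ _ hy, reading_bracket hW (hκ _) he hy] at k5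
    rw [← k5, map_sum, ← Finset.sum_sub_distrib]
    refine Finset.sum_congr rfl fun i _ => ?_
    rw [map_smul, smul_sub]

end Flows

/-! ### Global flows on a compact manifold -/

section GlobalFlow

variable {E : Type*} [NormedAddCommGroup E] [NormedSpace ℂ E]
  {M : Type*} [TopologicalSpace M] [ChartedSpace E M] [IsManifold 𝓘(ℂ, E) ω M]
  {W : (x : M) → TangentSpace 𝓘(ℂ, E) x}

theorem exp_add_smul {V : Type*} [NormedAddCommGroup V] [NormedSpace ℂ V] [CompleteSpace V]
    (A : V →L[ℂ] V) (s t : ℝ) :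
    NormedSpace.exp ((s + t) • A) = NormedSpace.exp (s • A) * NormedSpace.exp (t • A) := by
  have : NormedAlgebra ℚ (V →L[ℂ] V) := NormedAlgebra.restrictScalars ℚ ℂ _
  have h : Commute (s • A) (t • A) := by
    ext v
    simp [smul_smul, mul_comm]
  rw [← NormedSpace.exp_add_of_commute h, add_smul]

theorem exists_forall_of_compactSpace {X : Type*} [TopologicalSpace X] [CompactSpace X]
    {P : X → ℝ → Prop} (hP : ∀ z a b, a ≤ b → P z b → P z a)
    (h : ∀ x, ∃ N : Set X, IsOpen N ∧ x ∈ N ∧ ∃ ε > 0, ∀ z ∈ N, P z ε) :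
    ∃ ε > 0, ∀ z, P z ε := by
  have := isCompact_univ.induction_on (p := fun s : Set X => ∃ ε > 0, ∀ z ∈ s, P z ε)
    ⟨1, one_pos, by simp⟩ (fun s t hst ⟨ε, h0, h1⟩ => ⟨ε, h0, fun z hz => h1 z (hst hz)⟩)
    (fun s t ⟨ε, h0, h1⟩ ⟨δ, h2, h3⟩ => ⟨min ε δ, lt_min h0 h2, fun z hz => hz.elim
      (fun hz => hP _ _ _ (min_le_left _ _) (h1 z hz))
      (fun hz => hP _ _ _ (min_le_right _ _) (h3 z hz))⟩)
    (fun x _ => by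
      obtain ⟨N, h0, h1, ε, h2, h3⟩ := h x
      exact ⟨N, mem_nhdsWithin_of_mem_nhds (h0.mem_nhds h1), ε, h2, h3⟩)
  obtain ⟨ε, h0, h1⟩ := this
  exact ⟨ε, h0, fun z => h1 z (mem_univ z)⟩

/-- `Φ` is the flow of the complete real vector field `Re W`. -/
structure IsFlow (W : (x : M) → TangentSpace 𝓘(ℂ, E) x) (Φ : ℝ → M → M) : Prop where
  zero : ∀ z, Φ 0 z = z
  curve : ∀ z, IsMIntegralCurve (I := 𝓘(ℝ, E)) (fun t => Φ t z) (fun x => reVec (W x))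

variable [CompleteSpace E] [T2Space M]

theorem integralCurve_unique
    (hW : ContMDiff 𝓘(ℂ, E) 𝓘(ℂ, E).tangent ω (fun x => (⟨x, W x⟩ : TangentBundle 𝓘(ℂ, E) M)))
    {γ γ' : ℝ → M} (hγ : IsMIntegralCurve (I := 𝓘(ℝ, E)) γ (fun x => reVec (W x)))
    (hγ' : IsMIntegralCurve (I := 𝓘(ℝ, E)) γ' (fun x => reVec (W x))) (h : γ 0 = γ' 0) : γ = γ' := by
  have : IsManifold 𝓘(ℂ, E) 1 M := IsManifold.of_le (n := ω) le_top
  have : IsManifold 𝓘(ℝ, E) 1 M := isManifold_real 1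
  exact isMIntegralCurve_Ioo_eq_of_contMDiff_boundaryless (t₀ := 0) (contMDiff_reVec hW) hγ hγ' h

theorem timeOneFlow_eq
    (hW : ContMDiff 𝓘(ℂ, E) 𝓘(ℂ, E).tangent ω (fun x => (⟨x, W x⟩ : TangentBundle 𝓘(ℂ, E) M)))
    {γ : ℝ → M} (hγ : IsMIntegralCurve (I := 𝓘(ℝ, E)) γ (fun x => reVec (W x))) :
    timeOneFlow (fun x => reVec (W x)) (γ 0) = γ 1 := by
  have h : ∃ γ' : ℝ → M, γ' 0 = γ 0 ∧
    IsMIntegralCurve (I := 𝓘(ℝ, E)) γ' (fun x => reVec (W x)) := ⟨γ, rfl, hγ⟩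
  rw [timeOneFlow, dif_pos h]
  rw [integralCurve_unique hW h.choose_spec.2 hγ h.choose_spec.1]

theorem IsFlow.add
    (hW : ContMDiff 𝓘(ℂ, E) 𝓘(ℂ, E).tangent ω (fun x => (⟨x, W x⟩ : TangentBundle 𝓘(ℂ, E) M)))
    {Φ : ℝ → M → M} (h : IsFlow W Φ) (s t : ℝ) : Φ (s + t) = Φ s ∘ Φ t := by
  funext z
  exact congrFun (integralCurve_unique hW ((h.curve z).comp_add t) (h.curve (Φ t z))
    (by simp [h.zero])) s

/-- Uniqueness of integral curves lets the local flows compute the global one for short times, from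
which its regularity is inherited. -/
theorem IsFlow.eqOn
    (hW : ContMDiff 𝓘(ℂ, E) 𝓘(ℂ, E).tangent ω (fun x => (⟨x, W x⟩ : TangentBundle 𝓘(ℂ, E) M)))
    {Φ : ℝ → M → M} (h : IsFlow W Φ) {γ : ℝ → M} {ε : ℝ} (hε : 0 < ε)
    (hγ : ∀ t ∈ Ioo (-ε) ε, HasTangentMapAt ℝ γ ((1 : ℝ →L[ℝ] ℝ).smulRight (vec W (γ t))) t) :
    EqOn γ (fun t => Φ t (γ 0)) (Ioo (-ε) ε) := by
  have : IsManifold 𝓘(ℂ, E) 1 M := IsManifold.of_le (n := ω) le_top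
  have : IsManifold 𝓘(ℝ, E) 1 M := isManifold_real 1
  exact isMIntegralCurveOn_Ioo_eqOn_of_contMDiff_boundaryless (t₀ := 0) (by simp [hε])
    (contMDiff_reVec hW) (fun t ht => HasMFDerivAt.hasMFDerivWithinAt (hγ t ht))
    ((h.curve _).isMIntegralCurveOn _) (h.zero _).symm

variable [CompactSpace M]

theorem exists_isFlow
    (hW : ContMDiff 𝓘(ℂ, E) 𝓘(ℂ, E).tangent ω (fun x => (⟨x, W x⟩ : TangentBundle 𝓘(ℂ, E) M))) :
    ∃ Φ, IsFlow W Φ := by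
  have : IsManifold 𝓘(ℂ, E) 1 M := IsManifold.of_le (n := ω) le_top
  have : IsManifold 𝓘(ℝ, E) 1 M := isManifold_real 1
  obtain ⟨ε, hε, h⟩ := exists_forall_of_compactSpace (X := M)
    (P := fun z ε => ∃ γ : ℝ → M, γ 0 = z ∧
      IsMIntegralCurveOn (I := 𝓘(ℝ, E)) γ (fun x => reVec (W x)) (Ioo (-ε) ε))
    (fun z a b hab ⟨γ, h0, h1⟩ => ⟨γ, h0, h1.mono (Ioo_subset_Ioo (neg_le_neg hab) hab)⟩)
    (fun x => by
      -- Only the existence time is needed here, so the invariant family is empty.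
      obtain ⟨N, h0, h1, ε, h2, G, h3⟩ := exists_local_flow (ι := Fin 0) (A := 0) hW
        (κ := fun i => i.elim0) (fun i => i.elim0) (by simp) 0 x
      exact ⟨N, h0, h1, ε, h2, fun z hz => ⟨G z, (h3 z hz).1,
        fun t ht => HasMFDerivAt.hasMFDerivWithinAt ((h3 z hz).2.1 t ht)⟩⟩)
  choose γ h0 h1 using exists_isMIntegralCurve_of_isMIntegralCurveOn (contMDiff_reVec hW) hε h
  exact ⟨fun t z => γ z t, h0, h1⟩

/-- The assertion holds for short times, uniformly by compactness, and is stable under adding times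
because flows and exponentials both turn sums into compositions. -/
theorem IsFlow.transport
    (hW : ContMDiff 𝓘(ℂ, E) 𝓘(ℂ, E).tangent ω (fun x => (⟨x, W x⟩ : TangentBundle 𝓘(ℂ, E) M)))
    {ι : Type*} [Fintype ι] {κ : ι → (x : M) → TangentSpace 𝓘(ℂ, E) x}
    (hκ : ∀ i, ContMDiff 𝓘(ℂ, E) 𝓘(ℂ, E).tangent ω
      (fun x => (⟨x, κ i x⟩ : TangentBundle 𝓘(ℂ, E) M)))
    {A : (ι → ℂ) →L[ℂ] (ι → ℂ)}
    (hA : ∀ v x, ∑ i, v i • vec (bracket W (κ i)) x = ∑ i, A v i • vec (κ i) x)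
    {Φ : ℝ → M → M} (hΦ : IsFlow W Φ) (n : ℕ) (z : M) :
    ContMDiffAt 𝓘(ℂ, E) 𝓘(ℂ, E) (n + 1 : ℕ) (Φ 1) z ∧
      ∃ T : E →L[ℂ] E, HasTangentMapAt ℂ (Φ 1) T z ∧ ∀ v : ι → ℂ,
        T (∑ i, v i • vec (κ i) z) = ∑ i, NormedSpace.exp (-A) v i • vec (κ i) (Φ 1 z) := by
  set Q : ℝ → M → Prop := fun t z => ContMDiffAt 𝓘(ℂ, E) 𝓘(ℂ, E) (n + 1 : ℕ) (Φ t) z ∧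
      ∃ T : E →L[ℂ] E, HasTangentMapAt ℂ (Φ t) T z ∧ ∀ v : ι → ℂ,
        T (∑ i, v i • vec (κ i) z) = ∑ i, NormedSpace.exp (t • -A) v i • vec (κ i) (Φ t z) with hQ
  obtain ⟨ε, hε, h⟩ := exists_forall_of_compactSpace (X := M)
    (P := fun z ε => ∀ t ∈ Ico 0 ε, Q t z)
    (fun z a b hab h t ht => h t ⟨ht.1, ht.2.trans_le hab⟩)
    (fun x => by
      obtain ⟨N, h0, h1, ε, h2, G, h3⟩ := exists_local_flow hW hκ hA n x
      refine ⟨N, h0, h1, ε, h2, fun z hz t ht => ?_⟩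
      have ht' : t ∈ Ioo (-ε) ε := ⟨by linarith [ht.1], ht.2⟩
      have h4 : ∀ y ∈ N, Φ t y = G y t := fun y hy => by
        have := hΦ.eqOn hW h2 (h3 y hy).2.1 ht'
        rw [this]
        simp only [(h3 y hy).1]
      have h5 : Φ t =ᶠ[𝓝 z] fun y => G y t := by
        filter_upwards [h0.mem_nhds hz] with y hy using h4 y hy
      obtain ⟨h6, T, h7, h8⟩ := (h3 z hz).2.2 t ht
      refine ⟨h6.congr_of_eventuallyEq h5, T, h7.congr_of_eventuallyEq h5, fun v => ?_⟩
      rw [h8, h4 z hz])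
  have hadd : ∀ s t, (∀ z, Q s z) → (∀ z, Q t z) → ∀ z, Q (s + t) z := by
    intro s t hs ht z
    obtain ⟨h1, T, h2, h3⟩ := hs (Φ t z)
    obtain ⟨h4, S, h5, h6⟩ := ht z
    rw [hQ]
    simp only [hΦ.add hW s t]
    refine ⟨h1.comp z h4, T.comp S, h2.comp h5, fun v => ?_⟩
    have hexp : NormedSpace.exp ((s + t) • -A) =
        NormedSpace.exp (s • -A) * NormedSpace.exp (t • -A) := exp_add_smul (-A) s t
    rw [ContinuousLinearMap.comp_apply, h6, h3, hexp]
    rfl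
  have h0 : ∀ z, Q 0 z := fun z => h z 0 ⟨le_rfl, hε⟩
  -- Time one is reached in `k + 1` steps of length `1 / (k + 1)`, each short enough.
  obtain ⟨k, hk⟩ := exists_nat_one_div_lt hε
  have hk0 : (0 : ℝ) < 1 / ((k : ℝ) + 1) := by positivity
  have hj : ∀ j : ℕ, ∀ z, Q (j * (1 / ((k : ℝ) + 1))) z := by
    intro j
    induction j with
    | zero => simpa using h0
    | succ j ih =>
      rw [Nat.cast_succ, add_one_mul]
      exact hadd _ _ ih fun z => h z _ ⟨hk0.le, hk⟩
  have h1 := hj (k + 1) z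
  rw [Nat.cast_succ, mul_one_div_cancel (by positivity), hQ] at h1
  simpa only [one_smul] using h1

/-- The time-one flow of a holomorphic field is a biholomorphic map, which acts on an invariant
family of fields by the exponential of the bracket. -/
theorem exists_homeomorph_timeOneFlow
    (hW : ContMDiff 𝓘(ℂ, E) 𝓘(ℂ, E).tangent ω (fun x => (⟨x, W x⟩ : TangentBundle 𝓘(ℂ, E) M)))
    {ι : Type*} [Fintype ι] {κ : ι → (x : M) → TangentSpace 𝓘(ℂ, E) x}
    (hκ : ∀ i, ContMDiff 𝓘(ℂ, E) 𝓘(ℂ, E).tangent ω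
      (fun x => (⟨x, κ i x⟩ : TangentBundle 𝓘(ℂ, E) M)))
    {A : (ι → ℂ) →L[ℂ] (ι → ℂ)}
    (hA : ∀ v x, ∑ i, v i • vec (bracket W (κ i)) x = ∑ i, A v i • vec (κ i) x) :
    ∃ φ : M ≃ₜ M, ⇑φ = timeOneFlow (fun x => reVec (W x)) ∧
      ContMDiff 𝓘(ℂ, E) 𝓘(ℂ, E) ∞ φ ∧ ∀ z, ∃ T : E →L[ℂ] E, HasTangentMapAt ℂ φ T z ∧
        ∀ v : ι → ℂ, T (∑ i, v i • vec (κ i) z) =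
          ∑ i, NormedSpace.exp (-A) v i • vec (κ i) (φ z) := by
  obtain ⟨Φ, hΦ⟩ := exists_isFlow hW
  have h1 : Φ 1 = timeOneFlow (fun x => reVec (W x)) := by
    funext z
    rw [← timeOneFlow_eq hW (hΦ.curve z), hΦ.zero]
  have hinv : ∀ t z, Φ (-t) (Φ t z) = z := fun t z => by
    have := congrFun (hΦ.add hW (-t) t) z
    rw [neg_add_cancel, hΦ.zero] at this
    exact this.symm
  have hs : ContMDiff 𝓘(ℂ, E) 𝓘(ℂ, E) ∞ (Φ 1) := contMDiff_infty.2 fun n z =>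
    (hΦ.transport hW hκ hA n z).1.of_le (by exact_mod_cast n.le_succ)
  refine ⟨hs.continuous.homeoOfEquivCompactToT2 (f := ⟨Φ 1, Φ (-1), hinv 1, fun z => by
    simpa using hinv (-1) z⟩), h1, hs, fun z => ?_⟩
  exact (hΦ.transport hW hκ hA 0 z).2

end GlobalFlow

/-! ### Pull-back of potentials and moment maps by biholomorphisms -/

section Pullback

variable {E : Type*} [NormedAddCommGroup E] [NormedSpace ℂ E] [FiniteDimensional ℂ E]
  {M : Type*} [TopologicalSpace M] [ChartedSpace E M] [IsManifold 𝓘(ℂ, E) ω M]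
  {Ω : TwoTensor E M}

/-- The bracket on the space of Hamiltonian holomorphic fields. -/
def hamBracket (hΩ : IsKahlerForm Ω) :
    hamFields Ω →ₗ[ℂ] hamFields Ω →ₗ[ℂ] hamFields Ω :=
  LinearMap.mk₂ ℂ (fun Ξ Ξ' => ⟨bracket Ξ.1 Ξ'.1, bracket_mem_hamFields hΩ Ξ.2 Ξ'.2⟩)
    (fun Ξ₁ Ξ₂ Ξ => Subtype.ext <| funext fun x => VectorField.mlieBracket_add_left
      (Ξ₁.2.1.mdifferentiable (by simp) x) (Ξ₂.2.1.mdifferentiable (by simp) x))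
    (fun c Ξ₁ Ξ => Subtype.ext <| funext fun x => VectorField.mlieBracket_const_smul_left
      (Ξ₁.2.1.mdifferentiable (by simp) x))
    (fun Ξ Ξ₁ Ξ₂ => Subtype.ext <| funext fun x => VectorField.mlieBracket_add_right
      (Ξ₁.2.1.mdifferentiable (by simp) x) (Ξ₂.2.1.mdifferentiable (by simp) x))
    (fun c Ξ Ξ₁ => Subtype.ext <| funext fun x => VectorField.mlieBracket_const_smul_right
      (Ξ₁.2.1.mdifferentiable (by simp) x))

theorem metric_pullback {φ : M → M} {T : M → E →L[ℂ] E} (hT : ∀ x, HasTangentMapAt ℂ φ (T x) x) :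
    metric (pullback φ Ω) = pullback φ (metric Ω) := by
  funext x
  have h1 : (tangentMapAt ℝ φ x : E →L[ℝ] E) = (T x).restrictScalars ℝ := (hT x).real.eq
  have key : ∀ u v : E, form (metric (pullback φ Ω)) x u v =
      form (pullback φ (metric Ω)) x u v := fun u v => by
    rw [form_metric, form_pullback, form_pullback, form_metric, h1]
    simp
  exact LinearMap.ext fun u => LinearMap.ext fun v => key u v

/-- The tangent map of `φ` commutes with `i`, so composing with `φ` transforms the whole equation.
-/
theorem IsPotential.pullback {φ : M → M} (hφ : ContMDiff 𝓘(ℂ, E) 𝓘(ℂ, E) ∞ φ)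
    {T : M → E →L[ℂ] E} (hT : ∀ x, HasTangentMapAt ℂ φ (T x) x)
    {Ξ Ξ' : (x : M) → TangentSpace 𝓘(ℂ, E) x} (h : ∀ x, T x (vec Ξ x) = vec Ξ' (φ x)) {ζ : M → ℂ}
    (hζ : IsPotential Ω Ξ' ζ) : IsPotential (pullback φ Ω) Ξ (ζ ∘ φ) := by
  obtain ⟨h1, h2⟩ := isPotential_iff.1 hζ
  refine isPotential_iff.2 ⟨h1.comp fun x => contMDiffAt_real (hφ x), fun x v => ?_⟩
  have h3 : (tangentMapAt ℝ φ x : E →L[ℝ] E) = (T x).restrictScalars ℝ := (hT x).real.eq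
  have h4 : (tangentMapAt ℝ (ζ ∘ φ) x : E →L[ℝ] ℂ) =
      (tangentMapAt ℝ ζ (φ x) : E →L[ℝ] ℂ).comp ((T x).restrictScalars ℝ) :=
    HasTangentMapAt.eq (HasTangentMapAt.comp
      (MDifferentiableAt.hasTangentMapAt (h1.mdifferentiable (by simp) (φ x))) (hT x).real)
  have h5 := h2 (φ x) (T x v)
  rw [form_pullback, form_pullback, h3, h4]
  simp only [ContinuousLinearMap.comp_apply, ContinuousLinearMap.coe_restrictScalars', map_smul,
    h x]
  exact h5

variable [MeasurableSpace E] [BorelSpace E] [CompactSpace M] [T2Space M]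
  [MeasurableSpace M] [BorelSpace M] [ConnectedSpace M]

/-- Naturality: if `φ` moves `Ξ` to `B Ξ`, the potential of `B Ξ` composed with `φ` is a potential
of `Ξ` for the pulled back form. It has mean value zero because `φ` transports the volume, and
uniqueness of the moment map concludes. -/
theorem momentMap_pullback (hΩ : IsKahlerForm Ω) (φ : M ≃ₜ M)
    (hφ : ContMDiff 𝓘(ℂ, E) 𝓘(ℂ, E) ∞ φ) {T : M → E →L[ℂ] E}
    (hT : ∀ x, HasTangentMapAt ℂ φ (T x) x) {B : hamFields Ω →ₗ[ℂ] hamFields Ω}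
    (hB : ∀ x (Ξ : hamFields Ω), T x (vec Ξ.1 x) = vec (B Ξ).1 (φ x)) (x : M) :
    momentMap (hamFields Ω) (pullback φ Ω) x = momentMap (hamFields Ω) Ω (φ x) ∘ₗ B := by
  have hv : Measure.map φ (volumeOf (metric (pullback φ Ω))) = volumeOf (metric Ω) := by
    rw [metric_pullback hT]
    exact map_volumeOf_pullback φ (fun x => (hT x).real) _
  have huniv : volumeOf (metric (pullback φ Ω)) univ = volumeOf (metric Ω) univ := by
    rw [← hv, Measure.map_apply φ.measurable MeasurableSet.univ, preimage_univ]
  have hf := isFiniteMeasure_volumeOf hΩ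
  have : IsFiniteMeasure (volumeOf (metric (pullback φ Ω))) :=
    ⟨huniv ▸ hf.measure_univ_lt_top⟩
  have h := isMomentMap_momentMap hΩ
  have h1 : IsMomentMap (hamFields Ω) (pullback φ Ω)
      (fun x => momentMap (hamFields Ω) Ω (φ x) ∘ₗ B) := fun Ξ => by
    refine ⟨IsPotential.pullback hφ hT (fun x => hB x Ξ) (h (B Ξ)).1, ?_⟩
    rw [← (h (B Ξ)).2, ← hv, φ.measurableEmbedding.integral_map]
    rfl
  exact congrFun (IsMomentMap.unique (huniv ▸ volumeOf_univ_ne_zero hΩ)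
    (Classical.epsilon_spec ⟨_, h1⟩) h1) x

end Pullback

/-! ### Dependence of the time-one flow on the field -/

section Parameters

variable {E : Type*} [NormedAddCommGroup E] [NormedSpace ℂ E]
  {M : Type*} [TopologicalSpace M] [ChartedSpace E M] [IsManifold 𝓘(ℂ, E) ω M]
  {ι : Type*} [Fintype ι] [DecidableEq ι]
  {K : (ι → ℂ) →ₗ[ℂ] ((x : M) → TangentSpace 𝓘(ℂ, E) x)}

/-- The value at `x` of a linear family of fields. -/
def familyEval (K : (ι → ℂ) →ₗ[ℂ] ((x : M) → TangentSpace 𝓘(ℂ, E) x)) (x : M) :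
    (ι → ℂ) →L[ℂ] E :=
  LinearMap.toContinuousLinearMap
    { toFun := fun v => vec (K v) x
      map_add' := fun v w => by
        rw [map_add]
        rfl
      map_smul' := fun c v => by
        rw [map_smul]
        rfl }

theorem familyEval_apply (x : M) (v : ι → ℂ) : familyEval K x v = vec (K v) x := rfl

theorem vec_family (x : M) (v : ι → ℂ) :
    vec (K v) x = ∑ i, v i • vec (K (fun j => if i = j then 1 else 0)) x :=
  (familyEval K x).toLinearMap.pi_apply_eq_sum_univ v

theorem reading_family {e : OpenPartialHomeomorph M E} (he : e ∈ atlas E M) {y : E}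
    (hy : y ∈ e.target) (v : ι → ℂ) :
    reading (K v) e y = ∑ i, v i • reading (K (fun j => if i = j then 1 else 0)) e y := by
  rw [reading_eq _ he hy, vec_family, map_sum]
  refine Finset.sum_congr rfl fun i _ => ?_
  rw [map_smul, reading_eq _ he hy]

theorem reVec_real_smul (s : ℝ) (v : ι → ℂ) :
    (fun x => reVec (K (s • v) x)) = s • fun x => reVec (K v x) := by
  funext x
  have h : vec (K (s • v)) x = s • vec (K v) x := by
    rw [← familyEval_apply, ← familyEval_apply]
    exact ((familyEval K x).restrictScalars ℝ).map_smul s v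
  exact h

variable [CompleteSpace E] [T2Space M] [CompactSpace M]

/-- Scaling the field by `s` reparametrises its integral curves, so short-time flows are time-one
flows of small fields. -/
theorem timeOneFlow_smul
    (hK : ∀ v, ContMDiff 𝓘(ℂ, E) 𝓘(ℂ, E).tangent ω
      (fun x => (⟨x, K v x⟩ : TangentBundle 𝓘(ℂ, E) M)))
    {v : ι → ℂ} {Φ : ℝ → M → M} (hΦ : IsFlow (K v) Φ) (s : ℝ) (x : M) :
    timeOneFlow (fun x => reVec (K (s • v) x)) x = Φ s x := by
  have h1 := (hΦ.curve x).comp_mul s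
  rw [← reVec_real_smul] at h1
  have h2 := timeOneFlow_eq (hK (s • v)) h1
  simpa [hΦ.zero] using h2

/-- The time-one flow of a linear family of fields is differentiable in the parameter at zero. -/
theorem hasTangentMapAt_timeOneFlow
    (hK : ∀ v, ContMDiff 𝓘(ℂ, E) 𝓘(ℂ, E).tangent ω
      (fun x => (⟨x, K v x⟩ : TangentBundle 𝓘(ℂ, E) M))) (x : M) :
    HasTangentMapAt ℝ (fun v => timeOneFlow (fun x => reVec (K v x)) x)
      ((familyEval K x).restrictScalars ℝ) 0 := by
  choose Φ hΦ using fun v => exists_isFlow (hK v)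
  obtain ⟨T, hT⟩ : ∃ T : (ι → ℂ) →L[ℝ] E,
      HasTangentMapAt ℝ (fun v => timeOneFlow (fun x => reVec (K v x)) x) T 0 := by
    set e := chartAt E x
    have he : e ∈ atlas E M := chart_mem_atlas E x
    have hx : x ∈ e.source := mem_chart_source E x
    -- The parameters become coordinates that stay constant in time, so dependence on parameters is
    -- dependence on initial values.
    set F : E × (ι → ℂ) → E × (ι → ℂ) := fun z =>
      (∑ i, z.2 i • reading (K (fun j => if i = j then 1 else 0)) e z.1, 0) with hFdef
    have hU : IsOpen (e.target ×ˢ (univ : Set (ι → ℂ))) := e.open_target.prod isOpen_univ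
    have hF : ContDiffOn ℂ ∞ F (e.target ×ˢ univ) := by
      refine ContDiffOn.prodMk (ContDiffOn.sum fun i _ => ?_) contDiffOn_const
      refine ContDiffOn.smul ?_ ?_
      · exact (((ContinuousLinearMap.proj (R := ℂ) (φ := fun _ : ι => ℂ) i).comp
          (ContinuousLinearMap.snd ℂ E (ι → ℂ))).contDiff).contDiffOn
      · exact ((contDiffOn_reading (hK _) he).of_le le_top).comp contDiff_fst.contDiffOn
          fun z hz => hz.1
    obtain ⟨r, ε, γ, Y, h⟩ := exists_isSmoothLocalFlow hU hF
      (x₀ := (e x, 0)) ⟨e.map_source hx, mem_univ _⟩ 0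
    -- The local flow need not exist up to time one. The time-one flow of `w` is the time-`s` flow
    -- of `s⁻¹ • w`, and for small `w` this parameter lies in the ball of initial values.
    set s := ε / 2 with hs
    have hs0 : 0 < s := half_pos h.ε_pos
    have hsε : s ∈ Ioo (-ε) ε := ⟨by linarith, by linarith⟩
    have hball : ∀ v : ι → ℂ, ‖v‖ < r → ((e x, v) : E × (ι → ℂ)) ∈ Metric.ball (e x, 0) r :=
      fun v hv => by
        rw [Metric.mem_ball, Prod.dist_eq]
        simpa [h.r_pos] using hv
    have key : ∀ v : ι → ℂ, ‖v‖ < r → e.symm (γ (e x, v) s).1 = Φ v s x := by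
      intro v hv
      have hb := hball v hv
      have h2 : ∀ t ∈ Ioo (-ε) ε, (γ (e x, v) t).2 = v := by
        intro t ht
        have hd : ∀ t ∈ Ioo (-ε) ε, HasDerivAt (fun t => (γ (e x, v) t).2) 0 t := fun t ht =>
          (ContinuousLinearMap.snd ℝ E (ι → ℂ)).hasFDerivAt.comp_hasDerivAt t (h.deriv _ hb t ht)
        have := isOpen_Ioo.is_const_of_deriv_eq_zero isPreconnected_Ioo
          (fun t ht => (hd t ht).differentiableAt.differentiableWithinAt)
          (fun t ht => (hd t ht).deriv) ht (by simp [h.ε_pos] : (0 : ℝ) ∈ Ioo (-ε) ε)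
        rw [this, h.zero _ hb]
      have h3 : ∀ t ∈ Ioo (-ε) ε, HasDerivAt (fun t => (γ (e x, v) t).1)
          (reading (K v) e (γ (e x, v) t).1) t := fun t ht => by
        have h4 := (ContinuousLinearMap.fst ℝ E (ι → ℂ)).hasFDerivAt.comp_hasDerivAt t
          (h.deriv _ hb t ht)
        refine h4.congr_deriv ?_
        rw [reading_family he (h.mem _ hb t ht).1]
        simp only [hFdef, ContinuousLinearMap.coe_fst', h2 t ht]
      have h5 := (hΦ v).eqOn (hK v) (γ := e.symm ∘ fun t => (γ (e x, v) t).1) h.ε_pos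
        (fun t ht => hasTangentMapAt_chart_symm_curve he (h.mem _ hb t ht).1 (h3 t ht)) hsε
      have h6 : (e.symm ∘ fun t => (γ (e x, v) t).1) 0 = x := by
        rw [Function.comp, h.zero _ hb]
        exact e.left_inv hx
      rw [h6] at h5
      exact h5
    have hb0 := hball 0 (by simpa using h.r_pos)
    have hlin : HasFDerivAt (𝕜 := ℝ) (fun w : ι → ℂ => ((e x, s⁻¹ • w) : E × (ι → ℂ)))
        ((0 : (ι → ℂ) →L[ℝ] E).prod (s⁻¹ • ContinuousLinearMap.id ℝ (ι → ℂ))) 0 :=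
      (hasFDerivAt_const _ _).prodMk ((hasFDerivAt_id _).const_smul s⁻¹)
    have hγ : HasFDerivAt (𝕜 := ℝ) (fun z => γ z s) ((Y (e x, 0) s).restrictScalars ℝ)
        (e x, s⁻¹ • (0 : ι → ℂ)) := by
      rw [smul_zero]
      exact (h.hasFDerivAt _ hb0 s ⟨hs0.le, hsε.2⟩).restrictScalars ℝ
    have h7 := (ContinuousLinearMap.fst ℝ E (ι → ℂ)).hasFDerivAt.comp (0 : ι → ℂ)
      (hγ.comp (0 : ι → ℂ) hlin)
    have h8 : HasTangentMapAt ℝ (fun w : ι → ℂ => (γ (e x, s⁻¹ • w) s).1) _ 0 :=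
      hasTangentMapAt_iff_hasFDerivAt.2 h7
    have h9 : (γ (e x, s⁻¹ • (0 : ι → ℂ)) s).1 ∈ e.target := by
      rw [smul_zero]
      exact (h.mem _ hb0 s hsε).1
    have h10 := (hasTangentMapAt_chart_symm he h9).real
    refine ⟨_, (HasTangentMapAt.comp (f := fun w : ι → ℂ => (γ (e x, s⁻¹ • w) s).1) h10
      h8).congr_of_eventuallyEq ?_⟩
    have h11 : Tendsto (fun w : ι → ℂ => ‖s⁻¹ • w‖) (𝓝 0) (𝓝 0) := by
      have : Continuous (fun w : ι → ℂ => ‖s⁻¹ • w‖) := by fun_prop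
      simpa using this.tendsto 0
    filter_upwards [h11.eventually_lt_const h.r_pos] with w hw
    rw [Function.comp, key _ hw, ← timeOneFlow_smul hK (hΦ _), smul_inv_smul₀ hs0.ne']
  -- Once the derivative is known to exist, it is determined along the rays `t • δ`, where the map
  -- is the flow of `K δ` at time `t`, with velocity `K δ` at time zero.
  convert hT using 1
  refine ContinuousLinearMap.ext fun δ => ?_
  have h1 : HasTangentMapAt ℝ (fun t : ℝ => t • δ) ((1 : ℝ →L[ℝ] ℝ).smulRight δ) 0 :=
    hasTangentMapAt_iff_hasFDerivAt.2 ((1 : ℝ →L[ℝ] ℝ).smulRight δ).hasFDerivAt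
  have h2 := HasTangentMapAt.comp (x := (0 : ℝ)) (f := fun t : ℝ => t • δ) (by
    rw [zero_smul]
    exact hT) h1
  have h3 : ((fun v => timeOneFlow (fun x => reVec (K v x)) x) ∘ fun t : ℝ => t • δ) =
      fun t => Φ δ t x := by
    funext t
    exact timeOneFlow_smul hK (hΦ δ) t x
  rw [h3] at h2
  have h4 : HasTangentMapAt ℝ (fun t => Φ δ t x)
    ((1 : ℝ →L[ℝ] ℝ).smulRight (vec (K δ) (Φ δ 0 x))) 0 := (hΦ δ).curve x 0
  have h5 := DFunLike.congr_fun (h4.eq.symm.trans h2.eq) 1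
  rw [(hΦ δ).zero] at h5
  simpa [familyEval_apply] using h5

end Parameters

/-- The source `V` has only a topology and no norm, as for the space of fields with pointwise
convergence, so the little-o condition is transported in its topological form. -/
theorem hasFDerivAt_comp_continuousLinearMap {𝕜 V F G : Type*} [NontriviallyNormedField 𝕜]
    [AddCommGroup V] [Module 𝕜 V] [TopologicalSpace V] [NormedAddCommGroup F] [NormedSpace 𝕜 F]
    [NormedAddCommGroup G] [NormedSpace 𝕜 G] {f : F → G} {f' : F →L[𝕜] G} (S : V →L[𝕜] F) {x : V}
    (hf : HasFDerivAt f f' (S x)) : HasFDerivAt (fun z => f (S z)) (f'.comp S) x := by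
  have h1 := (hf.isLittleOTVS.comp_tendsto (S.continuous.tendsto x)).trans_isBigOTVS
    (k := fun z => z - x) (by
      have := S.isBigOTVS_comp (l := 𝓝 x) (f := fun z => z - x)
      refine this.congr_left fun z => ?_
      simp)
  refine HasFDerivAt.of_isLittleOTVS (h1.congr_left fun z => ?_)
  simp

/-! ### The differential of the moment map under pull-back by flows -/

section Differential

variable {E : Type*} [NormedAddCommGroup E] [NormedSpace ℂ E] [FiniteDimensional ℂ E]
  {M : Type*} [TopologicalSpace M] [ChartedSpace E M] [IsManifold 𝓘(ℂ, E) ω M]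
  {Ω : TwoTensor E M} {ι : Type*} [Fintype ι]

/-- The bracket in coordinates on the space of Hamiltonian holomorphic fields. -/
def coordBracket (hΩ : IsKahlerForm Ω) (κ : (ι → ℂ) ≃ₗ[ℂ] hamFields Ω) :
    (ι → ℂ) →L[ℂ] (ι → ℂ) →L[ℂ] (ι → ℂ) :=
  LinearMap.toContinuousLinearMap (LinearMap.toContinuousLinearMap.toLinearMap ∘ₗ
    ((hamBracket hΩ).compl₁₂ κ.toLinearMap κ.toLinearMap).compr₂ κ.symm.toLinearMap)

theorem coordBracket_apply (hΩ : IsKahlerForm Ω) (κ : (ι → ℂ) ≃ₗ[ℂ] hamFields Ω) (v w : ι → ℂ) :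
    κ (coordBracket hΩ κ v w) = hamBracket hΩ (κ v) (κ w) :=
  κ.apply_symm_apply _

theorem timeOneFlow_zero [T2Space M] [CompactSpace M] (x : M) :
    timeOneFlow (fun x => reVec ((0 : hamFields Ω).1 x)) x = x := by
  have : CompleteSpace E := FiniteDimensional.complete ℂ E
  obtain ⟨Φ, hΦ⟩ := exists_isFlow (0 : hamFields Ω).2.1
  have h := timeOneFlow_smul (K := (0 : (Fin 0 → ℂ) →ₗ[ℂ] ((x : M) → TangentSpace 𝓘(ℂ, E) x)))
    (fun v => (0 : hamFields Ω).2.1) (v := 0) hΦ 0 x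
  rw [hΦ.zero] at h
  exact h

variable [DecidableEq ι] [MeasurableSpace E] [BorelSpace E] [CompactSpace M] [T2Space M]
  [MeasurableSpace M] [BorelSpace M] [ConnectedSpace M]

/-- The variation of the Kähler form is traded for a motion of the point and the action of
`exp(-ad)` on the argument; both are differentiable in `w` at zero. -/
theorem momentMap_timeOneFlow (hΩ : IsKahlerForm Ω) (κ : (ι → ℂ) ≃ₗ[ℂ] hamFields Ω)
    (w v : ι → ℂ) (x : M) :
    momentMap (hamFields Ω) (pullback (timeOneFlow fun x => reVec ((κ w).1 x)) Ω) x (κ v) =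
      momentMap (hamFields Ω) Ω (timeOneFlow (fun x => reVec ((κ w).1 x)) x)
        (κ (NormedSpace.exp (-coordBracket hΩ κ w) v)) := by
  have : CompleteSpace E := FiniteDimensional.complete ℂ E
  set K := (hamFields Ω).subtype ∘ₗ κ.toLinearMap with hK
  have hKv : ∀ v, K v = (κ v).1 := fun v => rfl
  obtain ⟨φ, h1, h2, h3⟩ := exists_homeomorph_timeOneFlow (κ w).2.1
    (κ := fun i => K (fun j => if i = j then 1 else 0)) (fun i => (κ _).2.1)
    (A := coordBracket hΩ κ w) (fun v x => by
      rw [← vec_family, hKv, coordBracket_apply]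
      exact (vec_family (K := (hamFields Ω).subtype ∘ₗ hamBracket hΩ (κ w) ∘ₗ κ.toLinearMap)
        x v).symm)
  choose T hT hT' using h3
  have h4 := momentMap_pullback hΩ φ h2 hT
    (B := κ.toLinearMap ∘ₗ (NormedSpace.exp (-coordBracket hΩ κ w)).toLinearMap ∘ₗ
      κ.symm.toLinearMap) (fun x Ξ => by
      have h5 := hT' x (κ.symm Ξ)
      rw [← vec_family, ← vec_family, hKv, hKv, κ.apply_symm_apply] at h5
      exact h5) x
  rw [← h1, h4]
  simp

/-- The differential of a component of the moment map with respect to the pull-back of the form by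
the flow of the field `Ξ`. -/
def momentVariation (hΩ : IsKahlerForm Ω) (x : M) (Ξ Ξ' : hamFields Ω) : ℂ :=
  tangentMapAt ℝ (fun y => momentMap (hamFields Ω) Ω y Ξ') x (vec Ξ.1 x)
    - momentMap (hamFields Ω) Ω x (hamBracket hΩ Ξ Ξ')

/-- Product rule at `w = 0`: moving the point gives the derivative of the potential of `κ v` along
the field, and the exponential gives minus the potential of the bracket. -/
theorem exists_hasFDerivAt_momentMap (hΩ : IsKahlerForm Ω) (κ : (ι → ℂ) ≃ₗ[ℂ] hamFields Ω)
    (v : ι → ℂ) (x : M) : ∃ T : (ι → ℂ) →L[ℝ] ℂ,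
      HasFDerivAt (fun w => momentMap (hamFields Ω)
        (pullback (timeOneFlow fun x => reVec ((κ w).1 x)) Ω) x (κ v)) T 0 ∧
      ∀ w, T w = momentVariation hΩ x (κ w) (κ v) := by
  have : CompleteSpace E := FiniteDimensional.complete ℂ E
  set K := (hamFields Ω).subtype ∘ₗ κ.toLinearMap with hK
  set φ : (ι → ℂ) → M := fun w => timeOneFlow (fun x => reVec ((κ w).1 x)) x with hφ
  have hφ0 : φ 0 = x := by
    simp only [hφ, map_zero]
    exact timeOneFlow_zero x
  set b : ι → ι → ℂ := fun i j => if i = j then 1 else 0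
  have hflow : HasTangentMapAt ℝ φ ((familyEval K x).restrictScalars ℝ) 0 :=
    hasTangentMapAt_timeOneFlow (K := K) (fun v => (κ v).2.1) x
  set dζ : (ι → ℂ) → E →L[ℝ] ℂ := fun v =>
    tangentMapAt ℝ (fun y => momentMap (hamFields Ω) Ω y (κ v)) x with hdζ
  have hcomp : ∀ v, HasFDerivAt (fun w => momentMap (hamFields Ω) Ω (φ w) (κ v))
      ((dζ v).comp ((familyEval K x).restrictScalars ℝ)) 0 := fun v => by
    refine hasTangentMapAt_iff_hasFDerivAt.1 (HasTangentMapAt.comp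
      (g := fun y => momentMap (hamFields Ω) Ω y (κ v)) ?_ hflow)
    rw [hφ0]
    exact MDifferentiableAt.hasTangentMapAt
      (((isMomentMap_momentMap hΩ) (κ v)).1.1.mdifferentiable (by simp) x)
  have hexp : HasFDerivAt (𝕜 := ℝ) (fun w => NormedSpace.exp (-coordBracket hΩ κ w) v)
      (-((((coordBracket hΩ κ).flip v)).restrictScalars ℝ)) 0 := by
    have h1 : HasFDerivAt (fun w => -coordBracket hΩ κ w) (-coordBracket hΩ κ) 0 :=
      (coordBracket hΩ κ).hasFDerivAt.neg
    have h2 : HasFDerivAt (𝕜 := ℂ) (NormedSpace.exp : ((ι → ℂ) →L[ℂ] (ι → ℂ)) → _)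
        (1 : ((ι → ℂ) →L[ℂ] (ι → ℂ)) →L[ℂ] _) (-coordBracket hΩ κ 0) := by
      rw [map_zero, neg_zero]
      exact hasFDerivAt_exp_zero
    have h3 := (ContinuousLinearMap.apply ℂ (ι → ℂ) v).hasFDerivAt.comp (0 : ι → ℂ) (h2.comp 0 h1)
    refine (h3.restrictScalars ℝ).congr_fderiv ?_
    ext w
    simp
  -- Expansion in the basis writes the pairing of two varying factors as a finite sum of products of
  -- differentiable functions.
  have hsum : ∀ (u : ι → ℂ) y, momentMap (hamFields Ω) Ω y (κ u) =
      ∑ i, u i * momentMap (hamFields Ω) Ω y (κ (b i)) := fun u y =>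
    (momentMap (hamFields Ω) Ω y ∘ₗ κ.toLinearMap).pi_apply_eq_sum_univ u
  have hterm := fun i => (hasFDerivAt_pi'.1 hexp i).mul (hcomp (b i))
  have hfun := HasFDerivAt.fun_sum fun i (_ : i ∈ Finset.univ) => hterm i
  refine ⟨_, hfun.congr_of_eventuallyEq (Eventually.of_forall fun w => ?_), fun w => ?_⟩
  · simp only
    rw [momentMap_timeOneFlow hΩ, hsum]
    rfl
  -- Uniqueness of the derivative shows that the differential of the moment map is linear in the
  -- field, which reassembles the sum into the derivative of a single potential.
  have h4 : (dζ v).comp ((familyEval K x).restrictScalars ℝ) = _ :=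
    (hcomp v).unique ((HasFDerivAt.fun_sum fun i (_ : i ∈ Finset.univ) =>
      (hcomp (b i)).const_mul (v i)).congr_of_eventuallyEq
        (Eventually.of_forall fun w => hsum v (φ w)))
  have h5 := DFunLike.congr_fun h4 w
  have h6 : (dζ v).comp ((familyEval K x).restrictScalars ℝ) w =
    tangentMapAt ℝ (fun y => momentMap (hamFields Ω) Ω y (κ v)) x (vec (κ w).1 x) := rfl
  rw [momentVariation, ← h6, h5, ← coordBracket_apply, hsum]
  simp only [sum_apply, add_apply, smul_apply, map_zero, neg_zero, NormedSpace.exp_zero, hφ0]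
  rw [← Finset.sum_sub_distrib]
  refine Finset.sum_congr rfl fun i _ => ?_
  simp
  ring

end Differential

/-! ### The Hermitian form at a point and the potential equation -/

section Hermitian

variable {E : Type*} [NormedAddCommGroup E] [NormedSpace ℂ E]
  {M : Type*} [TopologicalSpace M] [ChartedSpace E M] {Ω : TwoTensor E M}

theorem form_I_right (hΩ : IsKahlerForm Ω) (x : M) (u v : E) :
    form Ω x (Complex.I • u) v = -form Ω x u (Complex.I • v) := by
  rw [← form_I_I hΩ x u (Complex.I • v), smul_smul, Complex.I_mul_I, neg_one_smul, map_neg, neg_neg]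

theorem smul_eq_re_add_im (c : ℂ) (u : E) : c • u = c.re • u + c.im • (Complex.I • u) := by
  conv_lhs => rw [← Complex.re_add_im c]
  rw [add_smul, mul_smul]
  rfl

theorem map_complex_smul {G : Type*} [AddCommGroup G] [Module ℝ G] (T : E →ₗ[ℝ] G) (c : ℂ)
    (u : E) : T (c • u) = c.re • T u + c.im • T (Complex.I • u) := by
  rw [smul_eq_re_add_im c u, T.map_add, T.map_smul, T.map_smul]

theorem map_I_smul_complex_smul {G : Type*} [AddCommGroup G] [Module ℝ G] (T : E →ₗ[ℝ] G) (c : ℂ)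
    (u : E) : T (Complex.I • c • u) = c.re • T (Complex.I • u) - c.im • T u := by
  rw [smul_comm, map_complex_smul, smul_smul Complex.I, Complex.I_mul_I, neg_one_smul, T.map_neg,
    smul_neg, sub_eq_add_neg]

/-- The Hermitian form at a point. -/
def hermForm (hΩ : IsKahlerForm Ω) (x : M) : E →ₗ⋆[ℂ] E →ₗ[ℂ] ℂ :=
  LinearMap.mk₂'ₛₗ (starRingEnd ℂ) (RingHom.id ℂ)
    (fun u u' => (form Ω x u (Complex.I • u') : ℂ) + Complex.I * (form Ω x u u' : ℂ))
    (fun u v w => by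
      simp only [map_add, LinearMap.add_apply, Complex.ofReal_add]
      ring)
    (fun c u w => by
      have h1 : ∀ v, form Ω x (c • u) v = c.re * form Ω x u v - c.im * form Ω x u (Complex.I • v) :=
        fun v => by
          rw [smul_eq_re_add_im c u, map_add, map_smul, map_smul, LinearMap.add_apply,
            LinearMap.smul_apply, LinearMap.smul_apply, form_I_right hΩ]
          simp only [smul_eq_mul]
          ring
      rw [h1, h1, smul_smul, Complex.I_mul_I, neg_one_smul, map_neg]
      apply Complex.ext <;> simp
      ring)
    (fun u v w => by
      simp only [smul_add, map_add, Complex.ofReal_add]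
      ring)
    (fun c u w => by
      rw [map_complex_smul (form Ω x u) c w, map_I_smul_complex_smul (form Ω x u)]
      apply Complex.ext <;> simp)

theorem hermForm_apply (hΩ : IsKahlerForm Ω) (x : M) (u u' : E) : hermForm hΩ x u u' =
    (form Ω x u (Complex.I • u') : ℂ) + Complex.I * (form Ω x u u' : ℂ) := rfl

theorem hermForm_conj (hΩ : IsKahlerForm Ω) (x : M) (u u' : E) :
    hermForm hΩ x u u' = conj (hermForm hΩ x u' u) := by
  rw [hermForm_apply, hermForm_apply, form_alt hΩ x u' u, form_alt hΩ x u' (Complex.I • u),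
    form_I_right hΩ]
  apply Complex.ext <;> simp

theorem hermForm_self (hΩ : IsKahlerForm Ω) (x : M) (u : E) :
    hermForm hΩ x u u = (form Ω x u (Complex.I • u) : ℂ) := by
  have h : form Ω x u u = 0 := by linarith [form_alt hΩ x u u]
  rw [hermForm_apply, h]
  simp

theorem herm_eq_hermForm (hΩ : IsKahlerForm Ω) (x : M)
    (Ξ' Ξ : (x : M) → TangentSpace 𝓘(ℂ, E) x) :
    herm Ω x (Ξ' x) (Ξ x) = hermForm hΩ x (vec Ξ x) (vec Ξ' x) := by
  rw [herm_eq, form_I_I hΩ, hermForm_apply]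

/-- The potential equation in Hermitian form: the right-hand side is linear in the field and
conjugate linear in `v`, as the type of `∂̄ζ` demands. -/
theorem IsPotential.add_I_mul (hΩ : IsKahlerForm Ω) {Ξ : (x : M) → TangentSpace 𝓘(ℂ, E) x}
    {ζ : M → ℂ} (h : IsPotential Ω Ξ ζ) (x : M) (v : E) :
    tangentMapAt ℝ ζ x v + Complex.I * tangentMapAt ℝ ζ x (Complex.I • v : E) =
      -Complex.I * hermForm hΩ x v (vec Ξ x) := by
  rw [(isPotential_iff.1 h).2, hermForm_apply, form_alt hΩ x (vec Ξ x) v, form_I_right hΩ,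
    form_alt hΩ x (vec Ξ x), form_I_right hΩ]
  apply Complex.ext <;> simp

/-- With constant imaginary part the differential of `ζ` is real, so this is the conjugate of the
preceding equation. -/
theorem IsPotential.sub_I_mul [FiniteDimensional ℂ E] (hΩ : IsKahlerForm Ω) {Ξ : (x : M) → TangentSpace 𝓘(ℂ, E) x}
    {ζ : M → ℂ} (h : IsPotential Ω Ξ ζ) (him : ∀ x x', (ζ x).im = (ζ x').im) (x : M) (v : E) :
    tangentMapAt ℝ ζ x v - Complex.I * tangentMapAt ℝ ζ x (Complex.I • v : E) =
      Complex.I * hermForm hΩ x (vec Ξ x) v := by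
  have h0 : ∀ v : E, conj ((tangentMapAt ℝ ζ x : E →L[ℝ] ℂ) v) = tangentMapAt ℝ ζ x v := by
    intro v
    rw [Complex.conj_eq_iff_im, ← tangentMapAt_im h.1]
    have h1 : (fun y => (ζ y).im) = fun _ => (ζ x).im := funext fun y => him y x
    rw [h1]
    have h2 : HasTangentMapAt ℝ (fun _ : M => (ζ x).im) (0 : E →L[ℝ] ℝ) x := hasMFDerivAt_const _ _
    rw [h2.eq]
    rfl
  have h3 := congrArg conj (h.add_I_mul hΩ x v)
  rw [map_add, map_mul, h0, h0, map_mul, ← hermForm_conj] at h3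
  simpa [sub_eq_add_neg] using h3

end Hermitian

/-! ### Conjugate linear and complex linear parts of the differential -/

section Forms

variable {E : Type*} [NormedAddCommGroup E] [NormedSpace ℂ E] [FiniteDimensional ℂ E]
  {M : Type*} [TopologicalSpace M] [ChartedSpace E M] [IsManifold 𝓘(ℂ, E) ω M]
  {Ω : TwoTensor E M}

/-- The real subspace of the fields whose real part is a Killing field. -/
def killingFields (hΩ : IsKahlerForm Ω) : Submodule ℝ (hamFields Ω) where
  carrier := {Ξ | IsKilling (metric Ω) (fun x => reVec (Ξ.1 x))}
  zero_mem' := by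
    refine (isKilling_iff hΩ (0 : hamFields Ω).2).2 fun e he y hy u v => ?_
    have h : reading ((0 : hamFields Ω) : (x : M) → TangentSpace 𝓘(ℂ, E) x) e = fun _ => 0 :=
      funext fun z => (tangentMapAt ℝ e (e.symm z) : E →L[ℝ] E).map_zero
    rw [h]
    simp
  add_mem' := fun {Ξ Ξ'} h h' => by
    refine (isKilling_iff hΩ (Ξ + Ξ').2).2 fun e he y hy u v => ?_
    have h1 := (isKilling_iff hΩ Ξ.2).1 h e he y hy u v
    have h2 := (isKilling_iff hΩ Ξ'.2).1 h' e he y hy u v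
    have h3 : reading (Ξ + Ξ').1 e = fun z => reading Ξ.1 e z + reading Ξ'.1 e z :=
      funext fun z => (tangentMapAt ℝ e (e.symm z) : E →L[ℝ] E).map_add (vec Ξ.1 _) (vec Ξ'.1 _)
    rw [h3, fderiv_fun_add ((differentiableOn_reading Ξ.2 he).differentiableAt
      (e.open_target.mem_nhds hy)) ((differentiableOn_reading Ξ'.2 he).differentiableAt
      (e.open_target.mem_nhds hy))]
    simp only [map_add, add_apply]
    linear_combination h1 + h2
  smul_mem' := fun r Ξ h => by
    refine (isKilling_iff hΩ (r • Ξ).2).2 fun e he y hy u v => ?_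
    have h1 := (isKilling_iff hΩ Ξ.2).1 h e he y hy u v
    have h3 : reading (r • Ξ).1 e = fun z => r • reading Ξ.1 e z :=
      funext fun z => (tangentMapAt ℝ e (e.symm z) : E →L[ℝ] E).map_smul r (vec Ξ.1 _)
    rw [h3, fderiv_fun_const_smul ((differentiableOn_reading Ξ.2 he).differentiableAt
      (e.open_target.mem_nhds hy))]
    simp only [map_smul, smul_apply, smul_eq_mul]
    linear_combination r * h1

/-- The weighted sum of the Hermitian forms at the points `p j`. -/
def weightedHerm (hΩ : IsKahlerForm Ω) {n : ℕ} (b : Fin n → ℂ) (p : Fin n → M) :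
    hamFields Ω →ₗ⋆[ℂ] Module.Dual ℂ (hamFields Ω) :=
  LinearMap.mk₂'ₛₗ (starRingEnd ℂ) (RingHom.id ℂ)
    (fun Ξ Ξ' => 1 / 2 * ∑ j, b j * hermForm hΩ (p j) (vec Ξ.1 (p j)) (vec Ξ'.1 (p j)))
    (fun Ξ₁ Ξ₂ Ξ' => by
      have h : ∀ x, vec (Ξ₁ + Ξ₂).1 x = vec Ξ₁.1 x + vec Ξ₂.1 x := fun x => rfl
      simp only [h, map_add, LinearMap.add_apply, mul_add, Finset.sum_add_distrib])
    (fun c Ξ Ξ' => by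
      have h : ∀ x, vec (c • Ξ).1 x = c • vec Ξ.1 x := fun x => rfl
      simp only [h, map_smulₛₗ, LinearMap.smul_apply, smul_eq_mul, Finset.mul_sum]
      exact Finset.sum_congr rfl fun i _ => by ring)
    (fun Ξ Ξ₁ Ξ₂ => by
      have h : ∀ x, vec (Ξ₁ + Ξ₂).1 x = vec Ξ₁.1 x + vec Ξ₂.1 x := fun x => rfl
      simp only [h, map_add, mul_add, Finset.sum_add_distrib])
    (fun c Ξ Ξ' => by
      have h : ∀ x, vec (c • Ξ').1 x = c • vec Ξ'.1 x := fun x => rfl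
      simp only [h, map_smul, RingHom.id_apply, smul_eq_mul, Finset.mul_sum]
      exact Finset.sum_congr rfl fun i _ => by ring)

theorem weightedHerm_apply (hΩ : IsKahlerForm Ω) {n : ℕ} (b : Fin n → ℂ) (p : Fin n → M)
    (Ξ Ξ' : hamFields Ω) : weightedHerm hΩ b p Ξ Ξ' =
      1 / 2 * ∑ j, b j * hermForm hΩ (p j) (vec Ξ.1 (p j)) (vec Ξ'.1 (p j)) := rfl

variable [MeasurableSpace E] [BorelSpace E] [CompactSpace M] [T2Space M]
  [MeasurableSpace M] [BorelSpace M] [ConnectedSpace M]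

/-- The differential of the moment map at a point. -/
def momentDifferential (hΩ : IsKahlerForm Ω) (x : M) : hamFields Ω →ₗ[ℂ] (E →L[ℝ] ℂ) where
  toFun Ξ := tangentMapAt ℝ (fun y => momentMap (hamFields Ω) Ω y Ξ) x
  map_add' Ξ Ξ' := by
    have h := fun Ξ : hamFields Ω => MDifferentiableAt.hasTangentMapAt
      (((isMomentMap_momentMap hΩ) Ξ).1.1.mdifferentiable (by simp) x)
    have h1 : HasTangentMapAt ℝ (fun y => momentMap (hamFields Ω) Ω y (Ξ + Ξ'))
        ((tangentMapAt ℝ (fun y => momentMap (hamFields Ω) Ω y Ξ) x : E →L[ℝ] ℂ)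
          + tangentMapAt ℝ (fun y => momentMap (hamFields Ω) Ω y Ξ') x) x := by
      refine HasTangentMapAt.congr_of_eventuallyEq (HasMFDerivAt.add (h Ξ) (h Ξ'))
        (Eventually.of_forall fun y => ?_)
      exact map_add _ _ _
    exact h1.eq
  map_smul' c Ξ := by
    have h := MDifferentiableAt.hasTangentMapAt
      (((isMomentMap_momentMap hΩ) Ξ).1.1.mdifferentiable (by simp) x)
    have h0 : HasTangentMapAt ℝ (fun z : ℂ => c * z) (ContinuousLinearMap.mul ℝ ℂ c)
        (momentMap (hamFields Ω) Ω x Ξ) :=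
      hasTangentMapAt_iff_hasFDerivAt.2 (ContinuousLinearMap.mul ℝ ℂ c).hasFDerivAt
    have h1 : HasTangentMapAt ℝ (fun y => momentMap (hamFields Ω) Ω y (c • Ξ))
        ((ContinuousLinearMap.mul ℝ ℂ c).comp
          (tangentMapAt ℝ (fun y => momentMap (hamFields Ω) Ω y Ξ) x : E →L[ℝ] ℂ)) x := by
      refine HasTangentMapAt.congr_of_eventuallyEq (HasTangentMapAt.comp
        (f := fun y => momentMap (hamFields Ω) Ω y Ξ) h0 h) (Eventually.of_forall fun y => ?_)
      exact map_smul _ _ _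
    exact h1.eq

theorem momentDifferential_apply (hΩ : IsKahlerForm Ω) (x : M) (Ξ : hamFields Ω) :
    momentDifferential hΩ x Ξ = tangentMapAt ℝ (fun y => momentMap (hamFields Ω) Ω y Ξ) x := rfl

/-- The (1,0)-derivative of `ζ'` in the bracket potential removes that part from the full derivative
of `ζ'`. Only its `∂̄` part remains, which is the Hermitian term, conjugate linear in `Ξ`. The
second summand is complex linear in `Ξ`, because the normalised potential depends linearly on the
field. -/
theorem momentVariation_eq (hΩ : IsKahlerForm Ω) (x : M) (Ξ Ξ' : hamFields Ω) :
    momentVariation hΩ x Ξ Ξ' =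
      -(Complex.I / 2) * hermForm hΩ x (vec Ξ.1 x) (vec Ξ'.1 x)
      + 1 / 2 * (momentDifferential hΩ x Ξ (vec Ξ'.1 x)
        - Complex.I * momentDifferential hΩ x Ξ (Complex.I • vec Ξ'.1 x)) := by
  have h1 : momentMap (hamFields Ω) Ω x (hamBracket hΩ Ξ Ξ') = _ := momentMap_bracket hΩ Ξ Ξ' x
  have h2 := ((isMomentMap_momentMap hΩ) Ξ').1.add_I_mul hΩ x (vec Ξ.1 x)
  rw [momentVariation, h1, bracketPot, momentDifferential_apply]
  linear_combination (1 / 2 : ℂ) * h2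

/-- The complex linear part of the differential. -/
def linearPart (hΩ : IsKahlerForm Ω) {n : ℕ} (b : Fin n → ℂ) (p : Fin n → M) :
    hamFields Ω →ₗ[ℂ] Module.Dual ℂ (hamFields Ω) :=
  LinearMap.mk₂ ℂ (fun Ξ Ξ' => 1 / 2 * ∑ j, b j * (momentDifferential hΩ (p j) Ξ (vec Ξ'.1 (p j))
        - Complex.I * momentDifferential hΩ (p j) Ξ (Complex.I • vec Ξ'.1 (p j))))
    (fun Ξ₁ Ξ₂ Ξ' => by
      simp only [map_add, add_apply, mul_add, Finset.mul_sum, ← Finset.sum_add_distrib]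
      exact Finset.sum_congr rfl fun i _ => by ring)
    (fun c Ξ Ξ' => by
      simp only [map_smul, smul_apply, smul_eq_mul, Finset.mul_sum]
      exact Finset.sum_congr rfl fun i _ => by ring)
    (fun Ξ Ξ₁ Ξ₂ => by
      have h : ∀ x, vec (Ξ₁ + Ξ₂).1 x = vec Ξ₁.1 x + vec Ξ₂.1 x := fun x => rfl
      simp only [h, smul_add, map_add, Finset.mul_sum, ← Finset.sum_add_distrib]
      exact Finset.sum_congr rfl fun i _ => by ring)
    (fun c Ξ Ξ' => by
      have h : ∀ x, vec (c • Ξ').1 x = c • vec Ξ'.1 x := fun x => rfl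
      simp only [h, smul_eq_mul, Finset.mul_sum]
      refine Finset.sum_congr rfl fun i _ => ?_
      have e1 := map_complex_smul (momentDifferential hΩ (p i) Ξ).toLinearMap c (vec Ξ'.1 (p i))
      have e2 := map_I_smul_complex_smul (momentDifferential hΩ (p i) Ξ).toLinearMap c
        (vec Ξ'.1 (p i))
      simp only [ContinuousLinearMap.coe_coe, Complex.real_smul] at e1 e2
      rw [e1, e2]
      have hc := Complex.re_add_im c
      have hI := Complex.I_mul_I
      generalize momentDifferential hΩ (p i) Ξ (vec Ξ'.1 (p i)) = d1
      generalize momentDifferential hΩ (p i) Ξ (Complex.I • vec Ξ'.1 (p i)) = d2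
      linear_combination (1 / 2 * b i * (d1 - Complex.I * d2)) * hc
        + (1 / 2 * b i * c.im * d2) * hI)

theorem linearPart_apply (hΩ : IsKahlerForm Ω) {n : ℕ} (b : Fin n → ℂ) (p : Fin n → M)
    (Ξ Ξ' : hamFields Ω) : linearPart hΩ b p Ξ Ξ' =
      1 / 2 * ∑ j, b j * (momentDifferential hΩ (p j) Ξ (vec Ξ'.1 (p j))
        - Complex.I * momentDifferential hΩ (p j) Ξ (Complex.I • vec Ξ'.1 (p j))) := rfl

theorem sum_momentVariation (hΩ : IsKahlerForm Ω) {n : ℕ} (b : Fin n → ℂ) (p : Fin n → M)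
    (Ξ Ξ' : hamFields Ω) : ∑ j, b j * momentVariation hΩ (p j) Ξ Ξ' =
      -Complex.I * weightedHerm hΩ b p Ξ Ξ' + linearPart hΩ b p Ξ Ξ' := by
  simp only [momentVariation_eq, weightedHerm_apply, linearPart_apply, Finset.mul_sum,
    ← Finset.sum_add_distrib]
  exact Finset.sum_congr rfl fun i _ => by ring

/-- The normalised potential of such a field has constant imaginary part, so `IsPotential.sub_I_mul`
evaluates every summand by the Hermitian form. -/
theorem linearPart_of_mem_killingFields (hΩ : IsKahlerForm Ω) {n : ℕ} (b : Fin n → ℂ)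
    (p : Fin n → M) {Ξ : hamFields Ω} (hΞ : Ξ ∈ killingFields hΩ) :
    linearPart hΩ b p Ξ = Complex.I • weightedHerm hΩ b p Ξ := by
  refine LinearMap.ext fun Ξ' => ?_
  have h := ((isMomentMap_momentMap hΩ) Ξ).1
  rw [LinearMap.smul_apply, linearPart_apply, weightedHerm_apply, smul_eq_mul, Finset.mul_sum,
    Finset.mul_sum, Finset.mul_sum]
  refine Finset.sum_congr rfl fun i _ => ?_
  rw [momentDifferential_apply, h.sub_I_mul hΩ
    (im_potential_const_of_isKilling hΩ Ξ.2 hΞ h)]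
  ring

end Forms

/-! ### Finite dimension, positivity, and the isomorphisms -/

section Assembly

variable {E : Type*} [NormedAddCommGroup E] [NormedSpace ℂ E] [FiniteDimensional ℂ E]
  {M : Type*} [TopologicalSpace M] [ChartedSpace E M] [IsManifold 𝓘(ℂ, E) ω M]
  {Ω : TwoTensor E M} {n : ℕ} {p : Fin n → M}

/-- Evaluation at the points `p j` is an injective linear map into a finite-dimensional space. -/
theorem finiteDimensional_hamFields (hp : ∀ Ξ : hamFields Ω, (∀ j, Ξ.1 (p j) = 0) → Ξ = 0) :
    FiniteDimensional ℂ (hamFields Ω) := by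
  set f : hamFields Ω →ₗ[ℂ] (Fin n → E) :=
    { toFun := fun Ξ j => vec Ξ.1 (p j)
      map_add' := fun _ _ => rfl
      map_smul' := fun _ _ => rfl } with hf
  refine FiniteDimensional.of_injective f ((injective_iff_map_eq_zero f).2 fun Ξ hΞ => ?_)
  exact hp Ξ fun j => congrFun hΞ j

theorem weightedHerm_conj (hΩ : IsKahlerForm Ω) (b : Fin n → ℝ) (Ξ Ξ' : hamFields Ω) :
    weightedHerm hΩ (fun j => (b j : ℂ)) p Ξ Ξ' =
      conj (weightedHerm hΩ (fun j => (b j : ℂ)) p Ξ' Ξ) := by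
  rw [weightedHerm_apply, weightedHerm_apply, map_mul, map_sum]
  congr 1
  · rw [map_div₀, map_one, map_ofNat]
  · refine Finset.sum_congr rfl fun j _ => ?_
    rw [map_mul, Complex.conj_ofReal, ← hermForm_conj]

theorem weightedHerm_self_pos (hΩ : IsKahlerForm Ω) {b : Fin n → ℝ} (hb : ∀ j, 0 < b j)
    (hp : ∀ Ξ : hamFields Ω, (∀ j, Ξ.1 (p j) = 0) → Ξ = 0) {Ξ : hamFields Ω} (hΞ : Ξ ≠ 0) :
    0 < (weightedHerm hΩ (fun j => (b j : ℂ)) p Ξ Ξ).re := by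
  have h0 : ∃ j, vec Ξ.1 (p j) ≠ 0 := by
    by_contra! h
    exact hΞ (hp Ξ h)
  obtain ⟨j, hj⟩ := h0
  have h1 : weightedHerm hΩ (fun j => (b j : ℂ)) p Ξ Ξ = ((1 / 2 * ∑ j, b j *
      form Ω (p j) (vec Ξ.1 (p j)) (Complex.I • vec Ξ.1 (p j)) : ℝ) : ℂ) := by
    rw [weightedHerm_apply]
    push_cast
    simp only [hermForm_self]
  rw [h1, Complex.ofReal_re]
  have h2 : ∀ i, 0 ≤ b i * form Ω (p i) (vec Ξ.1 (p i)) (Complex.I • vec Ξ.1 (p i)) := fun i => by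
    refine mul_nonneg (hb i).le ?_
    by_cases h : vec Ξ.1 (p i) = 0
    · rw [h, map_zero, LinearMap.zero_apply]
    · exact (form_pos hΩ (p i) h).le
  have h3 := Finset.sum_pos' (fun i _ => h2 i)
    ⟨j, Finset.mem_univ j, mul_pos (hb j) (form_pos hΩ (p j) hj)⟩
  linarith

/-- If `B` has nonzero diagonal on `S`, the induced map from `S` to its dual is injective, hence
bijective; symmetry plays no role. Taking `l` on all of `V` loses nothing, since every functional on
`S` extends. -/
theorem existsUnique_mem_of_pos {V : Type*} [AddCommGroup V] [Module ℝ V] [FiniteDimensional ℝ V]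
    (S : Submodule ℝ V) (B : V →ₗ[ℝ] V →ₗ[ℝ] ℝ) (hB : ∀ v ∈ S, v ≠ 0 → B v v ≠ 0)
    (l : V →ₗ[ℝ] ℝ) : ∃! v, v ∈ S ∧ ∀ w ∈ S, B v w = l w := by
  set R : S →ₗ[ℝ] Module.Dual ℝ S := B.compl₁₂ S.subtype S.subtype
  have hinj : Function.Injective R := (injective_iff_map_eq_zero R).2 fun v hv => by
    by_contra h
    exact hB v v.2 (by simpa using h) (DFunLike.congr_fun hv v)
  obtain ⟨v, hv⟩ := (LinearMap.injective_iff_surjective_of_finrank_eq_finrank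
    Subspace.dual_finrank_eq.symm).1 hinj (l.domRestrict S)
  refine ⟨v, ⟨v.2, fun w hw => DFunLike.congr_fun hv ⟨w, hw⟩⟩, fun u hu => ?_⟩
  have h1 : R ⟨u, hu.1⟩ = l.domRestrict S := LinearMap.ext fun w => hu.2 w w.2
  exact congrArg Subtype.val (hinj (h1.trans hv.symm))

theorem exists_linearEquiv_weightedHerm (hΩ : IsKahlerForm Ω) {b : Fin n → ℝ} (hb : ∀ j, 0 < b j)
    (hp : ∀ Ξ : hamFields Ω, (∀ j, Ξ.1 (p j) = 0) → Ξ = 0) :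
    ∃ L : hamFields Ω ≃ₛₗ[starRingEnd ℂ] Module.Dual ℂ (hamFields Ω),
      ∀ Ξ, L Ξ = weightedHerm hΩ (fun j => (b j : ℂ)) p Ξ := by
  have := finiteDimensional_hamFields hp
  have : FiniteDimensional ℝ (hamFields Ω) := FiniteDimensional.complexToReal _
  have : FiniteDimensional ℝ (Module.Dual ℂ (hamFields Ω)) := FiniteDimensional.complexToReal _
  set L := weightedHerm hΩ (fun j => (b j : ℂ)) p with hL
  have hinj : Function.Injective L := (injective_iff_map_eq_zero L).2 fun Ξ hΞ => by
    by_contra h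
    have := weightedHerm_self_pos hΩ hb hp h
    rw [← hL, hΞ] at this
    simp at this
  -- The map is only conjugate linear over `ℂ`, so dimensions are compared over `ℝ`.
  set R : hamFields Ω →ₗ[ℝ] Module.Dual ℂ (hamFields Ω) :=
    { toFun := L
      map_add' := map_add L
      map_smul' := fun r Ξ => by
        rw [← Complex.coe_smul, map_smulₛₗ, Complex.conj_ofReal, Complex.coe_smul]
        rfl } with hR
  have hdim : Module.finrank ℝ (hamFields Ω) = Module.finrank ℝ (Module.Dual ℂ (hamFields Ω)) := by
    rw [finrank_real_of_complex, finrank_real_of_complex, Subspace.dual_finrank_eq]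
  have hsurj : Function.Surjective R :=
    (LinearMap.injective_iff_surjective_of_finrank_eq_finrank hdim).1 hinj
  exact ⟨LinearEquiv.ofBijective L ⟨hinj, hsurj⟩, fun Ξ => rfl⟩

variable [MeasurableSpace E] [BorelSpace E] [CompactSpace M] [T2Space M]
  [MeasurableSpace M] [BorelSpace M] [ConnectedSpace M]

/-- The differential of the weighted sum of the moment maps. -/
def momentSumDifferential (hΩ : IsKahlerForm Ω) (b : Fin n → ℂ) (p : Fin n → M) (c : ℂ) :
    hamFields Ω →ₗ[ℝ] Module.Dual ℂ (hamFields Ω) where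
  toFun Ξ := -Complex.I • weightedHerm hΩ b p (c • Ξ) + linearPart hΩ b p (c • Ξ)
  map_add' Ξ Ξ' := by
    rw [smul_add, map_add, map_add, smul_add]
    abel
  map_smul' r Ξ := by
    rw [← Complex.coe_smul, smul_comm c, (weightedHerm hΩ b p).map_smulₛₗ,
      (linearPart hΩ b p).map_smul, Complex.conj_ofReal, smul_comm (-Complex.I), ← smul_add]
    rfl

theorem momentSumDifferential_apply (hΩ : IsKahlerForm Ω) (b : Fin n → ℂ) (p : Fin n → M) (c : ℂ)
    (Ξ : hamFields Ω) : momentSumDifferential hΩ b p c Ξ =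
      (-Complex.I * conj c) • weightedHerm hΩ b p Ξ + c • linearPart hΩ b p Ξ := by
  rw [mul_smul, ← (weightedHerm hΩ b p).map_smulₛₗ, ← (linearPart hΩ b p).map_smul]
  rfl

/-- The linear part is `i` times the Hermitian one, so the coefficient is `-i c̄ + i c`, which is
real. -/
theorem momentSumDifferential_of_mem_killingFields (hΩ : IsKahlerForm Ω) (b : Fin n → ℂ)
    (c : ℂ) {Ξ : hamFields Ω} (hΞ : Ξ ∈ killingFields hΩ) :
    momentSumDifferential hΩ b p c Ξ = ((-2 * c.im : ℝ) : ℂ) • weightedHerm hΩ b p Ξ := by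
  rw [momentSumDifferential_apply, linearPart_of_mem_killingFields hΩ b p hΞ, smul_smul, ← add_smul]
  congr 1
  apply Complex.ext <;> simp
  ring

theorem momentSumDifferential_I_of_mem_killingFields (hΩ : IsKahlerForm Ω) (b : Fin n → ℂ)
    (c : ℂ) {Ξ : hamFields Ω} (hΞ : Ξ ∈ killingFields hΩ) :
    momentSumDifferential hΩ b p c (Complex.I • Ξ) =
      ((-2 * c.re : ℝ) : ℂ) • weightedHerm hΩ b p Ξ := by
  rw [momentSumDifferential_apply, map_smulₛₗ, map_smul,
    linearPart_of_mem_killingFields hΩ b p hΞ, smul_smul, smul_smul, smul_smul, ← add_smul]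
  congr 1
  apply Complex.ext <;> simp
  ring

/-- The projection to the conjugate linear part kills the complex linear summand. -/
theorem momentSumDifferential_conj_part (hΩ : IsKahlerForm Ω) (b : Fin n → ℂ) (c : ℂ)
    (Ξ : hamFields Ω) : (1 / 2 : ℂ) • (momentSumDifferential hΩ b p c Ξ
      + Complex.I • momentSumDifferential hΩ b p c (Complex.I • Ξ)) =
      (-Complex.I * conj c) • weightedHerm hΩ b p Ξ := by
  rw [momentSumDifferential_apply, momentSumDifferential_apply, map_smulₛₗ, map_smul,
    Complex.conj_I]
  have hI := Complex.I_mul_I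
  refine LinearMap.ext fun Ξ' => ?_
  simp only [LinearMap.smul_apply, LinearMap.add_apply, smul_eq_mul]
  generalize weightedHerm hΩ b p Ξ Ξ' = A
  generalize linearPart hΩ b p Ξ Ξ' = B
  linear_combination (1 / 2 * (Complex.I * conj c * A + c * B)) * hI

/-- On the Killing directions the differential is a nonzero real multiple of a positive definite
form, so its diagonal does not vanish. -/
theorem existsUnique_killing (hΩ : IsKahlerForm Ω) {b : Fin n → ℝ} (hb : ∀ j, 0 < b j)
    (hp : ∀ Ξ : hamFields Ω, (∀ j, Ξ.1 (p j) = 0) → Ξ = 0) {c : ℂ} (hc : c.im ≠ 0)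
    (l : hamFields Ω →ₗ[ℝ] ℝ) : ∃! Ξ : hamFields Ω, Ξ ∈ killingFields hΩ ∧
      ∀ Ξ' ∈ killingFields hΩ,
        (momentSumDifferential hΩ (fun j => (b j : ℂ)) p c Ξ Ξ').re = l Ξ' := by
  have := finiteDimensional_hamFields hp
  have : FiniteDimensional ℝ (hamFields Ω) := FiniteDimensional.complexToReal _
  set D := momentSumDifferential hΩ (fun j => (b j : ℂ)) p c with hD
  set B : hamFields Ω →ₗ[ℝ] hamFields Ω →ₗ[ℝ] ℝ :=
    LinearMap.mk₂ ℝ (fun Ξ Ξ' => (D Ξ Ξ').re)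
      (fun Ξ₁ Ξ₂ Ξ' => by rw [map_add, LinearMap.add_apply, Complex.add_re])
      (fun r Ξ Ξ' => by
        rw [map_smul, ← Complex.coe_smul, LinearMap.smul_apply]
        simp)
      (fun Ξ Ξ₁ Ξ₂ => by rw [map_add, Complex.add_re])
      (fun r Ξ Ξ' => by
        rw [← Complex.coe_smul, map_smul]
        simp) with hB
  refine existsUnique_mem_of_pos (killingFields hΩ) B (fun Ξ hΞ h0 => ?_) l
  have h1 : B Ξ Ξ = (D Ξ Ξ).re := rfl
  have h2 := weightedHerm_self_pos (p := p) hΩ hb hp h0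
  rw [h1, hD, momentSumDifferential_of_mem_killingFields hΩ _ c hΞ, LinearMap.smul_apply,
    smul_eq_mul, Complex.re_ofReal_mul]
  exact mul_ne_zero (mul_ne_zero (by norm_num) hc) h2.ne'

theorem hasRealDifferentialAt_momentSum [FiniteDimensional ℂ (hamFields Ω)]
    (hΩ : IsKahlerForm Ω) (c : ℂ) (a : Fin n → ℝ) :
    HasRealDifferentialAt (momentSum Ω c a p) (momentSumDifferential hΩ
      (fun j => (a j : ℂ) ^ (Module.finrank ℂ E - 1)) p c) 0 := by
  intro Ξ'
  have : T2Space (hamFields Ω) := by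
    have : ∀ x : M, T2Space (TangentSpace 𝓘(ℂ, E) x) := fun x => inferInstanceAs (T2Space E)
    infer_instance
  set κ := (Module.finBasis ℂ (hamFields Ω)).equivFun.symm with hκ
  -- `S` takes the coordinates of `c • Ξ`. It is continuous because the space of fields is finite
  -- dimensional and Hausdorff, so the topology of pointwise convergence is the standard one.
  set S : hamFields Ω →L[ℝ] (Fin (Module.finrank ℂ (hamFields Ω)) → ℂ) :=
    (LinearMap.toContinuousLinearMap (κ.symm.toLinearMap ∘ₗ
      LinearMap.lsmul ℂ (hamFields Ω) c)).restrictScalars ℝ with hS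
  have hSκ : ∀ Ξ, κ (S Ξ) = c • Ξ := fun Ξ => κ.apply_symm_apply _
  choose T hT hT' using fun j => exists_hasFDerivAt_momentMap hΩ κ (κ.symm Ξ') (p j)
  have h1 : HasFDerivAt (fun w => ∑ j, (a j : ℂ) ^ (Module.finrank ℂ E - 1) *
      momentMap (hamFields Ω) (pullback (timeOneFlow fun x => reVec ((κ w).1 x)) Ω) (p j)
        (κ (κ.symm Ξ'))) (∑ j, (a j : ℂ) ^ (Module.finrank ℂ E - 1) • T j) (S 0) := by
    rw [map_zero]
    exact HasFDerivAt.fun_sum fun j _ => (hT j).const_mul _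
  refine ⟨_, fun Ξ => ?_, (hasFDerivAt_comp_continuousLinearMap S h1).congr_of_eventuallyEq
    (Eventually.of_forall fun Ξ => ?_)⟩
  · rw [ContinuousLinearMap.comp_apply, sum_apply]
    simp only [smul_apply, hT', hSκ, κ.apply_symm_apply, smul_eq_mul]
    rw [sum_momentVariation]
    rfl
  · simp only [momentSum, expField, hSκ, κ.apply_symm_apply]
    rw [LinearMap.sum_apply]
    rfl

end Assembly

end KahlerMoment

end

/-! ### The theorem -/

theorem mainTheorem5
    {E : Type*} [NormedAddCommGroup E] [NormedSpace ℂ E] [FiniteDimensional ℂ E]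
    [MeasurableSpace E] [BorelSpace E]
    {M : Type*} [TopologicalSpace M] [ChartedSpace E M] [IsManifold 𝓘(ℂ, E) ω M]
    [CompactSpace M] [ConnectedSpace M] [T2Space M] [MeasurableSpace M] [BorelSpace M]
    (Ω : KahlerMoment.TwoTensor E M) (hΩ : KahlerMoment.IsKahlerForm Ω)
    {n : ℕ} (a : Fin n → ℝ) (ha : ∀ j, 0 < a j) (p : Fin n → M)
    (hp : ∀ Ξ : KahlerMoment.hamFields Ω, (∀ j, Ξ.1 (p j) = 0) → Ξ = 0) :
    ∃ L : KahlerMoment.hamFields Ω ≃ₛₗ[starRingEnd ℂ] Module.Dual ℂ (KahlerMoment.hamFields Ω),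
      -- `L` is the map given by the weighted sum of the Hermitian forms at the points `p j`,
      (∀ Ξ Ξ', L Ξ Ξ' = 1 / 2 * ∑ j, (a j : ℂ) ^ (Module.finrank ℂ E - 1) *
          KahlerMoment.herm Ω (p j) (Ξ'.1 (p j)) (Ξ.1 (p j))) ∧
      -- a positive definite Hermitian form on the space of Hamiltonian holomorphic fields,
      (∀ Ξ Ξ', L Ξ Ξ' = conj (L Ξ' Ξ)) ∧
      (∀ Ξ, Ξ ≠ 0 → 0 < (L Ξ Ξ).re) ∧
      -- and for every normalisation `c` of the exponential the differential `D` exists, where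
      ∀ c : ℂ, ∃ D : KahlerMoment.hamFields Ω →ₗ[ℝ] Module.Dual ℂ (KahlerMoment.hamFields Ω),
        KahlerMoment.HasRealDifferentialAt (KahlerMoment.momentSum Ω c a p) D 0 ∧
        -- `D` is given by `L` on the fields `X - i J X` with `X` Killing,
        (∀ Ξ, KahlerMoment.IsKilling (KahlerMoment.metric Ω)
            (fun x => KahlerMoment.reVec (Ξ.1 x)) →
          D Ξ = ((-2 * c.im : ℝ) : ℂ) • L Ξ ∧
          D (Complex.I • Ξ) = ((-2 * c.re : ℝ) : ℂ) • L Ξ) ∧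
        -- the conjugate linear part of `D` is a multiple of `L`,
        (∀ Ξ, (1 / 2 : ℂ) • (D Ξ + Complex.I • D (Complex.I • Ξ)) =
          (-Complex.I * conj c) • L Ξ) ∧
        -- and the real part of `D` is an isomorphism from the real space of the fields
        -- `X - i J X` with `X` Killing onto its real dual.
        (c.im ≠ 0 → ∀ l : KahlerMoment.hamFields Ω →ₗ[ℝ] ℝ, ∃! Ξ : KahlerMoment.hamFields Ω,
          KahlerMoment.IsKilling (KahlerMoment.metric Ω)
            (fun x => KahlerMoment.reVec (Ξ.1 x)) ∧
          ∀ Ξ' : KahlerMoment.hamFields Ω, KahlerMoment.IsKilling (KahlerMoment.metric Ω)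
            (fun x => KahlerMoment.reVec (Ξ'.1 x)) → (D Ξ Ξ').re = l Ξ') := by
  -- Of the weights only reality and positivity matter below, so the exponent can be hidden in `b`.
  set b : Fin n → ℝ := fun j => a j ^ (Module.finrank ℂ E - 1) with hb
  have hbpos : ∀ j, 0 < b j := fun j => pow_pos (ha j) _
  have hab : (fun j => (a j : ℂ) ^ (Module.finrank ℂ E - 1)) = fun j => (b j : ℂ) :=
    funext fun j => by rw [hb, Complex.ofReal_pow]
  have hfin := KahlerMoment.finiteDimensional_hamFields hp
  obtain ⟨L, hL⟩ := KahlerMoment.exists_linearEquiv_weightedHerm hΩ hbpos hp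
  refine ⟨L, fun Ξ Ξ' => ?_, fun Ξ Ξ' => ?_, fun Ξ hΞ => ?_, fun c =>
    ⟨KahlerMoment.momentSumDifferential hΩ (fun j => (b j : ℂ)) p c, ?_, fun Ξ hΞ => ?_,
      fun Ξ => ?_, fun hc l => ?_⟩⟩
  · rw [hL, ← hab, KahlerMoment.weightedHerm_apply]
    simp only [KahlerMoment.herm_eq_hermForm hΩ]
  · rw [hL, hL]
    exact KahlerMoment.weightedHerm_conj hΩ b Ξ Ξ'
  · rw [hL]
    exact KahlerMoment.weightedHerm_self_pos hΩ hbpos hp hΞ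
  · rw [← hab]
    exact KahlerMoment.hasRealDifferentialAt_momentSum hΩ c a
  · rw [hL]
    exact ⟨KahlerMoment.momentSumDifferential_of_mem_killingFields hΩ _ c hΞ,
      KahlerMoment.momentSumDifferential_I_of_mem_killingFields hΩ _ c hΞ⟩
  · rw [hL]
    exact KahlerMoment.momentSumDifferential_conj_part hΩ _ c Ξ
  · exact KahlerMoment.existsUnique_killing hΩ hbpos hp hc l
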